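/- Setting. Formulas of cut-free, unit-free multiplicative-additive linear logic (MALL) are built from literals $P, P^\perp$ by $\otimes$ (tensor), $\wp$ (par), $\&$ (with), $\oplus$ (plus). A sequent $\Gamma$ is a finite list of formulas, viewed as a parse forest whose leaves are labelled by literals; premises of rules are regarded as sub-forests of conclusions. Two distinct leaves are in conflict if the smallest subformula containing both is a $\&$- or $\oplus$-formula. A *link* on $\Gamma$ is an unordered pair of leaves with dual labels. A *linking* on $\Gamma$ is a slicing whose links form a non-empty clique, that is, a non-empty finite set of pairwise disjoint links, regarded as a relation from the coherence space in which all its links are pairwise coherent to the coherence space of leaves of $\Gamma$, which is a map of coherence spaces (it preserves strict coherence and reflects conflict) and is maximal among such maps. A *linking-set* (slice net) $\Lambda$ on $\Gamma$ is a finite set of linkings on $\Gamma$. The number $l$ of links of $\Lambda$ is $\sum_{\lambda\in\Lambda}|\lambda|$ (links counted linking by linking), and $g$ is the number of vertices of $\Gamma$. Let $G(\Lambda,\Gamma)$ be the graph of $\Gamma$ together with all links of linkings in $\Lambda$; $\Lambda$ is *connected* if $\Lambda\ne\emptyset$ and $G(\Lambda,\Gamma)$ is connected. Translation. A MALL proof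 translates to a linking-set on its conclusion: an axiom on $P,P^\perp$ gives $\{\{\text{its link}\}\}$; permutation, $\wp$ and $\oplus$ rules change nothing; a $\otimes$-rule turns $\Lambda,M$ into $\{\lambda\cup\mu:\lambda\in\Lambda,\mu\in M\}$; a $\&$-rule turns $\Lambda,M$ into $\Lambda\cup M$. $\Lambda$ is *sequentializable* (correct) if it is the translation of some proof. Erasure. Let $\Lambda$ be connected and let $r$ be the root of a formula $A_0\,\square\,A_1$ of $\Gamma$. The root $r$ is *ready*, with result $\Lambda\setminus r$, as follows. - $\square=\wp $: always ready; the result is $\Lambda$ on $\Gamma$ with $A_0,A_1$ in place of $A_0\wp A_1$. - $\square=\&$: always ready; the result is $\Lambda_0$ and $\Lambda_1$, where $\Lambda_i$ consists of the linkings having a link with a leaf in $A_i$, on $\Gamma$ with $A_i$ in place of $A_0\& A_1$. - $\square=\oplus$: ready if for some $i$ no link of $\Lambda$ has a leaf in $A_i$; the result is $\Lambda$ on $\Gamma$ with $A_{1-i}$ in place of $A_0\oplus A_1$. - $\square=\otimes$: ready if deleting $r$ disconnects $G(\Lambda,\Gamma)$ into two components, $A_i$ in the $i$-th one, with underlying sequents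 $\Delta_0,\Delta_1$, and $n=n_0 n_1$, where $n=|\Lambda|$, $n_i=|\Lambda_i|$ and $\Lambda_i$ is the set of restrictions to $\Delta_i$ of the linkings in $\Lambda$; the result is $\Lambda_0$ on $\Delta_0$ and $\Lambda_1$ on $\Delta_1$. A *cluster* is a finite set of linking-sets on sequents, or an error symbol $\mathsf E$. The steps of erasure $\leadsto$ are: $Y\leadsto\mathsf E$ if $Y$ contains a disconnected linking-set; and, when all members of $X\cup\{\Lambda\}$ are connected and $\Lambda\notin X$, $X\cup\{\Lambda\}\leadsto X\cup(\Lambda\setminus r)$ for $r$ a ready root of $\Lambda$, and $X\cup\{\Lambda\}\leadsto X$ if $\Lambda$ consists of one linking with one link, on a sequent $P,P^\perp$. $\Lambda$ is *erasable* if $\{\Lambda\}\leadsto^*\emptyset$. Theorem. 1. There are a WHILE program over binary trees (with its usual step count) and a polynomial $p$ such that, for every linking-set $\Lambda$ on every sequent $\Gamma$, given as a list of formulas and a list of lists of pairs of leaf numbers, the program halts within $p(l+g)$ steps and decides whether $\Lambda$ is correct, i.e. sequentializable. 2. Erasure is confluent: if $X\leadsto^*Y_0$ and $X\leadsto^*Y_1$,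 then $Y_0\leadsto^*Z$ and $Y_1\leadsto^*Z$ for some $Z$. 3. Erasure is terminating: no infinite sequence of steps starts at any cluster. 4. There is a polynomial $q$ such that every sequence of erasure steps starting at $\{\Lambda\}$ has length at most $q(l+g)$. 5. $\Lambda$ is erasable if and only if it is sequentializable. -/

import Mathlib

namespace MALL

/-! ### Formulas and sequents as labelled parse forests -/

/-- A literal: a propositional atom or its formal negation. -/
structure Literal where
  atom : ℕ
  positive : Bool
deriving DecidableEq

/-- The dual of a literal. -/
def Literal.dual (P : Literal) : Literal := ⟨P.atom, !P.positive⟩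

/-- The four binary connectives: tensor, par, `amp` (with) and plus. -/
inductive Conn where
  | tensor
  | par
  | amp
  | plus
deriving DecidableEq

/-- A formula, as a parse tree. A leaf carries its identity `x` (the name of the leaf as a vertex
of the parse forest) and its literal label `P`. -/
inductive Formula where
  | leaf (x : ℕ) (P : Literal)
  | bin (c : Conn) (A B : Formula)
deriving DecidableEq

/-- The leaves of a formula, from left to right. -/
def Formula.leaves : Formula → List ℕ
  | .leaf x _ => [x]
  | .bin _ A B => A.leaves ++ B.leaves

/-- The vertices of a parse tree; each vertex is represented by the subtree above it. -/
def Formula.vertices : Formula → List Formula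
  | .leaf x P => [.leaf x P]
  | .bin c A B => .bin c A B :: (A.vertices ++ B.vertices)

/-- A sequent, as a parse forest, listed from left to right. -/
abbrev Sequent := List Formula

namespace Sequent

/-- The leaves of a sequent, from left to right. -/
def leaves (Γ : Sequent) : List ℕ := Γ.flatMap Formula.leaves

/-- The vertices of a parse forest. When distinct leaves have distinct names, distinct vertices
are represented by distinct subtrees. -/
def vertices (Γ : Sequent) : List Formula := Γ.flatMap Formula.vertices

/-- Distinct leaves have distinct names, so that `Γ` is a forest with named leaves. -/
def WellNamed (Γ : Sequent) : Prop := Γ.leaves.Nodup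

/-- The set of leaves of `Γ`, as a type. -/
abbrev Leaf (Γ : Sequent) : Type := {x : ℕ // x ∈ Γ.leaves}

/-- The leaves `x` and `y` have dual labels. -/
def DualLeaves (Γ : Sequent) (x y : Γ.Leaf) : Prop :=
  ∃ P : Literal, .leaf x.1 P ∈ Γ.vertices ∧ .leaf y.1 P.dual ∈ Γ.vertices

/-- The coherence space of `Γ`, given by its conflict graph: two leaves are in conflict when the
smallest subformula containing them is additive. -/
def coh (Γ : Sequent) : SimpleGraph Γ.Leaf :=
  SimpleGraph.fromRel fun x y => ∃ c A B, .bin c A B ∈ Γ.vertices ∧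
    (c = .amp ∨ c = .plus) ∧ x.1 ∈ A.leaves ∧ y.1 ∈ B.leaves

/-- Replace the formula `r` of `Γ` by the formulas `As`, in place. -/
def subst (Γ : Sequent) (r : Formula) (As : List Formula) : Sequent :=
  Γ.flatMap fun C => if C = r then As else [C]

end Sequent

/-! ### Coherence spaces, slicings and linkings

A coherence space is given by the graph of its conflict (strict incoherence) relation on its
tokens; two tokens are strictly coherent when they are distinct and not in conflict. -/

/-- Maps of coherence spaces preserve strict coherence and reflect conflict. -/
structure IsCohMap {X Y : Type} (G : SimpleGraph X) (H : SimpleGraph Y) (R : X → Y → Prop) :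
    Prop where
  preserves : ∀ x₁ x₂ y₁ y₂, R x₁ y₁ → R x₂ y₂ → x₁ ≠ x₂ → ¬ G.Adj x₁ x₂ →
    y₁ ≠ y₂ ∧ ¬ H.Adj y₁ y₂
  reflects : ∀ x₁ x₂ y₁ y₂, R x₁ y₁ → R x₂ y₂ → H.Adj y₁ y₂ → G.Adj x₁ x₂

/-- Maximality with respect to inclusion among maps. -/
def IsMaximalCohMap {X Y : Type} (G : SimpleGraph X) (H : SimpleGraph Y) (R : X → Y → Prop) :
    Prop :=
  IsCohMap G H R ∧ ∀ S : X → Y → Prop, IsCohMap G H S → (∀ x y, R x y → S x y) →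
    ∀ x y, S x y → R x y

/-- A coherence space is contractible if it is finite and its conflict graph is `P₄`-free. -/
def Contractible {X : Type} (G : SimpleGraph X) : Prop :=
  Finite X ∧ ∀ x₁ x₂ x₃ x₄ : X, [x₁, x₂, x₃, x₄].Nodup →
    G.Adj x₁ x₂ → G.Adj x₂ x₃ → G.Adj x₃ x₄ → G.Adj x₁ x₃ ∨ G.Adj x₂ x₄ ∨ G.Adj x₁ x₄

/-- A slicing on `Γ`: a maximal map from a contractible coherence space of links to the coherence
space of `Γ`, under which every link is a dual pair and overlapping links are in conflict. -/
structure IsSlicing (Γ : Sequent) {L : Type} (G : SimpleGraph L) (R : L → Γ.Leaf → Prop) :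
    Prop where
  contractible : Contractible G
  maximal : IsMaximalCohMap G Γ.coh R
  dualPair : ∀ l, ∃ x y, Γ.DualLeaves x y ∧ ∀ z, R l z ↔ z = x ∨ z = y
  overlap : ∀ l m x, R l x → R m x → l ≠ m → G.Adj l m

/-- A link: an unordered pair of leaves. -/
abbrev Link := Sym2 ℕ

/-- `lam` is a linking of a slice net on `Γ`: a slicing whose links form a non-empty clique. -/
def IsLinking (Γ : Sequent) (lam : Finset Link) : Prop :=
  lam.Nonempty ∧ IsSlicing Γ (⊥ : SimpleGraph {l // l ∈ lam}) (fun l x => x.1 ∈ l.1)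

/-- The data of a set of linkings on a sequent. -/
structure LinkingSet where
  seq : Sequent
  linkings : Finset (Finset Link)
deriving DecidableEq

namespace LinkingSet

/-- `Λ` is a set of linkings on its sequent. -/
def Valid (Λ : LinkingSet) : Prop :=
  Λ.seq.WellNamed ∧ ∀ lam ∈ Λ.linkings, IsLinking Λ.seq lam

/-- The number of links, summed over the linkings. -/
def numLinks (Λ : LinkingSet) : ℕ := ∑ lam ∈ Λ.linkings, lam.card

/-- The number of sequent vertices. -/
def numVertices (Λ : LinkingSet) : ℕ := Λ.seq.vertices.length

/-- The set of vertices of the sequent. -/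
def verts (Λ : LinkingSet) : Set Formula := {B | B ∈ Λ.seq.vertices}

/-- The graph comprising the sequent and all links, with edges restricted to vertices in `S`. -/
def graphOn (Λ : LinkingSet) (S : Set Formula) : SimpleGraph Formula :=
  SimpleGraph.fromRel fun B C => B ∈ S ∧ C ∈ S ∧
    ((∃ c D, B = .bin c C D ∨ B = .bin c D C) ∨
      ∃ x P y Q, B = .leaf x P ∧ C = .leaf y Q ∧ ∃ lam ∈ Λ.linkings, s(x, y) ∈ lam)

/-- Non-empty, with connected graph. -/
def Connected (Λ : LinkingSet) : Prop :=
  Λ.linkings.Nonempty ∧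
    ∀ B ∈ Λ.verts, ∀ C ∈ Λ.verts, (Λ.graphOn Λ.verts).Reachable B C

/-- Some link has a leaf in `A`. -/
def Touches (Λ : LinkingSet) (A : Formula) : Prop :=
  ∃ lam ∈ Λ.linkings, ∃ l ∈ lam, ∃ x ∈ l, x ∈ A.leaves

open Classical in
/-- The sequent underlying the component of `A` after deleting the root `r`, where `A` is an
immediate subformula of `r`. -/
noncomputable def splitSeq (Λ : LinkingSet) (r A : Formula) : Sequent :=
  (Λ.seq.subst r [A]).filter fun C => (Λ.graphOn (Λ.verts \ {r})).Reachable A C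

open Classical in
/-- Restrict every linking to a sub-forest `Δ`. -/
noncomputable def restrict (Λ : LinkingSet) (Δ : Sequent) : LinkingSet :=
  ⟨Δ, Λ.linkings.image fun lam => lam.filter fun l => ∀ x ∈ l, x ∈ Δ.leaves⟩

/-- The half `Λ_A` on the component of `A`, in the erasure of a tensor root `r`. -/
noncomputable def split (Λ : LinkingSet) (r A : Formula) : LinkingSet :=
  Λ.restrict (Λ.splitSeq r A)

/-- The linkings having a link with a leaf in `A`, on the sequent with `A` in place of `r`. -/
def choose (Λ : LinkingSet) (r A : Formula) : LinkingSet :=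
  ⟨Λ.seq.subst r [A], Λ.linkings.filter fun lam => ∃ l ∈ lam, ∃ x ∈ A.leaves, x ∈ l⟩

/-- Readiness of a root (given by its formula) of a connected set of linkings. -/
def Ready (Λ : LinkingSet) : Formula → Prop
  | .leaf _ _ => False
  | .bin .par _ _ => True
  | .bin .amp _ _ => True
  | .bin .plus A B => ¬ Λ.Touches A ∨ ¬ Λ.Touches B
  | .bin .tensor A B =>
      ¬ (Λ.graphOn (Λ.verts \ {.bin .tensor A B})).Reachable A B ∧
      Λ.linkings.card =
        (Λ.split (.bin .tensor A B) A).linkings.card *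
          (Λ.split (.bin .tensor A B) B).linkings.card

open Classical in
/-- The result of erasing a ready root. -/
noncomputable def erase (Λ : LinkingSet) : Formula → Finset LinkingSet
  | .leaf _ _ => ∅
  | .bin .par A B => {⟨Λ.seq.subst (.bin .par A B) [A, B], Λ.linkings⟩}
  | .bin .amp A B => {Λ.choose (.bin .amp A B) A, Λ.choose (.bin .amp A B) B}
  | .bin .plus A B =>
      if Λ.Touches A then {⟨Λ.seq.subst (.bin .plus A B) [A], Λ.linkings⟩}
      else {⟨Λ.seq.subst (.bin .plus A B) [B], Λ.linkings⟩}
  | .bin .tensor A B => {Λ.split (.bin .tensor A B) A, Λ.split (.bin .tensor A B) B}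

/-- A single linking with a single link, on a sequent `P, P⊥`. -/
def IsAxiom (Λ : LinkingSet) : Prop :=
  ∃ x y P, Λ.seq = [.leaf x P, .leaf y P.dual] ∧ Λ.linkings = {{s(x, y)}}

end LinkingSet

/-! ### Erasure on clusters -/

/-- A cluster: a finite set of linking-sets, or the error symbol. -/
inductive Cluster where
  | error
  | sets (X : Finset LinkingSet)

/-- All members are sets of linkings on their sequents. -/
def Cluster.Valid : Cluster → Prop
  | .error => True
  | .sets X => ∀ Λ ∈ X, Λ.Valid

/-- One erasure step. -/
inductive Step : Cluster → Cluster → Prop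
  | toError {Y : Finset LinkingSet} {Λ : LinkingSet} (mem : Λ ∈ Y) (disc : ¬ Λ.Connected) :
      Step (.sets Y) .error
  | root {X : Finset LinkingSet} {Λ : LinkingSet} {r : Formula} (fresh : Λ ∉ X)
      (conn : ∀ M ∈ X, M.Connected) (conn' : Λ.Connected) (mem : r ∈ Λ.seq)
      (ready : Λ.Ready r) :
      Step (.sets (insert Λ X)) (.sets (X ∪ Λ.erase r))
  | ax {X : Finset LinkingSet} {Λ : LinkingSet} (fresh : Λ ∉ X)
      (conn : ∀ M ∈ X, M.Connected) (isAx : Λ.IsAxiom) :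
      Step (.sets (insert Λ X)) (.sets X)

/-- Finitely many (possibly zero) erasure steps. -/
abbrev Steps : Cluster → Cluster → Prop := Relation.ReflTransGen Step

/-- A linking-set is erasable if it reduces to the empty cluster. -/
def LinkingSet.Erasable (Λ : LinkingSet) : Prop := Steps (.sets {Λ}) (.sets ∅)

/-! ### Proofs and their translation -/

/-- Cut-free MALL proofs, of sequents seen as parse forests with named leaves: every sequent above
the line is a sub-forest of the sequent below the line. -/
inductive Proof : Sequent → Type
  | ax (x y : ℕ) (P : Literal) : Proof [.leaf x P, .leaf y P.dual]
  | perm {Γ Δ : Sequent} (h : List.Perm Γ Δ) (p : Proof Γ) : Proof Δ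
  | par {Γ : Sequent} {A B : Formula} (p : Proof (Γ ++ [A, B])) : Proof (Γ ++ [.bin .par A B])
  | plus₀ {Γ : Sequent} {A : Formula} (B : Formula) (p : Proof (Γ ++ [A])) :
      Proof (Γ ++ [.bin .plus A B])
  | plus₁ {Γ : Sequent} (A : Formula) {B : Formula} (p : Proof (Γ ++ [B])) :
      Proof (Γ ++ [.bin .plus A B])
  | tensor {Γ Δ : Sequent} {A B : Formula} (p : Proof (Γ ++ [A])) (q : Proof (B :: Δ)) :
      Proof (Γ ++ .bin .tensor A B :: Δ)
  | amp {Γ : Sequent} {A B : Formula} (p : Proof (Γ ++ [A])) (q : Proof (Γ ++ [B])) :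
      Proof (Γ ++ [.bin .amp A B])

/-- The set of linkings that a proof translates to, one axiom linking per slice. -/
def Proof.translate : {Γ : Sequent} → Proof Γ → Finset (Finset Link)
  | _, .ax x y _ => {{s(x, y)}}
  | _, .perm _ p => p.translate
  | _, .par p => p.translate
  | _, .plus₀ _ p => p.translate
  | _, .plus₁ _ p => p.translate
  | _, .tensor p q => Finset.image₂ (· ∪ ·) p.translate q.translate
  | _, .amp p q => p.translate ∪ q.translate

/-- A linking-set is sequentializable if it is the translation of a proof. -/
def LinkingSet.Sequentializable (Λ : LinkingSet) : Prop :=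
  ∃ p : Proof Λ.seq, p.translate = Λ.linkings

end MALL

/-! ### A machine model with a step count: `WHILE` programs over binary trees -/

namespace WhileLang

/-- The values: binary trees. -/
inductive Data where
  | nil
  | cons (d e : Data)
deriving DecidableEq

/-- The head of a tree. -/
def Data.hd : Data → Data
  | .nil => .nil
  | .cons d _ => d

/-- The tail of a tree. -/
def Data.tl : Data → Data
  | .nil => .nil
  | .cons _ e => e

/-- Expressions over program variables. -/
inductive Expr where
  | var (i : ℕ)
  | nil
  | cons (e f : Expr)
  | hd (e : Expr)
  | tl (e : Expr)

/-- The contents of the program variables. -/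
abbrev Store := ℕ → Data

/-- Evaluation of expressions. -/
def Expr.eval (s : Store) : Expr → Data
  | .var i => s i
  | .nil => .nil
  | .cons e f => .cons (e.eval s) (f.eval s)
  | .hd e => (e.eval s).hd
  | .tl e => (e.eval s).tl

/-- The time to evaluate an expression: one unit for each operation. -/
def Expr.time : Expr → ℕ
  | .var _ => 1
  | .nil => 1
  | .cons e f => e.time + f.time + 1
  | .hd e => e.time + 1
  | .tl e => e.time + 1

/-- Programs; the value `nil` counts as false in tests, all other values as true. -/
inductive Prog where
  | assign (i : ℕ) (e : Expr)
  | seq (p q : Prog)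
  | ite (e : Expr) (p q : Prog)
  | loop (e : Expr) (p : Prog)

/-- `Exec p s s' t`: started in the store `s`, the program `p` halts in the store `s'` after
time `t`. -/
inductive Exec : Prog → Store → Store → ℕ → Prop
  | assign (i : ℕ) (e : Expr) (s : Store) :
      Exec (.assign i e) s (Function.update s i (e.eval s)) (e.time + 1)
  | seq {p q : Prog} {s s' s'' : Store} {t t' : ℕ} (h : Exec p s s' t) (h' : Exec q s' s'' t') :
      Exec (.seq p q) s s'' (t + t')
  | iteTrue {e : Expr} {p q : Prog} {s s' : Store} {t : ℕ} (he : e.eval s ≠ .nil)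
      (h : Exec p s s' t) : Exec (.ite e p q) s s' (e.time + 1 + t)
  | iteFalse {e : Expr} {p q : Prog} {s s' : Store} {t : ℕ} (he : e.eval s = .nil)
      (h : Exec q s s' t) : Exec (.ite e p q) s s' (e.time + 1 + t)
  | loopTrue {e : Expr} {p : Prog} {s s' s'' : Store} {t t' : ℕ} (he : e.eval s ≠ .nil)
      (h : Exec p s s' t) (h' : Exec (.loop e p) s' s'' t') :
      Exec (.loop e p) s s'' (e.time + 1 + t + t')
  | loopFalse {e : Expr} {p : Prog} {s : Store} (he : e.eval s = .nil) :
      Exec (.loop e p) s s (e.time + 1)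

/-- The initial store: the input in variable `0`, all other variables `nil`. -/
def initStore (d : Data) : Store := Function.update (fun _ => Data.nil) 0 d

/-- Unary encoding of numbers. -/
def encNat : ℕ → Data
  | 0 => .nil
  | n + 1 => .cons .nil (encNat n)

/-- Encoding of lists. -/
def encList {α : Type} (f : α → Data) : List α → Data
  | [] => .nil
  | a :: l => .cons (f a) (encList f l)

end WhileLang

namespace MALL

open WhileLang

/-- Encoding of literals. -/
def Literal.enc (P : Literal) : Data :=
  .cons (encNat P.atom) (encNat P.positive.toNat)

/-- Encoding of connectives, by non-`nil` codes. -/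
def Conn.enc : Conn → Data
  | .tensor => encNat 1
  | .par => encNat 2
  | .amp => encNat 3
  | .plus => encNat 4

/-- Encoding of formulas, where `pos` numbers the leaves. -/
def Formula.enc (pos : ℕ → ℕ) : Formula → Data
  | .leaf x P => .cons .nil (.cons (encNat (pos x)) P.enc)
  | .bin c A B => .cons c.enc (.cons (A.enc pos) (B.enc pos))

/-- Numbering of the leaves of `Γ` from left to right. -/
def Sequent.pos (Γ : Sequent) (x : ℕ) : ℕ := Γ.leaves.idxOf x

/-- The linking listed by a list of pairs. -/
def linkingOf (ps : List (ℕ × ℕ)) : Finset Link := (ps.map fun q => s(q.1, q.2)).toFinset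

/-- `Ls` lists the linkings of `Λ`, and each linking its links, without repetition. -/
def Lists (Ls : List (List (ℕ × ℕ))) (Λ : LinkingSet) : Prop :=
  (∀ ps ∈ Ls, (ps.map fun q => s(q.1, q.2)).Nodup) ∧ (Ls.map linkingOf).Nodup ∧
    (Ls.map linkingOf).toFinset = Λ.linkings

/-- The machine input for a linking-set on `Γ` whose linkings are listed by `Ls`; links refer to
leaves by their left-to-right numbers. -/
def input (Γ : Sequent) (Ls : List (List (ℕ × ℕ))) : Data :=
  .cons (encList (Formula.enc Γ.pos) Γ)
    (encList (encList fun q => .cons (encNat (Γ.pos q.1)) (encNat (Γ.pos q.2))) Ls)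

end MALL

/-! ### Leaves, labels and meeting points in parse forests -/

namespace MALL

/-! A linking matters mainly through the leaves that it covers. Its links are pairwise coherent, so
no two covered leaves conflict; its maximality makes every uncovered leaf conflict with a covered
one. Hence the covered leaves form an additive resolution of every root: they resolve both arguments
of a tensor or par and exactly one argument of a with or plus (`IsLinking.resolves`). The predicate
`Good` records this together with duality of links and distinctness of names. Erasure preserves it,
and the study of erasure uses nothing else.

Erasing a par, with or plus replaces the root by arguments and keeps the linkings that meet what is
left (`branch`). Erasing a ready tensor cuts along a leaf set `T` that no link and no other root
crosses (`half`). The condition n = n₀n₁ says exactly that the linkings are all combinations of a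
part inside `T` and a part outside (`PreSplit.prod_of_card`). Give a linking-set with n linkings and
v vertices the weight nv. At a with the linkings are shared out and each sequent loses a vertex. At
a tensor the vertices are shared out, and n₀v₀ + n₁v₁ ≤ n₀n₁(v₀ + v₁) < nv. So the total weight
drops at each step, which gives termination and the bound 1 + nv on the length of a path.

Confluence is proved through an invariant. `outcome` is the set of stuck linking-sets reached by
some fixed strategy, or `⊤` for an error. Erasures of distinct roots commute, and a disconnected set
always has a disconnected result, so by induction on weight the outcome of a set is the supremum of
the outcomes of its results, whichever root is erased (`outcome_le_iff`). Steps therefore preserve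
the outcome of a cluster, and every cluster reduces to the irreducible cluster described by its
outcome. Two reducts of one cluster share this normal form.

Erasable now means that the outcome is `⊥`, the empty set. Read upwards, an erasure is an inference
rule of a proof; read downwards, the last rule of a proof is a legitimate erasure, and by invariance
it is as good as any other. So erasability and sequentializability agree (`sequentializable_iff`).

The same invariance makes a greedy algorithm correct: keep a list of nets, and erase any ready root
of the first one until the list is empty or a net is stuck or disconnected. The weight bounds the
number of rounds, and no net outgrows the input. Polynomial running time is established
compositionally, in a class of functions on encoded types that is closed under pairing, branching,
bounded iteration and list operations. -/

theorem Formula.leaves_ne_nil (F : Formula) : F.leaves ≠ [] := by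
  induction F with
  | leaf x P => simp [Formula.leaves]
  | bin c A B ihA ihB => simp [Formula.leaves, ihA]

theorem Formula.exists_mem_leaves (F : Formula) : ∃ x, x ∈ F.leaves :=
  List.exists_mem_of_ne_nil _ F.leaves_ne_nil

theorem Formula.mem_vertices_self (F : Formula) : F ∈ F.vertices := by
  cases F <;> simp [Formula.vertices]

theorem Formula.leaves_sublist {F G : Formula} (h : G ∈ F.vertices) :
    G.leaves.Sublist F.leaves := by
  induction F with
  | leaf x P =>
    simp only [Formula.vertices, List.mem_singleton] at h
    subst h; exact List.Sublist.refl _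
  | bin c A B ihA ihB =>
    simp only [Formula.vertices, List.mem_cons, List.mem_append] at h
    rcases h with rfl | h | h
    · exact List.Sublist.refl _
    · exact (ihA h).trans (List.sublist_append_left _ _)
    · exact (ihB h).trans (List.sublist_append_right _ _)

theorem Formula.vertices_trans {F G H : Formula} (h : G ∈ F.vertices) (h' : H ∈ G.vertices) :
    H ∈ F.vertices := by
  induction F with
  | leaf x P =>
    simp only [Formula.vertices, List.mem_singleton] at h
    subst h; exact h'
  | bin c A B ihA ihB =>
    simp only [Formula.vertices, List.mem_cons, List.mem_append] at h ⊢
    rcases h with rfl | h | h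
    · simpa [Formula.vertices] using h'
    · exact .inr (.inl (ihA h))
    · exact .inr (.inr (ihB h))

theorem Formula.mem_leaves_iff {F : Formula} {x : ℕ} :
    x ∈ F.leaves ↔ ∃ P, .leaf x P ∈ F.vertices := by
  induction F with
  | leaf y Q => simp [Formula.leaves, Formula.vertices]
  | bin c A B ihA ihB => simp [Formula.leaves, Formula.vertices, ihA, ihB, exists_or]

theorem Formula.left_mem_vertices (c : Conn) (A B : Formula) : A ∈ (Formula.bin c A B).vertices := by
  simp [Formula.vertices, A.mem_vertices_self]

theorem Formula.right_mem_vertices (c : Conn) (A B : Formula) :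
    B ∈ (Formula.bin c A B).vertices := by
  simp [Formula.vertices, B.mem_vertices_self]

theorem Formula.label_unique {F : Formula} (nd : F.leaves.Nodup) {x : ℕ} {P Q : Literal}
    (hP : .leaf x P ∈ F.vertices) (hQ : .leaf x Q ∈ F.vertices) : P = Q := by
  induction F with
  | leaf y R => simp_all [Formula.vertices]
  | bin c A B ihA ihB =>
    simp only [Formula.leaves, List.nodup_append] at nd
    obtain ⟨ndA, ndB, hd⟩ := nd
    simp only [Formula.vertices, List.mem_cons, List.mem_append, reduceCtorEq, false_or] at hP hQ
    rcases hP with hP | hP <;> rcases hQ with hQ | hQ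
    · exact ihA ndA hP hQ
    · exact absurd rfl (hd x (mem_leaves_iff.2 ⟨_, hP⟩) x (mem_leaves_iff.2 ⟨_, hQ⟩))
    · exact absurd rfl (hd x (mem_leaves_iff.2 ⟨_, hQ⟩) x (mem_leaves_iff.2 ⟨_, hP⟩))
    · exact ihB ndB hP hQ

/-- The node of a forest at which two of its leaves part is unique. -/
theorem Formula.meet_unique {F : Formula} (nd : F.leaves.Nodup) {c c' : Conn}
    {A B A' B' : Formula} {x y : ℕ} (h : .bin c A B ∈ F.vertices) (h' : .bin c' A' B' ∈ F.vertices)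
    (hx : x ∈ A.leaves) (hy : y ∈ B.leaves)
    (hxy : (x ∈ A'.leaves ∧ y ∈ B'.leaves) ∨ (y ∈ A'.leaves ∧ x ∈ B'.leaves)) : c = c' := by
  induction F with
  | leaf z R => simp [Formula.vertices] at h
  | bin d C D ihC ihD =>
    simp only [Formula.leaves, List.nodup_append] at nd
    obtain ⟨ndC, ndD, hd⟩ := nd
    have key : ∀ {e : Conn} {E G H : Formula}, .bin e G H ∈ E.vertices → ∀ z,
        z ∈ G.leaves ∨ z ∈ H.leaves → z ∈ E.leaves := fun hm z hz =>
      (leaves_sublist hm).subset (by simpa [Formula.leaves] using hz)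
    simp only [Formula.vertices, List.mem_cons, List.mem_append, Formula.bin.injEq] at h h'
    rcases h with ⟨rfl, rfl, rfl⟩ | h | h <;> rcases h' with ⟨rfl, rfl, rfl⟩ | h' | h'
    · rfl
    · have h1 := key h' x (by tauto)
      have h2 := key h' y (by tauto)
      exact absurd rfl (hd y h2 y hy)
    · have h1 := key h' x (by tauto)
      exact absurd rfl (hd x hx x h1)
    · have h1 := key h x (by tauto)
      have h2 := key h y (by tauto)
      rcases hxy with ⟨_, h3⟩ | ⟨_, h3⟩
      · exact absurd rfl (hd y h2 y h3)
      · exact absurd rfl (hd x h1 x h3)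
    · exact ihC ndC h h'
    · exact absurd rfl (hd x (key h x (by tauto)) x (key h' x (by tauto)))
    · have h1 := key h x (by tauto)
      have h2 := key h y (by tauto)
      rcases hxy with ⟨h3, _⟩ | ⟨h3, _⟩
      · exact absurd rfl (hd x h3 x h1)
      · exact absurd rfl (hd y h3 y h2)
    · exact absurd rfl (hd x (key h' x (by tauto)) x (key h x (by tauto)))
    · exact ihD ndD h h'

namespace Sequent

theorem mem_leaves {Γ : Sequent} {x : ℕ} : x ∈ Γ.leaves ↔ ∃ F ∈ Γ, x ∈ F.leaves := by
  simp [Sequent.leaves]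

theorem mem_vertices {Γ : Sequent} {G : Formula} : G ∈ Γ.vertices ↔ ∃ F ∈ Γ, G ∈ F.vertices := by
  simp [Sequent.vertices]

theorem mem_leaves_iff {Γ : Sequent} {x : ℕ} : x ∈ Γ.leaves ↔ ∃ P, .leaf x P ∈ Γ.vertices := by
  simp only [mem_leaves, mem_vertices, Formula.mem_leaves_iff]
  exact ⟨fun ⟨F, h, P, h'⟩ => ⟨P, F, h, h'⟩, fun ⟨P, F, h, h'⟩ => ⟨F, h, P, h'⟩⟩

theorem root_mem_vertices {Γ : Sequent} {F : Formula} (h : F ∈ Γ) : F ∈ Γ.vertices :=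
  mem_vertices.2 ⟨F, h, F.mem_vertices_self⟩

theorem WellNamed.formula {Γ : Sequent} (h : Γ.WellNamed) {F : Formula} (hF : F ∈ Γ) :
    F.leaves.Nodup :=
  (List.nodup_flatMap.1 h).1 F hF

theorem WellNamed.root_unique {Γ : Sequent} (h : Γ.WellNamed) {F G : Formula} (hF : F ∈ Γ)
    (hG : G ∈ Γ) {x : ℕ} (hx : x ∈ F.leaves) (hx' : x ∈ G.leaves) : F = G := by
  by_contra hne
  have := (List.nodup_flatMap.1 h).2
  have hsymm : Std.Symm (Function.onFun List.Disjoint Formula.leaves) :=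
    ⟨fun _ _ h => List.Disjoint.symm h⟩
  exact this.forall hF hG hne hx hx'

theorem WellNamed.nodup {Γ : Sequent} (h : Γ.WellNamed) : Γ.Nodup := by
  refine (List.nodup_flatMap.1 h).2.imp ?_
  rintro F G hd rfl
  obtain ⟨x, hx⟩ := F.exists_mem_leaves
  exact hd hx hx

theorem WellNamed.label_unique {Γ : Sequent} (h : Γ.WellNamed) {x : ℕ} {P Q : Literal}
    (hP : .leaf x P ∈ Γ.vertices) (hQ : .leaf x Q ∈ Γ.vertices) : P = Q := by
  obtain ⟨F, hF, hP⟩ := mem_vertices.1 hP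
  obtain ⟨G, hG, hQ⟩ := mem_vertices.1 hQ
  obtain rfl := h.root_unique hF hG (Formula.mem_leaves_iff.2 ⟨_, hP⟩)
    (Formula.mem_leaves_iff.2 ⟨_, hQ⟩)
  exact Formula.label_unique (h.formula hF) hP hQ

theorem WellNamed.meet_unique {Γ : Sequent} (hΓ : Γ.WellNamed) {c c' : Conn}
    {A B A' B' : Formula} {x y : ℕ} (h : .bin c A B ∈ Γ.vertices) (h' : .bin c' A' B' ∈ Γ.vertices)
    (hx : x ∈ A.leaves) (hy : y ∈ B.leaves)
    (hxy : (x ∈ A'.leaves ∧ y ∈ B'.leaves) ∨ (y ∈ A'.leaves ∧ x ∈ B'.leaves)) : c = c' := by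
  obtain ⟨F, hF, h⟩ := mem_vertices.1 h
  obtain ⟨G, hG, h'⟩ := mem_vertices.1 h'
  obtain rfl := hΓ.root_unique hF hG
    ((Formula.leaves_sublist h).subset (List.mem_append_left _ hx))
    ((Formula.leaves_sublist h').subset (List.mem_append.2 (by tauto)))
  exact Formula.meet_unique (hΓ.formula hF) h h' hx hy hxy

end Sequent

/-! ### Linkings as additive resolutions -/

theorem Literal.dual_ne (P : Literal) : P.dual ≠ P := by
  intro h
  have := congrArg Literal.positive h
  simp [Literal.dual] at this

@[simp] theorem Literal.dual_dual (P : Literal) : P.dual.dual = P := by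
  simp [Literal.dual]

/-- Some link of `lam` ends in the leaf `x`. -/
def Covered (lam : Finset Link) (x : ℕ) : Prop := ∃ l ∈ lam, x ∈ l

/-- Some link of `lam` has a leaf in `Δ`. -/
def Meets (lam : Finset Link) (Δ : Sequent) : Prop := ∃ x ∈ Δ.leaves, Covered lam x

/-- The leaves of `F` covered by `lam` form an additive resolution of `F`. -/
def Resolves (lam : Finset Link) : Formula → Prop
  | .leaf x _ => Covered lam x
  | .bin .tensor A B => Resolves lam A ∧ Resolves lam B
  | .bin .par A B => Resolves lam A ∧ Resolves lam B
  | .bin .amp A B => (Resolves lam A ∧ ¬ Meets lam [B]) ∨ (¬ Meets lam [A] ∧ Resolves lam B)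
  | .bin .plus A B => (Resolves lam A ∧ ¬ Meets lam [B]) ∨ (¬ Meets lam [A] ∧ Resolves lam B)

theorem meets_single {lam : Finset Link} {F : Formula} :
    Meets lam [F] ↔ ∃ x ∈ F.leaves, Covered lam x := by
  simp [Meets, Sequent.leaves]

theorem Meets.mono {lam : Finset Link} {Δ Δ' : Sequent} (h : Meets lam Δ)
    (hs : ∀ x ∈ Δ.leaves, x ∈ Δ'.leaves) : Meets lam Δ' :=
  let ⟨x, hx, hc⟩ := h; ⟨x, hs x hx, hc⟩

theorem meets_bin {lam : Finset Link} {c : Conn} {A B : Formula} :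
    Meets lam [.bin c A B] ↔ Meets lam [A] ∨ Meets lam [B] := by
  simp only [meets_single, Formula.leaves, List.mem_append]
  constructor
  · rintro ⟨x, h | h, hc⟩
    exacts [.inl ⟨x, h, hc⟩, .inr ⟨x, h, hc⟩]
  · rintro (⟨x, h, hc⟩ | ⟨x, h, hc⟩)
    exacts [⟨x, .inl h, hc⟩, ⟨x, .inr h, hc⟩]

theorem Resolves.meets {lam : Finset Link} {F : Formula} (h : Resolves lam F) :
    Meets lam [F] := by
  induction F with
  | leaf x P => exact meets_single.2 ⟨x, by simp [Formula.leaves], h⟩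
  | bin c A B ihA ihB =>
    rw [meets_bin]
    cases c <;> simp only [Resolves] at h <;> tauto

theorem meets_congr {lam lam' : Finset Link} {Δ : Sequent}
    (h : ∀ x ∈ Δ.leaves, Covered lam x ↔ Covered lam' x) : Meets lam Δ ↔ Meets lam' Δ :=
  exists_congr fun x => and_congr_right (h x)

theorem resolves_congr {lam lam' : Finset Link} {F : Formula}
    (h : ∀ x ∈ F.leaves, Covered lam x ↔ Covered lam' x) : Resolves lam F ↔ Resolves lam' F := by
  induction F with
  | leaf x P => exact h x (by simp [Formula.leaves])
  | bin c A B ihA ihB =>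
    simp only [Formula.leaves, List.mem_append] at h
    have hA := ihA fun x hx => h x (.inl hx)
    have hB := ihB fun x hx => h x (.inr hx)
    have mA : Meets lam [A] ↔ Meets lam' [A] :=
      meets_congr fun x hx => h x (.inl (by simpa [Sequent.leaves] using hx))
    have mB : Meets lam [B] ↔ Meets lam' [B] :=
      meets_congr fun x hx => h x (.inr (by simpa [Sequent.leaves] using hx))
    cases c <;> simp only [Resolves, hA, hB, mA, mB]

/-- The combinatorial content of `LinkingSet.Valid` that erasure preserves. -/
structure Good (Λ : LinkingSet) : Prop where
  named : Λ.seq.WellNamed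
  dual : ∀ lam ∈ Λ.linkings, ∀ l ∈ lam, ∃ x y P, l = s(x, y) ∧
    .leaf x P ∈ Λ.seq.vertices ∧ .leaf y P.dual ∈ Λ.seq.vertices
  resolves : ∀ lam ∈ Λ.linkings, ∀ F ∈ Λ.seq, Resolves lam F

theorem Good.mem_leaves {Λ : LinkingSet} (h : Good Λ) {lam : Finset Link}
    (hlam : lam ∈ Λ.linkings) {l : Link} (hl : l ∈ lam) {x : ℕ} (hx : x ∈ l) :
    x ∈ Λ.seq.leaves := by
  obtain ⟨y, z, P, rfl, hy, hz⟩ := h.dual lam hlam l hl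
  rcases Sym2.mem_iff.1 hx with rfl | rfl
  · exact Sequent.mem_leaves_iff.2 ⟨_, hy⟩
  · exact Sequent.mem_leaves_iff.2 ⟨_, hz⟩

theorem IsLinking.dual {Γ : Sequent} (hΓ : Γ.WellNamed) {lam : Finset Link}
    (h : IsLinking Γ lam) {l : Link} (hl : l ∈ lam) :
    ∃ x y P, l = s(x, y) ∧ .leaf x P ∈ Γ.vertices ∧ .leaf y P.dual ∈ Γ.vertices := by
  obtain ⟨x, y, ⟨P, hP, hQ⟩, hz⟩ := h.2.dualPair ⟨l, hl⟩
  -- Labels are unique and no literal is its own dual, so the two ends differ; an unordered pair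
  -- containing two distinct leaves is determined by them.
  have hne : x.1 ≠ y.1 := by
    intro he
    rw [← he] at hQ
    exact P.dual_ne (hΓ.label_unique hQ hP)
  exact ⟨x, y, P, (Sym2.mem_and_mem_iff hne).1 ⟨(hz x).2 (.inl rfl), (hz y).2 (.inr rfl)⟩, hP, hQ⟩

/-- The conflict graph on the links is empty, so reflection of conflict leaves nothing for a
conflict of covered leaves to be reflected to. -/
theorem IsLinking.not_conflict {Γ : Sequent} {lam : Finset Link} (h : IsLinking Γ lam)
    {x y : Γ.Leaf} (hx : Covered lam x) (hy : Covered lam y) : ¬ Γ.coh.Adj x y := by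
  obtain ⟨l, hl, hx⟩ := hx
  obtain ⟨m, hm, hy⟩ := hy
  intro hadj
  simpa using h.2.maximal.1.reflects ⟨l, hl⟩ ⟨m, hm⟩ x y hx hy hadj

/-- This is where maximality enters. If no covered leaf conflicted with `z`, then relating `z` to
one fixed link would give a larger map. One link only, since strict coherence of distinct links must
be sent to distinct leaves. -/
theorem IsLinking.exists_conflict {Γ : Sequent} {lam : Finset Link} (h : IsLinking Γ lam)
    {z : Γ.Leaf} (hz : ¬ Covered lam z) : ∃ w : Γ.Leaf, Covered lam w ∧ Γ.coh.Adj z w := by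
  by_contra hcon
  push Not at hcon
  obtain ⟨l₀, hl₀⟩ := h.1
  have hmap : IsCohMap (⊥ : SimpleGraph {l // l ∈ lam}) Γ.coh
      (fun l x => x.1 ∈ l.1 ∨ (x = z ∧ l = ⟨l₀, hl₀⟩)) := by
    have hno : ∀ (l₁ l₂ : {l // l ∈ lam}) (y₁ y₂ : Γ.Leaf),
        (y₁.1 ∈ l₁.1 ∨ (y₁ = z ∧ l₁ = ⟨l₀, hl₀⟩)) → (y₂.1 ∈ l₂.1 ∨ (y₂ = z ∧ l₂ = ⟨l₀, hl₀⟩)) →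
        ¬ Γ.coh.Adj y₁ y₂ := by
      rintro ⟨l₁, h₁⟩ ⟨l₂, h₂⟩ y₁ y₂ (hy₁ | ⟨rfl, -⟩) (hy₂ | ⟨rfl, -⟩)
      · exact h.not_conflict ⟨l₁, h₁, hy₁⟩ ⟨l₂, h₂, hy₂⟩
      · exact fun ha => hcon _ ⟨l₁, h₁, hy₁⟩ ha.symm
      · exact hcon _ ⟨l₂, h₂, hy₂⟩
      · exact Γ.coh.loopless.irrefl _
    refine ⟨?_, fun l₁ l₂ y₁ y₂ h₁ h₂ ha => absurd ha (hno l₁ l₂ y₁ y₂ h₁ h₂)⟩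
    intro l₁ l₂ y₁ y₂ h₁ h₂ hne hadj
    refine ⟨?_, hno l₁ l₂ y₁ y₂ h₁ h₂⟩
    rcases h₁ with h₁ | ⟨rfl, e₁⟩ <;> rcases h₂ with h₂ | ⟨rfl, e₂⟩
    · exact (h.2.maximal.1.preserves l₁ l₂ y₁ y₂ h₁ h₂ hne hadj).1
    · rintro rfl; exact hz ⟨l₁, l₁.2, h₁⟩
    · rintro rfl; exact hz ⟨l₂, l₂.2, h₂⟩
    · exact absurd (e₁.trans e₂.symm) hne
  exact hz ⟨l₀, hl₀, h.2.maximal.2 _ hmap (fun l x hx => .inl hx) ⟨l₀, hl₀⟩ z (.inr ⟨rfl, rfl⟩)⟩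

theorem Sequent.coh_adj {Γ : Sequent} {c : Conn} (hc : c = .amp ∨ c = .plus) {A B : Formula}
    (h : .bin c A B ∈ Γ.vertices) (hΓ : Γ.WellNamed) {x y : Γ.Leaf} (hx : x.1 ∈ A.leaves)
    (hy : y.1 ∈ B.leaves) : Γ.coh.Adj x y := by
  refine (SimpleGraph.fromRel_adj _ _ _).2 ⟨?_, .inl ⟨c, A, B, h, hc, hx, hy⟩⟩
  rintro rfl
  obtain ⟨F, hF, h⟩ := mem_vertices.1 h
  have := (Formula.leaves_sublist h).nodup (hΓ.formula hF)
  exact (List.nodup_append.1 this).2.2 _ hx _ hy rfl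

theorem Sequent.not_coh_adj {Γ : Sequent} {c : Conn} (hc : c = .tensor ∨ c = .par) {A B : Formula}
    (h : .bin c A B ∈ Γ.vertices) (hΓ : Γ.WellNamed) {x y : Γ.Leaf} (hx : x.1 ∈ A.leaves)
    (hy : y.1 ∈ B.leaves) : ¬ Γ.coh.Adj x y := by
  rw [coh, SimpleGraph.fromRel_adj]
  rintro ⟨-, ⟨c', A', B', h', hc', hxy⟩ | ⟨c', A', B', h', hc', hxy⟩⟩
  · obtain rfl := hΓ.meet_unique h h' hx hy (.inl hxy)
    rcases hc with rfl | rfl <;> simp at hc'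
  · obtain rfl := hΓ.meet_unique h h' hx hy (.inr hxy)
    rcases hc with rfl | rfl <;> simp at hc'

/-- Descent into `F`. The hypothesis `hout`, that covered leaves outside `F` put no leaf of `F` in
conflict, is what the induction carries. The two sides of a tensor or par never conflict, so it
passes to both. At an additive node a covered leaf on one side excludes every covered leaf on the
other, so it passes to a side whose opposite is uncovered. At a leaf, `exists_conflict` leaves no
option but to be covered. -/
theorem IsLinking.resolves {Γ : Sequent} (hΓ : Γ.WellNamed) {lam : Finset Link}
    (h : IsLinking Γ lam) {F : Formula} (hF : F ∈ Γ.vertices)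
    (hout : ∀ z w : Γ.Leaf, z.1 ∈ F.leaves → Covered lam w → w.1 ∉ F.leaves → ¬ Γ.coh.Adj z w) :
    Resolves lam F := by
  have up : ∀ {G H : Formula}, G ∈ Γ.vertices → H ∈ G.vertices → H ∈ Γ.vertices := by
    intro G H hG hH
    obtain ⟨K, hK, hG⟩ := Sequent.mem_vertices.1 hG
    exact Sequent.mem_vertices.2 ⟨K, hK, Formula.vertices_trans hG hH⟩
  have inΓ : ∀ {G : Formula} {x}, G ∈ Γ.vertices → x ∈ G.leaves → x ∈ Γ.leaves := by
    intro G x hG hx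
    obtain ⟨P, hP⟩ := Formula.mem_leaves_iff.1 hx
    exact Sequent.mem_leaves_iff.2 ⟨P, up hG hP⟩
  induction F with
  | leaf x P =>
    by_contra hx
    have hm : x ∈ Γ.leaves := Sequent.mem_leaves_iff.2 ⟨P, hF⟩
    obtain ⟨w, hw, hadj⟩ := h.exists_conflict (z := ⟨x, hm⟩) hx
    refine hout ⟨x, hm⟩ w (by simp [Formula.leaves]) hw ?_ hadj
    simp only [Formula.leaves, List.mem_singleton]
    rintro rfl
    exact hx hw
  | bin c A B ihA ihB =>
    have hA : A ∈ Γ.vertices := up hF (Formula.left_mem_vertices c A B)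
    have hB : B ∈ Γ.vertices := up hF (Formula.right_mem_vertices c A B)
    have resA : (∀ z w : Γ.Leaf, z.1 ∈ A.leaves → Covered lam w → w.1 ∈ B.leaves →
        ¬ Γ.coh.Adj z w) → Resolves lam A := by
      refine fun hAB => ihA hA fun z w hz hw hwA => ?_
      by_cases hwB : w.1 ∈ B.leaves
      · exact hAB z w hz hw hwB
      · exact hout z w (by simp [Formula.leaves, hz]) hw (by simp [Formula.leaves, hwA, hwB])
    have resB : (∀ z w : Γ.Leaf, z.1 ∈ B.leaves → Covered lam w → w.1 ∈ A.leaves →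
        ¬ Γ.coh.Adj z w) → Resolves lam B := by
      refine fun hAB => ihB hB fun z w hz hw hwB => ?_
      by_cases hwA : w.1 ∈ A.leaves
      · exact hAB z w hz hw hwA
      · exact hout z w (by simp [Formula.leaves, hz]) hw (by simp [Formula.leaves, hwA, hwB])
    have mult : (c = .tensor ∨ c = .par) → Resolves lam A ∧ Resolves lam B := fun hc =>
      ⟨resA fun z w hz _ hw => Sequent.not_coh_adj hc hF hΓ hz hw,
        resB fun z w hz _ hw hadj => Sequent.not_coh_adj hc hF hΓ hw hz hadj.symm⟩
    have add : (c = .amp ∨ c = .plus) →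
        (Resolves lam A ∧ ¬ Meets lam [B]) ∨ (¬ Meets lam [A] ∧ Resolves lam B) := by
      intro hc
      by_cases hm : Meets lam [B]
      · obtain ⟨y, hy, hcy⟩ := meets_single.1 hm
        have hmA : ∀ x ∈ A.leaves, ¬ Covered lam x := fun x hx hcx =>
          h.not_conflict (x := ⟨x, inΓ hA hx⟩) (y := ⟨y, inΓ hB hy⟩) hcx hcy
            (Sequent.coh_adj hc hF hΓ hx hy)
        exact .inr ⟨fun hmA' => let ⟨x, hx, hcx⟩ := meets_single.1 hmA'; hmA x hx hcx,
          resB fun z w _ hw hwA => absurd hw (hmA _ hwA)⟩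
      · exact .inl ⟨resA fun z w _ hw hwB => absurd (meets_single.2 ⟨_, hwB, hw⟩) hm, hm⟩
    cases c
    · exact mult (.inl rfl)
    · exact mult (.inr rfl)
    · exact add (.inl rfl)
    · exact add (.inr rfl)

theorem LinkingSet.Valid.good {Λ : LinkingSet} (h : Λ.Valid) : Good Λ where
  named := h.1
  dual lam hlam l hl := (h.2 lam hlam).dual h.1 hl
  resolves lam hlam F hF := (h.2 lam hlam).resolves h.1 (Sequent.root_mem_vertices hF)
    fun z w hz hw hwF hadj => by
      rw [Sequent.coh, SimpleGraph.fromRel_adj] at hadj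
      -- Conflicting leaves lie in one tree, so leaves outside a root never conflict with leaves
      -- inside it.
      have key : ∀ {c A B}, .bin c A B ∈ Λ.seq.vertices → ∀ {x y}, x ∈ (Formula.bin c A B).leaves →
          y ∈ (Formula.bin c A B).leaves → x ∈ F.leaves → y ∈ F.leaves := by
        intro c A B hm x y hx hy hxF
        obtain ⟨G, hG, hm⟩ := Sequent.mem_vertices.1 hm
        have hs := (Formula.leaves_sublist hm).subset
        obtain rfl := h.1.root_unique hF hG hxF (hs hx)
        exact hs hy
      obtain ⟨-, ⟨c, A, B, hm, -, hx, hy⟩ | ⟨c, A, B, hm, -, hx, hy⟩⟩ := hadj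
      · exact hwF (key hm (List.mem_append_left _ hx) (List.mem_append_right _ hy) hz)
      · exact hwF (key hm (List.mem_append_right _ hy) (List.mem_append_left _ hx) hz)

/-! ### Passing to a sub-forest -/

theorem leaves_subset {As : Sequent} {D : Formula} (hD : D ∈ As) {x : ℕ} (hx : x ∈ D.leaves) :
    x ∈ As.leaves := Sequent.mem_leaves.2 ⟨D, hD, hx⟩

theorem sublist_flatMap {α β : Type*} {f g : α → List β} {l : List α}
    (h : ∀ a ∈ l, (f a).Sublist (g a)) : (l.flatMap f).Sublist (l.flatMap g) := by
  induction l with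
  | nil => simp
  | cons a l ih =>
    simp only [List.flatMap_cons]
    exact (h a (by simp)).append (ih fun b hb => h b (by simp [hb]))

theorem Sequent.leaves_flatMap (Γ : Sequent) (φ : Formula → Sequent) :
    Sequent.leaves (Γ.flatMap φ) = Γ.flatMap fun C => (φ C).leaves :=
  List.flatMap_assoc

theorem Sequent.leaves_append (Γ Δ : Sequent) :
    Sequent.leaves (Γ ++ Δ) = Γ.leaves ++ Δ.leaves := List.flatMap_append

@[simp] theorem Sequent.leaves_cons (F : Formula) (Γ : Sequent) :
    Sequent.leaves (F :: Γ) = F.leaves ++ Γ.leaves := rfl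

@[simp] theorem Sequent.leaves_nil : Sequent.leaves [] = [] := rfl

/-- The common shape of all erasures: roots give way to disjoint parts of themselves, and linkings
lose the links that do not survive. `Branches.good` and `SplitBy.good` are instances. Duality is
inherited because a surviving leaf keeps its unique label. -/
theorem Good.refine {Λ : LinkingSet} (h : Good Λ) {φ : Formula → Sequent}
    {K : Finset (Finset Link)}
    (hsub : ∀ C ∈ Λ.seq, (φ C).leaves.Sublist C.leaves)
    (hvert : ∀ C ∈ Λ.seq, ∀ D ∈ φ C, D ∈ C.vertices)
    (hK : ∀ lam ∈ K, (∃ lam' ∈ Λ.linkings, lam ⊆ lam') ∧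
      (∀ C ∈ Λ.seq, ∀ D ∈ φ C, Resolves lam D) ∧
      ∀ l ∈ lam, ∀ x ∈ l, x ∈ Sequent.leaves (Λ.seq.flatMap φ)) :
    Good ⟨Λ.seq.flatMap φ, K⟩ where
  named := by
    have := sublist_flatMap hsub
    rw [← Sequent.leaves_flatMap] at this
    exact this.nodup h.named
  dual := by
    intro lam hlam l hl
    obtain ⟨⟨lam', hlam', hss⟩, -, hin⟩ := hK lam hlam
    obtain ⟨x, y, P, rfl, hx, hy⟩ := h.dual lam' hlam' l (hss hl)
    have key : ∀ {z : ℕ} {Q : Literal}, z ∈ s(x, y) → .leaf z Q ∈ Λ.seq.vertices →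
        .leaf z Q ∈ Sequent.vertices (Λ.seq.flatMap φ) := by
      intro z Q hz hQ
      obtain ⟨R, hR⟩ := Sequent.mem_leaves_iff.1 (hin _ hl z hz)
      obtain ⟨D, hD, hDR⟩ := Sequent.mem_vertices.1 hR
      obtain ⟨C, hC, hCD⟩ := List.mem_flatMap.1 hD
      have := Sequent.mem_vertices.2 ⟨C, hC, Formula.vertices_trans (hvert C hC D hCD) hDR⟩
      rwa [h.named.label_unique hQ this]
    exact ⟨x, y, P, rfl, key (Sym2.mem_mk_left _ _) hx, key (Sym2.mem_mk_right _ _) hy⟩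
  resolves := by
    intro lam hlam D hD
    obtain ⟨C, hC, hCD⟩ := List.mem_flatMap.1 hD
    exact (hK lam hlam).2.1 C hC D hCD

/-! ### Replacing a root by parts of it -/

open Classical in
/-- Replace the root `r` by `As`, keeping the linkings that meet `As`. -/
noncomputable def branch (r : Formula) (As : Sequent) (Λ : LinkingSet) : LinkingSet :=
  ⟨Λ.seq.subst r As, Λ.linkings.filter fun lam => Meets lam As⟩

/-- The families of replacements of a root `r` that is not a tensor, when erased. -/
inductive Branches (Λ : LinkingSet) : Formula → List Sequent → Prop
  | par (A B : Formula) : Branches Λ (.bin .par A B) [[A, B]]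
  | amp (A B : Formula) : Branches Λ (.bin .amp A B) [[A], [B]]
  | plus₀ (A B : Formula) (h : ¬ Λ.Touches B) : Branches Λ (.bin .plus A B) [[A]]
  | plus₁ (A B : Formula) (h : ¬ Λ.Touches A) : Branches Λ (.bin .plus A B) [[B]]

theorem touches_iff {Λ : LinkingSet} {A : Formula} :
    Λ.Touches A ↔ ∃ lam ∈ Λ.linkings, Meets lam [A] := by
  simp only [LinkingSet.Touches, meets_single, Covered]
  constructor
  · rintro ⟨lam, h, l, hl, x, hx, hA⟩; exact ⟨lam, h, x, hA, l, hl, hx⟩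
  · rintro ⟨lam, h, x, hA, l, hl, hx⟩; exact ⟨lam, h, l, hl, x, hx, hA⟩

theorem Meets.of_forall {lam lam' : Finset Link} {Δ : Sequent} (h : Meets lam Δ)
    (hl : ∀ l ∈ lam, l ∈ lam') : Meets lam' Δ :=
  let ⟨x, hx, l, hl', hxl⟩ := h; ⟨x, hx, l, hl l hl', hxl⟩

/-- Every linking of `M` is included in one of `Λ`. -/
def Finer (M Λ : LinkingSet) : Prop := ∀ lam ∈ M.linkings, ∃ lam' ∈ Λ.linkings, lam ⊆ lam'

theorem Finer.touches {M Λ : LinkingSet} (h : Finer M Λ) {A : Formula} (hA : M.Touches A) :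
    Λ.Touches A := by
  obtain ⟨lam, hlam, l, hl, hx⟩ := hA
  obtain ⟨lam', hlam', hss⟩ := h lam hlam
  exact ⟨lam', hlam', l, hss hl, hx⟩

open Classical in
theorem mem_branch {r : Formula} {As : Sequent} {Λ : LinkingSet} {lam : Finset Link} :
    lam ∈ (branch r As Λ).linkings ↔ lam ∈ Λ.linkings ∧ Meets lam As := Finset.mem_filter

theorem finer_branch (r : Formula) (As : Sequent) (Λ : LinkingSet) : Finer (branch r As Λ) Λ :=
  fun lam hlam => ⟨lam, (mem_branch.1 hlam).1, Finset.Subset.refl _⟩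

theorem Branches.mono {M Λ : LinkingSet} (h : Finer M Λ) {r : Formula} {Bs : List Sequent}
    (hB : Branches Λ r Bs) : Branches M r Bs := by
  cases hB with
  | par A B => exact .par A B
  | amp A B => exact .amp A B
  | plus₀ A B hB => exact .plus₀ A B fun h' => hB (h.touches h')
  | plus₁ A B hA => exact .plus₁ A B fun h' => hA (h.touches h')

theorem Branches.sublist {Λ : LinkingSet} {r : Formula} {Bs : List Sequent}
    (h : Branches Λ r Bs) {As : Sequent} (hA : As ∈ Bs) : As.leaves.Sublist r.leaves := by
  cases h <;> simp at hA
  · subst hA; simp [Formula.leaves]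
  · rcases hA with rfl | rfl <;> simp [Formula.leaves]
  · subst hA; simp [Formula.leaves]
  · subst hA; simp [Formula.leaves]

theorem Branches.mem_vertices {Λ : LinkingSet} {r : Formula} {Bs : List Sequent}
    (h : Branches Λ r Bs) {As : Sequent} (hA : As ∈ Bs) {D : Formula} (hD : D ∈ As) :
    D ∈ r.vertices := by
  cases h <;> simp at hA
  · subst hA
    simp at hD
    rcases hD with rfl | rfl <;> simp [Formula.vertices, Formula.mem_vertices_self]
  · rcases hA with rfl | rfl <;> simp at hD <;> subst hD <;>
      simp [Formula.vertices, Formula.mem_vertices_self]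
  · subst hA; simp at hD; subst hD; simp [Formula.vertices, Formula.mem_vertices_self]
  · subst hA; simp at hD; subst hD; simp [Formula.vertices, Formula.mem_vertices_self]

theorem Branches.exists_leaf {Λ : LinkingSet} {r : Formula} {Bs : List Sequent}
    (h : Branches Λ r Bs) {As : Sequent} (hA : As ∈ Bs) : ∃ x, x ∈ As.leaves := by
  cases h <;> simp at hA
  · obtain ⟨x, hx⟩ := Formula.exists_mem_leaves ‹Formula›
    subst hA; exact ⟨x, by simp [hx]⟩
  · rcases hA with rfl | rfl
    all_goals simpa using Formula.exists_mem_leaves _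
  · subst hA; simpa using Formula.exists_mem_leaves _
  · subst hA; simpa using Formula.exists_mem_leaves _

theorem Branches.ne_nil {Λ : LinkingSet} {r : Formula} {Bs : List Sequent}
    (h : Branches Λ r Bs) : ∃ As, As ∈ Bs := by
  cases h <;> simp

theorem Branches.exists_meets {Λ : LinkingSet} (hΛ : Good Λ) {r : Formula} (hr : r ∈ Λ.seq)
    {Bs : List Sequent} (h : Branches Λ r Bs) {lam : Finset Link} (hlam : lam ∈ Λ.linkings) :
    ∃ As ∈ Bs, Meets lam As := by
  have hres := (hΛ.resolves lam hlam r hr).meets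
  cases h <;> rw [meets_bin] at hres
  · refine ⟨_, List.mem_singleton.2 rfl, ?_⟩
    rcases hres with hm | hm <;> exact hm.mono (by simp +contextual)
  · rcases hres with hm | hm
    exacts [⟨_, by simp, hm⟩, ⟨_, by simp, hm⟩]
  · rename_i A B hB
    exact ⟨_, by simp, hres.resolve_right fun hm => hB (touches_iff.2 ⟨_, hlam, hm⟩)⟩
  · rename_i A B hA
    exact ⟨_, by simp, hres.resolve_left fun hm => hA (touches_iff.2 ⟨_, hlam, hm⟩)⟩

/-- A linking that meets a branch covers nothing of `r` outside it: at a with because it resolves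
only one side, at a plus because the other side is untouched or unchosen. So the branch inherits the
resolution, and no link loses an end. -/
theorem Branches.resolves {Λ : LinkingSet} (hΛ : Good Λ) {r : Formula} (hr : r ∈ Λ.seq)
    {Bs : List Sequent} (h : Branches Λ r Bs) {As : Sequent} (hAs : As ∈ Bs) {lam : Finset Link}
    (hlam : lam ∈ Λ.linkings) (hm : Meets lam As) :
    (∀ D ∈ As, Resolves lam D) ∧ ∀ x ∈ r.leaves, Covered lam x → x ∈ As.leaves := by
  have hres := hΛ.resolves lam hlam r hr
  cases h <;> simp at hAs <;> simp only [Resolves] at hres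
  · subst hAs
    simp only [List.mem_cons, List.not_mem_nil, or_false, forall_eq_or_imp, forall_eq]
    exact ⟨hres, fun x hx _ => by simpa [Formula.leaves] using hx⟩
  · rename_i A B
    rcases hAs with rfl | rfl <;> rcases hres with ⟨h1, h2⟩ | ⟨h1, h2⟩
    · refine ⟨by simpa using h1, fun x hx hc => ?_⟩
      simp only [Formula.leaves, List.mem_append] at hx
      simpa using hx.resolve_right fun hx => h2 (meets_single.2 ⟨x, hx, hc⟩)
    · exact absurd hm h1
    · exact absurd hm h2
    · refine ⟨by simpa using h2, fun x hx hc => ?_⟩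
      simp only [Formula.leaves, List.mem_append] at hx
      simpa using hx.resolve_left fun hx => h1 (meets_single.2 ⟨x, hx, hc⟩)
  · rename_i A B hB
    subst hAs
    rcases hres with ⟨h1, h2⟩ | ⟨h1, h2⟩
    · refine ⟨by simpa using h1, fun x hx hc => ?_⟩
      simp only [Formula.leaves, List.mem_append] at hx
      simpa using hx.resolve_right fun hx => h2 (meets_single.2 ⟨x, hx, hc⟩)
    · exact absurd hm h1
  · rename_i A B hA
    subst hAs
    rcases hres with ⟨h1, h2⟩ | ⟨h1, h2⟩
    · exact absurd hm h2
    · refine ⟨by simpa using h2, fun x hx hc => ?_⟩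
      simp only [Formula.leaves, List.mem_append] at hx
      simpa using hx.resolve_left fun hx => h1 (meets_single.2 ⟨x, hx, hc⟩)

theorem Branches.good {Λ : LinkingSet} (hΛ : Good Λ) {r : Formula} (hr : r ∈ Λ.seq)
    {Bs : List Sequent} (h : Branches Λ r Bs) {As : Sequent} (hAs : As ∈ Bs) :
    Good (branch r As Λ) := by
  refine hΛ.refine (fun C hC => ?_) (fun C hC D hD => ?_) (fun lam hlam => ?_)
  · split_ifs with he
    · subst he; exact h.sublist hAs
    · simp
  · split_ifs at hD with he
    · subst he; exact h.mem_vertices hAs hD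
    · rw [List.mem_singleton.1 hD]; exact C.mem_vertices_self
  · simp only [Finset.mem_filter] at hlam
    obtain ⟨hres, hcov⟩ := h.resolves hΛ hr hAs hlam.1 hlam.2
    refine ⟨⟨lam, hlam.1, Finset.Subset.refl _⟩, fun C hC D hD => ?_, fun l hl x hx => ?_⟩
    · split_ifs at hD with he
      · exact hres D hD
      · rw [List.mem_singleton.1 hD]; exact hΛ.resolves lam hlam.1 C hC
    · obtain ⟨C, hC, hxC⟩ := Sequent.mem_leaves.1 (hΛ.mem_leaves hlam.1 hl hx)
      rw [Sequent.leaves_flatMap, List.mem_flatMap]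
      refine ⟨C, hC, ?_⟩
      split_ifs with he
      · subst he; exact hcov x hxC ⟨l, hl, hx⟩
      · simpa using hxC

/-! ### Splitting at a tensor root -/

open Classical in
/-- The links of `lam` with both ends in `T`. -/
noncomputable def onSet (T : Set ℕ) (lam : Finset Link) : Finset Link :=
  lam.filter fun l => ∀ x ∈ l, x ∈ T

/-- All leaves of `C` are in `T`. -/
def Within (T : Set ℕ) (C : Formula) : Prop := ∀ x ∈ C.leaves, x ∈ T

open Classical in
/-- The part of `Λ` on the leaves in `T`, with `A` in place of the root `r`. -/
noncomputable def half (r A : Formula) (T : Set ℕ) (Λ : LinkingSet) : LinkingSet :=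
  ⟨Λ.seq.flatMap fun C => if C = r then [A] else if Within T C then [C] else [],
    Λ.linkings.image (onSet T)⟩

/-- No root other than the tensor `r`, with arguments `A` and `B`, and no link of `Λ` leaves or
enters the leaf set `T`, which contains `A` and not `B`. -/
structure PreSplit (Λ : LinkingSet) (r A B : Formula) (T : Set ℕ) : Prop where
  eq : r = .bin .tensor A B ∨ r = .bin .tensor B A
  left : ∀ x ∈ A.leaves, x ∈ T
  right : ∀ x ∈ B.leaves, x ∉ T
  roots : ∀ C ∈ Λ.seq, C ≠ r → (∀ x ∈ C.leaves, x ∈ T) ∨ ∀ x ∈ C.leaves, x ∉ T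
  links : ∀ lam ∈ Λ.linkings, ∀ l ∈ lam, (∀ x ∈ l, x ∈ T) ∨ ∀ x ∈ l, x ∉ T

/-- The leaf set `T` splits `Λ` at the tensor root `r` with arguments `A` and `B`. -/
structure SplitBy (Λ : LinkingSet) (r A B : Formula) (T : Set ℕ) : Prop
    extends PreSplit Λ r A B T where
  prod : ∀ lam ∈ Λ.linkings, ∀ mu ∈ Λ.linkings, onSet T lam ∪ onSet Tᶜ mu ∈ Λ.linkings

theorem mem_onSet {T : Set ℕ} {lam : Finset Link} {l : Link} :
    l ∈ onSet T lam ↔ l ∈ lam ∧ ∀ x ∈ l, x ∈ T := by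
  simp [onSet]

theorem onSet_subset (T : Set ℕ) (lam : Finset Link) : onSet T lam ⊆ lam :=
  fun _ h => (mem_onSet.1 h).1

theorem Link.exists_mem (l : Link) : ∃ x, x ∈ l := ⟨_, l.out_fst_mem⟩

theorem onSet_union_onSet_compl (T : Set ℕ) (lam mu : Finset Link) :
    onSet T (onSet T lam ∪ onSet Tᶜ mu) = onSet T lam := by
  ext l
  simp only [mem_onSet, Finset.mem_union]
  -- A link has at least one end, so it cannot lie both in `T` and in its complement.
  obtain ⟨x, hx⟩ := Link.exists_mem l
  exact ⟨fun ⟨h, h'⟩ => h.elim id fun h => absurd (h' x hx) (h.2 x hx), fun h => ⟨.inl h, h.2⟩⟩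

theorem onSet_compl_union (T : Set ℕ) (lam mu : Finset Link) :
    onSet Tᶜ (onSet T lam ∪ onSet Tᶜ mu) = onSet Tᶜ mu := by
  have := onSet_union_onSet_compl Tᶜ mu lam
  rwa [compl_compl, Finset.union_comm] at this

namespace PreSplit

variable {Λ : LinkingSet} {r A B : Formula} {T : Set ℕ}

theorem symm (h : PreSplit Λ r A B T) : PreSplit Λ r B A Tᶜ where
  eq := h.eq.symm
  left x hx := h.right x hx
  right x hx := by simpa using h.left x hx
  roots C hC hne := by simpa using (h.roots C hC hne).symm
  links lam hlam l hl := by simpa using (h.links lam hlam l hl).symm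

theorem union_eq (h : PreSplit Λ r A B T) {lam : Finset Link} (hlam : lam ∈ Λ.linkings) :
    onSet T lam ∪ onSet Tᶜ lam = lam := by
  ext l
  simp only [Finset.mem_union, mem_onSet, ← and_or_left, and_iff_left_iff_imp]
  exact h.links lam hlam l

theorem covered_onSet (h : PreSplit Λ r A B T) {lam : Finset Link} (hlam : lam ∈ Λ.linkings)
    {x : ℕ} (hx : x ∈ T) : Covered (onSet T lam) x ↔ Covered lam x := by
  refine ⟨fun ⟨l, hl, hxl⟩ => ⟨l, onSet_subset _ _ hl, hxl⟩, fun ⟨l, hl, hxl⟩ => ⟨l, ?_, hxl⟩⟩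
  refine mem_onSet.2 ⟨hl, (h.links lam hlam l hl).resolve_right fun h' => h' x hxl hx⟩

theorem left_mem_vertices (h : PreSplit Λ r A B T) : A ∈ r.vertices := by
  rcases h.eq with rfl | rfl
  exacts [Formula.left_mem_vertices _ _ _, Formula.right_mem_vertices _ _ _]

theorem mem_leaves (h : PreSplit Λ r A B T) {x : ℕ} : x ∈ r.leaves ↔ x ∈ A.leaves ∨ x ∈ B.leaves := by
  rcases h.eq with rfl | rfl <;> simp [Formula.leaves, or_comm]

theorem mem_leaves_half (h : PreSplit Λ r A B T) {x : ℕ} (hx : x ∈ Λ.seq.leaves) :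
    x ∈ (half r A T Λ).seq.leaves ↔ x ∈ T := by
  rw [half, Sequent.leaves_flatMap, List.mem_flatMap]
  constructor
  · rintro ⟨C, hC, hxC⟩
    split_ifs at hxC with he hT
    · exact h.left x (by simpa using hxC)
    · exact hT x (by simpa using hxC)
    · simp at hxC
  · intro hxT
    obtain ⟨C, hC, hxC⟩ := Sequent.mem_leaves.1 hx
    refine ⟨C, hC, ?_⟩
    split_ifs with he hT
    · subst he
      simpa using (h.mem_leaves.1 hxC).resolve_right fun hB => h.right x hB hxT
    · simpa using hxC
    · exact absurd hxT ((h.roots C hC he).resolve_left hT x hxC)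

end PreSplit

namespace SplitBy

variable {Λ : LinkingSet} {r A B : Formula} {T : Set ℕ}

theorem symm (h : SplitBy Λ r A B T) : SplitBy Λ r B A Tᶜ where
  toPreSplit := h.toPreSplit.symm
  prod lam hlam mu hmu := by
    rw [compl_compl, Finset.union_comm]; exact h.prod mu hmu lam hlam

theorem resolves (h : SplitBy Λ r A B T) (hΛ : Good Λ) (hr : r ∈ Λ.seq) {lam : Finset Link}
    (hlam : lam ∈ Λ.linkings) : Resolves lam A := by
  have := hΛ.resolves lam hlam r hr
  rcases h.eq with rfl | rfl
  exacts [this.1, this.2]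

theorem finer : Finer (half r A T Λ) Λ := by
  intro lam hlam
  obtain ⟨lam', h', rfl⟩ := Finset.mem_image.1 hlam
  exact ⟨lam', h', onSet_subset _ _⟩

theorem good (h : SplitBy Λ r A B T) (hΛ : Good Λ) (hr : r ∈ Λ.seq) : Good (half r A T Λ) := by
  refine hΛ.refine (fun C hC => ?_) (fun C hC D hD => ?_) (fun lam hlam => ?_)
  · split_ifs with he
    · subst he; simpa using Formula.leaves_sublist h.left_mem_vertices
    · simp
    · simp
  · split_ifs at hD with he
    · subst he; rw [List.mem_singleton.1 hD]; exact h.left_mem_vertices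
    · rw [List.mem_singleton.1 hD]; exact C.mem_vertices_self
    · simp at hD
  · obtain ⟨lam, h0, rfl⟩ := Finset.mem_image.1 hlam
    clear hlam
    rename' h0 => hlam
    refine ⟨⟨lam, hlam, onSet_subset _ _⟩, fun C hC D hD => ?_, fun l hl x hx => ?_⟩
    · split_ifs at hD with he hT
      · rw [List.mem_singleton.1 hD,
          resolves_congr fun x hx => h.covered_onSet hlam (h.left x hx)]
        exact h.resolves hΛ hr hlam
      · rw [List.mem_singleton.1 hD, resolves_congr fun x hx => h.covered_onSet hlam (hT x hx)]
        exact hΛ.resolves lam hlam C hC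
      · simp at hD
    · rw [mem_onSet] at hl
      have hxT := hl.2 x hx
      obtain ⟨C, hC, hxC⟩ := Sequent.mem_leaves.1 (hΛ.mem_leaves hlam hl.1 hx)
      exact (h.mem_leaves_half (leaves_subset hC hxC)).2 hxT

theorem card_eq (h : SplitBy Λ r A B T) : Λ.linkings.card =
    (half r A T Λ).linkings.card * (half r B Tᶜ Λ).linkings.card := by
  rw [half, half, ← Finset.card_product]
  refine Finset.card_bij (fun lam _ => (onSet T lam, onSet Tᶜ lam)) (fun lam hlam => ?_)
    (fun lam hlam mu hmu he => ?_) (fun p hp => ?_)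
  · exact Finset.mem_product.2 ⟨Finset.mem_image_of_mem _ hlam, Finset.mem_image_of_mem _ hlam⟩
  · simp only [Prod.mk.injEq] at he
    rw [← h.union_eq hlam, ← h.union_eq hmu, he.1, he.2]
  · obtain ⟨p, q⟩ := p
    simp only [Finset.mem_product, Finset.mem_image] at hp
    obtain ⟨⟨lam, hlam, rfl⟩, mu, hmu, rfl⟩ := hp
    exact ⟨_, h.prod lam hlam mu hmu, by rw [onSet_union_onSet_compl, onSet_compl_union]⟩

end SplitBy

/-! ### The weight of a linking-set -/

/-- The weight of a linking-set, which bounds the number of erasure steps. -/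
def weight (Λ : LinkingSet) : ℕ := Λ.linkings.card * Λ.numVertices

theorem Sequent.WellNamed.exists_append {Γ : Sequent} (h : Γ.WellNamed) {r : Formula} (hr : r ∈ Γ) :
    ∃ Γ₁ Γ₂, Γ = Γ₁ ++ r :: Γ₂ ∧ (∀ C ∈ Γ₁, C ≠ r) ∧ ∀ C ∈ Γ₂, C ≠ r := by
  obtain ⟨Γ₁, Γ₂, rfl⟩ := List.append_of_mem hr
  have := h.nodup
  rw [List.nodup_append, List.nodup_cons] at this
  refine ⟨Γ₁, Γ₂, rfl, fun C hC he => ?_, fun C hC he => ?_⟩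
  · exact this.2.2 C hC r (by simp) he
  · exact this.2.1.1 (he ▸ hC)

theorem Sequent.flatMap_ite {Γ : Sequent} {r : Formula} (h : ∀ C ∈ Γ, C ≠ r) (As : Sequent)
    (g : Formula → Sequent) : Γ.flatMap (fun C => if C = r then As else g C) = Γ.flatMap g := by
  induction Γ with
  | nil => rfl
  | cons C Γ ih =>
    simp only [List.flatMap_cons, if_neg (h C (by simp)), ih fun D hD => h D (by simp [hD])]

theorem Sequent.subst_eq {Γ₁ Γ₂ : Sequent} {r : Formula} (h₁ : ∀ C ∈ Γ₁, C ≠ r)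
    (h₂ : ∀ C ∈ Γ₂, C ≠ r) (As : Sequent) :
    Sequent.subst (Γ₁ ++ r :: Γ₂) r As = Γ₁ ++ As ++ Γ₂ := by
  simp only [subst, List.flatMap_append, List.flatMap_cons, if_true]
  rw [flatMap_ite h₁, flatMap_ite h₂]
  simp

theorem Sequent.vertices_append (Γ Δ : Sequent) :
    Sequent.vertices (Γ ++ Δ) = Γ.vertices ++ Δ.vertices := List.flatMap_append

@[simp] theorem Sequent.vertices_cons (F : Formula) (Γ : Sequent) :
    Sequent.vertices (F :: Γ) = F.vertices ++ Γ.vertices := rfl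

@[simp] theorem Sequent.vertices_nil : Sequent.vertices [] = [] := rfl

theorem numVertices_branch {Λ : LinkingSet} (hΛ : Good Λ) {r : Formula} (hr : r ∈ Λ.seq)
    (As : Sequent) : (branch r As Λ).numVertices + r.vertices.length =
      Λ.numVertices + As.vertices.length := by
  obtain ⟨Γ₁, Γ₂, he, h₁, h₂⟩ := hΛ.named.exists_append hr
  simp only [branch, LinkingSet.numVertices, he, Sequent.subst_eq h₁ h₂]
  simp only [Sequent.vertices_append, Sequent.vertices_cons, List.length_append]
  omega

theorem Formula.vertices_length_pos (F : Formula) : 0 < F.vertices.length :=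
  List.length_pos_of_mem F.mem_vertices_self

/-- Each branch has at least one vertex less, the root. For a with, every linking resolves exactly
one argument, so the two families of linkings are disjoint and n₀v₀ + n₁v₁ ≤ (n₀ + n₁)(v - 1) ≤ n(v
- 1). -/
theorem Branches.weight_lt {Λ : LinkingSet} (hΛ : Good Λ) (hne : Λ.linkings.Nonempty)
    {r : Formula} (hr : r ∈ Λ.seq) {Bs : List Sequent} (h : Branches Λ r Bs) :
    (Bs.map fun As => weight (branch r As Λ)).sum < weight Λ := by
  classical
  have hpos : 0 < Λ.linkings.card := hne.card_pos
  have hcard : ∀ As, (branch r As Λ).linkings.card ≤ Λ.linkings.card := fun As =>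
    Finset.card_le_card (Finset.filter_subset _ _)
  have hvert := fun As => numVertices_branch hΛ hr As
  cases h with
  | par A B =>
    have h1 := hcard [A, B]
    have h2 := hvert [A, B]
    simp only [Sequent.vertices_cons, Sequent.vertices_nil, Formula.vertices, List.length_append,
      List.length_cons, List.length_nil] at h2
    simp only [weight, List.map_cons, List.map_nil, List.sum_cons, List.sum_nil]
    calc _ ≤ Λ.linkings.card * (branch _ [A, B] Λ).numVertices := Nat.mul_le_mul_right _ h1
      _ < _ := Nat.mul_lt_mul_of_pos_left (by omega) hpos
  | amp A B =>
    have h1 := hvert [A]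
    have h2 := hvert [B]
    simp only [Sequent.vertices_cons, Sequent.vertices_nil, Formula.vertices, List.length_append,
      List.length_cons, List.length_nil] at h1 h2
    have hd : (branch (.bin .amp A B) [A] Λ).linkings.card +
        (branch (.bin .amp A B) [B] Λ).linkings.card ≤ Λ.linkings.card := by
      rw [branch, branch, ← Finset.card_union_of_disjoint]
      · exact Finset.card_le_card (Finset.union_subset (Finset.filter_subset _ _)
          (Finset.filter_subset _ _))
      · refine Finset.disjoint_filter.2 fun lam hlam hA hB => ?_
        rcases hΛ.resolves lam hlam _ hr with h | h
        exacts [h.2 hB, h.1 hA]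
    simp only [weight, List.map_cons, List.map_nil, List.sum_cons, List.sum_nil]
    calc _ ≤ (branch (.bin .amp A B) [A] Λ).linkings.card * (Λ.numVertices - 1) +
        (branch (.bin .amp A B) [B] Λ).linkings.card * (Λ.numVertices - 1) := by
          gcongr
          · omega
          · rw [add_zero]; gcongr; omega
      _ ≤ Λ.linkings.card * (Λ.numVertices - 1) := by
          rw [← add_mul]; exact Nat.mul_le_mul_right _ hd
      _ < _ := Nat.mul_lt_mul_of_pos_left (by omega) hpos
  | plus₀ A B hB =>
    have h1 := hcard [A]
    have h2 := hvert [A]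
    simp only [Sequent.vertices_cons, Sequent.vertices_nil, Formula.vertices, List.length_append,
      List.length_cons, List.length_nil] at h2
    simp only [weight, List.map_cons, List.map_nil, List.sum_cons, List.sum_nil]
    calc _ ≤ Λ.linkings.card * (branch _ [A] Λ).numVertices := Nat.mul_le_mul_right _ h1
      _ < _ := Nat.mul_lt_mul_of_pos_left (by omega) hpos
  | plus₁ A B hA =>
    have h1 := hcard [B]
    have h2 := hvert [B]
    simp only [Sequent.vertices_cons, Sequent.vertices_nil, Formula.vertices, List.length_append,
      List.length_cons, List.length_nil] at h2
    simp only [weight, List.map_cons, List.map_nil, List.sum_cons, List.sum_nil]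
    calc _ ≤ Λ.linkings.card * (branch _ [B] Λ).numVertices := Nat.mul_le_mul_right _ h1
      _ < _ := Nat.mul_lt_mul_of_pos_left (by omega) hpos

-- A root other than `r` has a leaf, hence lies wholly within at most one side; `r` gives `A` to one
-- side and `B` to the other and disappears itself, which makes the inequality strict.
open Classical in
theorem SplitBy.numVertices_lt {Λ : LinkingSet} (hΛ : Good Λ) {r A B : Formula} {T : Set ℕ}
    (hr : r ∈ Λ.seq) (h : SplitBy Λ r A B T) :
    (half r A T Λ).numVertices + (half r B Tᶜ Λ).numVertices < Λ.numVertices := by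
  have side : ∀ Γ : Sequent, (Sequent.vertices (Γ.flatMap fun C =>
        if Within T C then [C] else [])).length +
      (Sequent.vertices (Γ.flatMap fun C => if Within Tᶜ C then [C] else [])).length ≤
        Γ.vertices.length := by
    intro Γ
    induction Γ with
    | nil => simp
    | cons C Γ ih =>
      simp only [List.flatMap_cons, Sequent.vertices_append, List.length_append,
        Sequent.vertices_cons]
      obtain ⟨x, hx⟩ := C.exists_mem_leaves
      split_ifs with h1 h2 h2
      · exact absurd (h1 x hx) (h2 x hx)
      all_goals simp; omega
  obtain ⟨Γ₁, Γ₂, he, h₁, h₂⟩ := hΛ.named.exists_append hr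
  simp only [half, LinkingSet.numVertices, he, List.flatMap_append, List.flatMap_cons, if_true,
    Sequent.flatMap_ite h₁, Sequent.flatMap_ite h₂, Sequent.vertices_append, Sequent.vertices_cons,
    List.length_append, Sequent.vertices_nil, List.append_nil]
  have s1 := side Γ₁
  have s2 := side Γ₂
  have hrl : r.vertices.length = A.vertices.length + B.vertices.length + 1 := by
    rcases h.eq with rfl | rfl <;> simp [Formula.vertices]; omega
  omega

/-- With n = n₀n₁ and both factors positive, n₀v₀ + n₁v₁ ≤ n₀n₁(v₀ + v₁), and the vertices decrease.
-/
theorem SplitBy.weight_lt {Λ : LinkingSet} (hΛ : Good Λ) (hne : Λ.linkings.Nonempty)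
    {r A B : Formula} {T : Set ℕ} (hr : r ∈ Λ.seq) (h : SplitBy Λ r A B T) :
    weight (half r A T Λ) + weight (half r B Tᶜ Λ) < weight Λ := by
  have hn := h.numVertices_lt hΛ hr
  have hc := h.card_eq
  have h0 : 0 < (half r A T Λ).linkings.card := (hne.image _).card_pos
  have h1 : 0 < (half r B Tᶜ Λ).linkings.card := (hne.image _).card_pos
  simp only [weight, hc]
  set n₀ := (half r A T Λ).linkings.card
  set n₁ := (half r B Tᶜ Λ).linkings.card
  calc _ ≤ n₀ * n₁ * (half r A T Λ).numVertices + n₀ * n₁ * (half r B Tᶜ Λ).numVertices := by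
        gcongr
        · exact Nat.le_mul_of_pos_right _ h1
        · exact Nat.le_mul_of_pos_left _ h0
    _ < _ := by
        rw [← mul_add]
        exact Nat.mul_lt_mul_of_pos_left hn (Nat.mul_pos h0 h1)

theorem flatMap_congr_mem {α β : Type*} {f g : α → List β} {l : List α}
    (h : ∀ a ∈ l, f a = g a) : l.flatMap f = l.flatMap g := by
  induction l with
  | nil => rfl
  | cons a l ih => simp only [List.flatMap_cons, h a (by simp), ih fun b hb => h b (by simp [hb])]

/-! ### Different roots can be erased in either order -/

/-- A leaf belongs to one root only. Roots are identified by their formulas, so this ensures that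
erasing `s` later does not hit a piece left by the erasure of `r`. -/
theorem Sequent.WellNamed.not_mem_of_sublist {Γ : Sequent} (h : Γ.WellNamed) {r s : Formula}
    (hr : r ∈ Γ) (hs : s ∈ Γ) (hne : r ≠ s) {D : Formula} (hD : ∀ x ∈ D.leaves, x ∈ r.leaves) :
    D ≠ s := by
  rintro rfl
  obtain ⟨x, hx⟩ := D.exists_mem_leaves
  exact hne (h.root_unique hr hs (hD x hx) hx)

theorem flatMap_ite_of_ne {As : Sequent} {s : Formula} (h : ∀ D ∈ As, D ≠ s)
    (f g : Formula → Sequent) (hf : ∀ D ∈ As, g D = [D]) :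
    As.flatMap (fun C => if C = s then f C else g C) = As := by
  induction As with
  | nil => rfl
  | cons D As ih =>
    simp [List.flatMap_cons, h D (by simp), hf D (by simp), ih (fun D hD => h D (by simp [hD]))
      (fun D hD => hf D (by simp [hD]))]

section Commute

variable {Λ : LinkingSet} {r s : Formula}

theorem mem_seq_branch {C : Formula} {As : Sequent} (hC : C ∈ Λ.seq) (hne : C ≠ r) :
    C ∈ (branch r As Λ).seq :=
  List.mem_flatMap.2 ⟨C, hC, by simp [hne]⟩

open Classical in
theorem mem_seq_half {C A : Formula} {T : Set ℕ} (hC : C ∈ Λ.seq) (hne : C ≠ r)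
    (hT : Within T C) : C ∈ (half r A T Λ).seq :=
  List.mem_flatMap.2 ⟨C, hC, by simp [hne, hT]⟩

theorem branch_comm (hΛ : Good Λ) (hr : r ∈ Λ.seq) (hs : s ∈ Λ.seq) (hne : r ≠ s)
    {As Bs : Sequent} (hA : ∀ x ∈ As.leaves, x ∈ r.leaves) (hB : ∀ x ∈ Bs.leaves, x ∈ s.leaves) :
    branch s Bs (branch r As Λ) = branch r As (branch s Bs Λ) := by
  have hA' : ∀ D ∈ As, D ≠ s := fun D hD =>
    hΛ.named.not_mem_of_sublist hr hs hne fun x hx => hA x (leaves_subset hD hx)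
  have hB' : ∀ D ∈ Bs, D ≠ r := fun D hD =>
    hΛ.named.not_mem_of_sublist hs hr hne.symm fun x hx => hB x (leaves_subset hD hx)
  simp only [branch, LinkingSet.mk.injEq]
  refine ⟨?_, ?_⟩
  · simp only [Sequent.subst, List.flatMap_assoc]
    refine flatMap_congr_mem fun C hC => ?_
    by_cases h1 : C = r
    · subst h1
      simp [hne, flatMap_ite_of_ne hA' (fun _ => Bs) (fun C => [C]) (fun _ _ => rfl)]
    · by_cases h2 : C = s
      · subst h2
        simp [h1, flatMap_ite_of_ne hB' (fun _ => As) (fun C => [C]) (fun _ _ => rfl)]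
      · simp [h1, h2]
  · ext lam
    simp only [Finset.mem_filter, and_right_comm]

/-- The root `s` lies on one side of `T`, so whether a recombined linking meets `As` is decided by
its component on that side. Filtering therefore respects the exchange property. -/
theorem SplitBy.split_branch {A B : Formula} {T : Set ℕ} (h : SplitBy Λ r A B T) (hs : s ∈ Λ.seq)
    (hne : s ≠ r) {As : Sequent} (hAs : ∀ x ∈ As.leaves, x ∈ s.leaves) :
    SplitBy (branch s As Λ) r A B T where
  eq := h.eq
  left := h.left
  right := h.right
  roots C hC hCr := by
    obtain ⟨D, hD, hCD⟩ := List.mem_flatMap.1 hC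
    split_ifs at hCD with he
    · exact (h.roots s hs hne).imp (fun h x hx => h x (hAs x (leaves_subset hCD hx)))
        fun h x hx => h x (hAs x (leaves_subset hCD hx))
    · rw [List.mem_singleton.1 hCD] at hCr ⊢; exact h.roots D hD hCr
  links lam hlam := h.links lam (mem_branch.1 hlam).1
  prod lam hlam mu hmu := by
    rw [mem_branch] at hlam hmu ⊢
    refine ⟨h.prod lam hlam.1 mu hmu.1, ?_⟩
    rcases h.roots s hs hne with hT | hT
    · obtain ⟨x, hx, hc⟩ := hlam.2
      obtain ⟨l, hl, hxl⟩ := (h.covered_onSet hlam.1 (hT x (hAs x hx))).2 hc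
      exact ⟨x, hx, l, Finset.mem_union_left _ hl, hxl⟩
    · obtain ⟨x, hx, hc⟩ := hmu.2
      obtain ⟨l, hl, hxl⟩ := (h.symm.covered_onSet hmu.1 (hT x (hAs x hx))).2 hc
      exact ⟨x, hx, l, Finset.mem_union_right _ hl, hxl⟩

theorem SplitBy.meets_onSet {A B : Formula} {T : Set ℕ} (h : SplitBy Λ r A B T)
    {lam : Finset Link} (hlam : lam ∈ Λ.linkings) {As : Sequent} (hAs : ∀ x ∈ As.leaves, x ∈ T) :
    Meets (onSet T lam) As ↔ Meets lam As :=
  meets_congr fun x hx => h.covered_onSet hlam (hAs x hx)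

theorem SplitBy.half_branch {A B : Formula} {T : Set ℕ} (h : SplitBy Λ r A B T) (hΛ : Good Λ)
    (hr : r ∈ Λ.seq) (hs : s ∈ Λ.seq) (hne : s ≠ r) (hT : Within T s) {As : Sequent}
    (hAs : ∀ x ∈ As.leaves, x ∈ s.leaves) :
    half r A T (branch s As Λ) = branch s As (half r A T Λ) := by
  have hA' : ∀ D ∈ As, D ≠ r := fun D hD =>
    hΛ.named.not_mem_of_sublist hs hr hne fun x hx => hAs x (leaves_subset hD hx)
  have hAr : A ≠ s := hΛ.named.not_mem_of_sublist hr hs hne.symm fun x hx => h.mem_leaves.2 (.inl hx)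
  simp only [branch, half, LinkingSet.mk.injEq]
  refine ⟨?_, ?_⟩
  · simp only [Sequent.subst, List.flatMap_assoc]
    refine flatMap_congr_mem fun C hC => ?_
    by_cases h1 : C = r
    · subst h1; simp [hne.symm, hAr]
    · by_cases h2 : C = s
      · subst h2
        simp only [if_true, h1, if_false, hT, List.flatMap_singleton]
        exact flatMap_ite_of_ne hA' _ _ fun D hD =>
          if_pos fun x hx => hT x (hAs x (leaves_subset hD hx))
      · simp only [h1, h2, if_false, List.flatMap_singleton]
        split_ifs <;> simp [h2]
  · ext lam
    simp only [Finset.mem_image, Finset.mem_filter]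
    constructor
    · rintro ⟨mu, ⟨hmu, hm⟩, rfl⟩
      exact ⟨⟨mu, hmu, rfl⟩, (h.meets_onSet hmu fun x hx => hT x (hAs x hx)).2 hm⟩
    · rintro ⟨⟨mu, hmu, rfl⟩, hm⟩
      exact ⟨mu, ⟨hmu, (h.meets_onSet hmu fun x hx => hT x (hAs x hx)).1 hm⟩, rfl⟩

/-- The half away from `s` does not notice the filtering: any linking can exchange its part in `T`
for that of a linking in the branch. Such a linking must exist; if the branch is empty then so is
its half, whatever the half of `Λ` is. -/
theorem SplitBy.half_branch_of_disjoint {A B : Formula} {T : Set ℕ} (h : SplitBy Λ r A B T)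
    (hne : s ≠ r) (hs : s ∈ Λ.seq) (hT : Within T s) {As : Sequent}
    (hAs : ∀ x ∈ As.leaves, x ∈ s.leaves) (hne' : (branch s As Λ).linkings.Nonempty) :
    half r B Tᶜ (branch s As Λ) = half r B Tᶜ Λ := by
  have hsT : ¬ Within Tᶜ s := fun h' =>
    let ⟨x, hx⟩ := s.exists_mem_leaves; h' x hx (hT x hx)
  obtain ⟨lam, hlam⟩ := hne'
  simp only [half, LinkingSet.mk.injEq]
  refine ⟨?_, ?_⟩
  · simp only [branch, Sequent.subst, List.flatMap_assoc]
    refine flatMap_congr_mem fun C hC => ?_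
    by_cases h2 : C = s
    · subst h2
      simp only [if_true, hne, if_false, hsT, List.flatMap_eq_nil_iff]
      intro D hD
      obtain ⟨x, hx⟩ := D.exists_mem_leaves
      have hxT := hT x (hAs x (leaves_subset hD hx))
      have hDr : D ≠ r := by
        rintro rfl
        rcases h.eq with he | he
        · obtain ⟨y, hy⟩ := B.exists_mem_leaves
          have : y ∈ D.leaves := h.mem_leaves.2 (.inr hy)
          exact h.right y hy (hT y (hAs y (leaves_subset hD this)))
        · obtain ⟨y, hy⟩ := B.exists_mem_leaves
          have : y ∈ D.leaves := h.mem_leaves.2 (.inr hy)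
          exact h.right y hy (hT y (hAs y (leaves_subset hD this)))
      rw [if_neg hDr, if_neg fun h' : Within Tᶜ D => h' x hx hxT]
    · simp [h2]
  · ext mu
    simp only [Finset.mem_image]
    constructor
    · rintro ⟨nu, hnu, rfl⟩; exact ⟨nu, (mem_branch.1 hnu).1, rfl⟩
    · rintro ⟨nu, hnu, rfl⟩
      rw [mem_branch] at hlam
      refine ⟨onSet T lam ∪ onSet Tᶜ nu, mem_branch.2 ⟨h.prod lam hlam.1 nu hnu, ?_⟩,
        onSet_compl_union _ _ _⟩
      exact ((h.meets_onSet hlam.1 fun x hx => hT x (hAs x hx)).2 hlam.2).of_forall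
        fun l hl => Finset.mem_union_left _ hl

theorem onSet_comm (T U : Set ℕ) (lam : Finset Link) :
    onSet U (onSet T lam) = onSet T (onSet U lam) := by
  ext l; simp only [mem_onSet, and_right_comm]

theorem onSet_union (T : Set ℕ) (lam mu : Finset Link) :
    onSet T (lam ∪ mu) = onSet T lam ∪ onSet T mu := by
  ext l; simp only [mem_onSet, Finset.mem_union, or_and_right]

/-- The set `U` need not be intersected with `T`, since a split only constrains the two arguments
and the roots and links actually present. The exchange property passes to restrictions because
`onSet` commutes with itself and with unions. -/
theorem SplitBy.split_half {A B C D : Formula} {T U : Set ℕ} (h : SplitBy Λ r A B T)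
    (hU : SplitBy Λ s C D U) (hr : r ∈ Λ.seq) (hne : r ≠ s) :
    SplitBy (half r A T Λ) s C D U where
  eq := hU.eq
  left := hU.left
  right := hU.right
  roots E hE hEs := by
    obtain ⟨F, hF, hEF⟩ := List.mem_flatMap.1 hE
    split_ifs at hEF with h1 h2
    · rw [List.mem_singleton.1 hEF]
      exact (hU.roots r hr hne).imp (fun h' x hx => h' x (h.mem_leaves.2 (.inl hx)))
        fun h' x hx => h' x (h.mem_leaves.2 (.inl hx))
    · rw [List.mem_singleton.1 hEF] at hEs ⊢; exact hU.roots F hF hEs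
    · simp at hEF
  links lam hlam l hl := by
    obtain ⟨mu, hmu, rfl⟩ := Finset.mem_image.1 hlam
    exact hU.links mu hmu l (onSet_subset _ _ hl)
  prod lam hlam mu hmu := by
    obtain ⟨lam', hlam', rfl⟩ := Finset.mem_image.1 hlam
    obtain ⟨mu', hmu', rfl⟩ := Finset.mem_image.1 hmu
    rw [onSet_comm, onSet_comm T, ← onSet_union]
    exact Finset.mem_image_of_mem _ (hU.prod lam' hlam' mu' hmu')

theorem SplitBy.half_comm {A B C D : Formula} {T U : Set ℕ} (h : SplitBy Λ r A B T)
    (hU : SplitBy Λ s C D U) (hΛ : Good Λ) (hr : r ∈ Λ.seq) (hs : s ∈ Λ.seq) (hne : r ≠ s)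
    (hrU : Within U r) (hsT : Within T s) :
    half s C U (half r A T Λ) = half r A T (half s C U Λ) := by
  have hAs : A ≠ s := hΛ.named.not_mem_of_sublist hr hs hne fun x hx => h.mem_leaves.2 (.inl hx)
  have hCr : C ≠ r := hΛ.named.not_mem_of_sublist hs hr hne.symm
    fun x hx => hU.mem_leaves.2 (.inl hx)
  simp only [half, LinkingSet.mk.injEq]
  refine ⟨?_, ?_⟩
  · simp only [List.flatMap_assoc]
    refine flatMap_congr_mem fun E hE => ?_
    by_cases h1 : E = r
    · subst h1
      have : Within U A := fun x hx => hrU x (h.mem_leaves.2 (.inl hx))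
      simp [hne, hAs, hrU, this]
    · by_cases h2 : E = s
      · subst h2
        have : Within T C := fun x hx => hsT x (hU.mem_leaves.2 (.inl hx))
        simp [h1, hCr, hsT, this]
      · simp only [h1, h2, if_false]
        split_ifs <;> simp [*]
  · ext lam
    simp only [Finset.mem_image, exists_exists_and_eq_and, onSet_comm T U]

/-- The part outside `U` is contained in `T` and does not involve `r`, so cutting along `T`
beforehand leaves it intact. -/
theorem SplitBy.half_of_subset {A B C D : Formula} {T U : Set ℕ} (h : SplitBy Λ r A B T)
    (hU : SplitBy Λ s C D U) (hΛ : Good Λ) (hr : r ∈ Λ.seq) (hs : s ∈ Λ.seq) (hne : r ≠ s)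
    (hrU : Within U r) (hTU : ∀ x ∈ Λ.seq.leaves, x ∉ U → x ∈ T) :
    half s D Uᶜ (half r A T Λ) = half s D Uᶜ Λ := by
  have hAs : A ≠ s := hΛ.named.not_mem_of_sublist hr hs hne fun x hx => h.mem_leaves.2 (.inl hx)
  have hnot : ∀ {E : Formula}, Within U E → ¬ Within Uᶜ E := fun h1 h2 =>
    let ⟨x, hx⟩ := Formula.exists_mem_leaves _; h2 x hx (h1 x hx)
  have hsT : Within T s := by
    obtain ⟨y, hy⟩ := D.exists_mem_leaves
    have hys : y ∈ s.leaves := hU.mem_leaves.2 (.inr hy)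
    have hyT := hTU y (leaves_subset hs hys) (hU.right y hy)
    exact (h.roots s hs hne.symm).resolve_right fun h' => h' y hys hyT
  simp only [half, LinkingSet.mk.injEq]
  refine ⟨?_, ?_⟩
  · simp only [List.flatMap_assoc]
    refine flatMap_congr_mem fun E hE => ?_
    by_cases h1 : E = r
    · subst h1
      have : ¬ Within Uᶜ A := hnot fun x hx => hrU x (h.mem_leaves.2 (.inl hx))
      simp [hne, hAs, hnot hrU, this]
    · by_cases h2 : E = s
      · subst h2; simp [h1, hsT]
      · simp only [h1, h2, if_false]
        by_cases h3 : Within Uᶜ E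
        · have : Within T E := fun x hx => hTU x (leaves_subset hE hx) (h3 x hx)
          simp [h2, h3, this]
        · split_ifs <;> simp [h2, h3]
  · ext lam
    simp only [Finset.mem_image, exists_exists_and_eq_and]
    refine exists_congr fun mu => and_congr_right fun hmu => ?_
    have : onSet Uᶜ (onSet T mu) = onSet Uᶜ mu := by
      ext l
      simp only [mem_onSet]
      exact ⟨fun h => ⟨h.1.1, h.2⟩, fun h' => ⟨⟨h'.1, fun x hx =>
        hTU x (hΛ.mem_leaves hmu h'.1 hx) (h'.2 x hx)⟩, h'.2⟩⟩
    rw [this]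

end Commute

/-! ### Connectedness in terms of sets of leaves -/

/-- The leaf set `Z` is a union of components of the forest `Δ` with the links of `K`. -/
structure Closed (Δ : Sequent) (K : Finset (Finset Link)) (Z : Set ℕ) : Prop where
  roots : ∀ C ∈ Δ, ∀ x ∈ C.leaves, ∀ y ∈ C.leaves, x ∈ Z → y ∈ Z
  links : ∀ lam ∈ K, ∀ l ∈ lam, ∀ x ∈ l, ∀ y ∈ l, x ∈ Z → y ∈ Z

theorem reachable_of_mem_vertices {Λ : LinkingSet} {Δ : Sequent} {F G : Formula}
    (hF : F ∈ Δ.vertices) (hG : G ∈ F.vertices) :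
    (Λ.graphOn {B | B ∈ Δ.vertices}).Reachable F G := by
  induction F with
  | leaf x P =>
    obtain rfl := List.mem_singleton.1 hG
    exact .refl _
  | bin c A B ihA ihB =>
    have child : ∀ D, (D = A ∨ D = B) → D ∈ Δ.vertices ∧
        (Λ.graphOn {B | B ∈ Δ.vertices}).Reachable (.bin c A B) D := by
      intro D hD
      have hDv : D ∈ (Formula.bin c A B).vertices := by
        rcases hD with rfl | rfl
        exacts [Formula.left_mem_vertices _ _ _, Formula.right_mem_vertices _ _ _]
      have hDΔ : D ∈ Δ.vertices := by
        obtain ⟨C, hC, hFC⟩ := Sequent.mem_vertices.1 hF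
        exact Sequent.mem_vertices.2 ⟨C, hC, Formula.vertices_trans hFC hDv⟩
      refine ⟨hDΔ, SimpleGraph.Adj.reachable ?_⟩
      refine (SimpleGraph.fromRel_adj _ _ _).2 ⟨?_, .inl ⟨hF, hDΔ, .inl ⟨c, ?_⟩⟩⟩
      · intro he
        have := congrArg sizeOf he
        rcases hD with rfl | rfl <;> simp +arith at this
      · rcases hD with rfl | rfl
        exacts [⟨_, .inl rfl⟩, ⟨_, .inr rfl⟩]
    simp only [Formula.vertices, List.mem_cons, List.mem_append] at hG
    rcases hG with rfl | hG | hG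
    · exact .refl _
    · exact (child A (.inl rfl)).2.trans (ihA (child A (.inl rfl)).1 hG)
    · exact (child B (.inr rfl)).2.trans (ihB (child B (.inr rfl)).1 hG)

/-- The leaves of one tree are all in `Z` or all outside, so membership in `Z` makes sense for a
vertex, tested on any leaf below it, and is constant along tree edges and links. -/
theorem Closed.reachable {Λ : LinkingSet} {Δ : Sequent} {Z : Set ℕ}
    (hZ : Closed Δ Λ.linkings Z) {F G : Formula} (hF : F ∈ Δ.vertices)
    (h : (Λ.graphOn {B | B ∈ Δ.vertices}).Reachable F G) :
    ∀ x ∈ F.leaves, ∀ y ∈ G.leaves, x ∈ Z → y ∈ Z := by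
  have tree : ∀ {F G : Formula}, F ∈ Δ.vertices → G ∈ F.vertices →
      ∀ x ∈ F.leaves, ∀ y ∈ G.leaves, (x ∈ Z ↔ y ∈ Z) := by
    intro F G hF hG x hx y hy
    obtain ⟨C, hC, hFC⟩ := Sequent.mem_vertices.1 hF
    have hx' := (Formula.leaves_sublist hFC).subset hx
    have hy' := (Formula.leaves_sublist (Formula.vertices_trans hFC hG)).subset hy
    exact ⟨hZ.roots C hC x hx' y hy', hZ.roots C hC y hy' x hx'⟩
  obtain ⟨w⟩ := h
  induction w with
  | nil => exact fun x hx y hy => (tree hF (Formula.mem_vertices_self _) x hx y hy).1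
  | @cons F H G hadj w ih =>
    intro x hx y hy hxZ
    have step : ∀ {F H : Formula}, (F ∈ Δ.vertices ∧ H ∈ Δ.vertices ∧
        ((∃ c D, F = .bin c H D ∨ F = .bin c D H) ∨
          ∃ x P y Q, F = .leaf x P ∧ H = .leaf y Q ∧ ∃ lam ∈ Λ.linkings, s(x, y) ∈ lam)) →
        ∀ x ∈ F.leaves, ∀ y ∈ H.leaves, (x ∈ Z ↔ y ∈ Z) := by
      rintro F H ⟨hF, hH, ⟨c, D, rfl | rfl⟩ | ⟨a, P, b, Q, rfl, rfl, lam, hlam, hl⟩⟩ x hx y hy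
      · exact tree hF (Formula.left_mem_vertices _ _ _) x hx y hy
      · exact tree hF (Formula.right_mem_vertices _ _ _) x hx y hy
      · obtain rfl := List.mem_singleton.1 hx
        obtain rfl := List.mem_singleton.1 hy
        exact ⟨hZ.links lam hlam _ hl _ (Sym2.mem_mk_left _ _) _ (Sym2.mem_mk_right _ _),
          hZ.links lam hlam _ hl _ (Sym2.mem_mk_right _ _) _ (Sym2.mem_mk_left _ _)⟩
    obtain ⟨z, hz⟩ := H.exists_mem_leaves
    obtain ⟨-, h | h⟩ := (SimpleGraph.fromRel_adj _ _ _).1 hadj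
    · exact ih h.2.1 z hz y hy ((step h x hx z hz).1 hxZ)
    · exact ih h.1 z hz y hy ((step h z hz x hx).2 hxZ)

/-- For the converse, the leaves reachable from `F` form a closed set. Closed sets of leaves replace
the graph from here on: erasure changes the vertices of the graph, whereas a set of leaves can be
compared before and after. -/
theorem reachable_iff {Λ : LinkingSet} {Δ : Sequent} (hΔ : Δ.WellNamed)
    (hK : ∀ lam ∈ Λ.linkings, ∀ l ∈ lam, ∀ x ∈ l, x ∈ Δ.leaves) {F G : Formula}
    (hF : F ∈ Δ.vertices) (hG : G ∈ Δ.vertices) :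
    (Λ.graphOn {B | B ∈ Δ.vertices}).Reachable F G ↔
      ∀ Z, Closed Δ Λ.linkings Z → ∀ x ∈ F.leaves, ∀ y ∈ G.leaves, x ∈ Z → y ∈ Z := by
  refine ⟨fun h Z hZ => hZ.reachable hF h, fun h => ?_⟩
  set 𝒢 := Λ.graphOn {B | B ∈ Δ.vertices}
  let Z : Set ℕ := {z | ∃ P, .leaf z P ∈ Δ.vertices ∧ 𝒢.Reachable F (.leaf z P)}
  have up : ∀ {G H : Formula}, G ∈ Δ.vertices → H ∈ G.vertices → H ∈ Δ.vertices := by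
    intro G H hG hH
    obtain ⟨K, hK, hG⟩ := Sequent.mem_vertices.1 hG
    exact Sequent.mem_vertices.2 ⟨K, hK, Formula.vertices_trans hG hH⟩
  have hZ : Closed Δ Λ.linkings Z := by
    constructor
    · rintro C hC x hx y hy ⟨P, hP, hreach⟩
      have hCv := Sequent.root_mem_vertices hC
      obtain ⟨P', hP'⟩ := Formula.mem_leaves_iff.1 hx
      obtain ⟨Q, hQ⟩ := Formula.mem_leaves_iff.1 hy
      obtain rfl := hΔ.label_unique hP (up hCv hP')
      exact ⟨Q, up hCv hQ, hreach.trans ((reachable_of_mem_vertices hCv hP').symm.trans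
        (reachable_of_mem_vertices hCv hQ))⟩
    · rintro lam hlam l hl x hx y hy ⟨P, hP, hreach⟩
      by_cases hne : x = y
      · subst hne; exact ⟨P, hP, hreach⟩
      obtain ⟨Q, hQ⟩ := Sequent.mem_leaves_iff.1 (hK lam hlam l hl y hy)
      have hl' : s(x, y) ∈ lam := by rwa [← (Sym2.mem_and_mem_iff hne).1 ⟨hx, hy⟩]
      refine ⟨Q, hQ, hreach.trans (SimpleGraph.Adj.reachable ?_)⟩
      exact (SimpleGraph.fromRel_adj _ _ _).2 ⟨by simp [hne],
        .inl ⟨hP, hQ, .inr ⟨x, P, y, Q, rfl, rfl, lam, hlam, hl'⟩⟩⟩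
  obtain ⟨x, hx⟩ := F.exists_mem_leaves
  obtain ⟨y, hy⟩ := G.exists_mem_leaves
  obtain ⟨P, hP⟩ := Formula.mem_leaves_iff.1 hx
  obtain ⟨Q, hQ⟩ := Formula.mem_leaves_iff.1 hy
  obtain ⟨Q', hQ', hreach⟩ := h Z hZ x hx y hy ⟨P, up hF hP, reachable_of_mem_vertices hF hP⟩
  obtain rfl := hΔ.label_unique hQ' (up hG hQ)
  exact hreach.trans (reachable_of_mem_vertices hG hQ).symm

/-- Connectedness, in terms of unions of components. -/
def Coherent (Λ : LinkingSet) : Prop :=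
  Λ.linkings.Nonempty ∧ ∀ Z, Closed Λ.seq Λ.linkings Z →
    ∀ x ∈ Λ.seq.leaves, ∀ y ∈ Λ.seq.leaves, x ∈ Z → y ∈ Z

theorem Good.connected_iff {Λ : LinkingSet} (h : Good Λ) : Λ.Connected ↔ Coherent Λ := by
  have key := fun {F G} => reachable_iff (Λ := Λ) (F := F) (G := G) h.named
    fun lam hlam l hl x hx => h.mem_leaves hlam hl hx
  refine and_congr_right fun _ => ⟨fun hc Z hZ x hx y hy => ?_, fun hc F hF G hG => ?_⟩
  · obtain ⟨P, hP⟩ := Sequent.mem_leaves_iff.1 hx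
    obtain ⟨Q, hQ⟩ := Sequent.mem_leaves_iff.1 hy
    exact (key hP hQ).1 (hc _ hP _ hQ) Z hZ x (by simp [Formula.leaves]) y (by simp [Formula.leaves])
  · have sub : ∀ {F : Formula}, F ∈ Λ.seq.vertices → ∀ x ∈ F.leaves, x ∈ Λ.seq.leaves := by
      intro F hF x hx
      obtain ⟨C, hC, hFC⟩ := Sequent.mem_vertices.1 hF
      exact leaves_subset hC ((Formula.leaves_sublist hFC).subset hx)
    exact (key hF hG).2 fun Z hZ x hx y hy => hc Z hZ x (sub hF x hx) y (sub hG y hy)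

theorem mem_subst {Γ : Sequent} {r : Formula} (hr : r ∈ Γ) {As : Sequent} {C : Formula} :
    C ∈ Γ.subst r As ↔ C ∈ As ∨ C ∈ Γ ∧ C ≠ r := by
  simp only [Sequent.subst, List.mem_flatMap]
  constructor
  · rintro ⟨D, hD, hCD⟩
    split_ifs at hCD with he
    · exact .inl hCD
    · obtain rfl := List.mem_singleton.1 hCD; exact .inr ⟨hD, he⟩
  · rintro (h | ⟨h, hne⟩)
    · exact ⟨r, hr, by simpa using h⟩
    · exact ⟨C, h, by simp [hne]⟩

/-- A set closed for `Λ` is closed for the branch. It is thus trivial on the surviving leaves, and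
every lost leaf shared a tree with a surviving one. The contrapositive is what matters:
disconnectedness is inherited by results of erasure. -/
theorem branch_conn {Λ : LinkingSet} {r : Formula} (hr : r ∈ Λ.seq)
    {Bs : List Sequent} (h : Branches Λ r Bs) {As : Sequent} (hAs : As ∈ Bs)
    (hc : Coherent (branch r As Λ)) : Coherent Λ := by
  refine ⟨hc.1.imp fun lam hlam => (mem_branch.1 hlam).1, fun Z hZ => ?_⟩
  have hZ' : Closed (branch r As Λ).seq (branch r As Λ).linkings Z := by
    refine ⟨fun C hC x hx y hy => ?_, fun lam hlam => hZ.links lam (mem_branch.1 hlam).1⟩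
    rcases (mem_subst hr).1 hC with hC | ⟨hC, -⟩
    · have := (h.sublist hAs).subset
      exact hZ.roots r hr x (this (leaves_subset hC hx)) y (this (leaves_subset hC hy))
    · exact hZ.roots C hC x hx y hy
  -- every leaf has a companion in its own tree that survives
  have comp : ∀ x ∈ Λ.seq.leaves, ∃ x' ∈ (branch r As Λ).seq.leaves, (x ∈ Z ↔ x' ∈ Z) := by
    intro x hx
    obtain ⟨C, hC, hxC⟩ := Sequent.mem_leaves.1 hx
    by_cases he : C = r
    · subst he
      obtain ⟨y, hy⟩ := h.exists_leaf hAs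
      have hyC := (h.sublist hAs).subset hy
      obtain ⟨D, hD, hyD⟩ := Sequent.mem_leaves.1 hy
      exact ⟨y, leaves_subset ((mem_subst hr).2 (.inl hD)) hyD,
        hZ.roots C hC x hxC y hyC, hZ.roots C hC y hyC x hxC⟩
    · exact ⟨x, leaves_subset ((mem_subst hr).2 (.inr ⟨hC, he⟩)) hxC, Iff.rfl⟩
  intro x hx y hy hxZ
  obtain ⟨x', hx', ex⟩ := comp x hx
  obtain ⟨y', hy', ey⟩ := comp y hy
  exact ey.2 (hc.2 Z hZ' x' hx' y' hy' (ex.1 hxZ))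

theorem mem_half {Λ : LinkingSet} {r A : Formula} {T : Set ℕ} (hr : r ∈ Λ.seq) {C : Formula} :
    C ∈ (half r A T Λ).seq ↔ C = A ∨ C ∈ Λ.seq ∧ C ≠ r ∧ Within T C := by
  simp only [half, List.mem_flatMap]
  constructor
  · rintro ⟨D, hD, hCD⟩
    split_ifs at hCD with h1 h2
    · exact .inl (List.mem_singleton.1 hCD)
    · obtain rfl := List.mem_singleton.1 hCD; exact .inr ⟨hD, h1, h2⟩
    · simp at hCD
  · rintro (rfl | ⟨h, h1, h2⟩)
    · exact ⟨r, hr, by simp⟩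
    · exact ⟨C, h, by simp [h1, h2]⟩

theorem Closed.closed_half {Λ : LinkingSet} {r A B : Formula} {T : Set ℕ} (hr : r ∈ Λ.seq)
    (h : SplitBy Λ r A B T) {Z : Set ℕ} (hZ : Closed Λ.seq Λ.linkings Z) :
    Closed (half r A T Λ).seq (half r A T Λ).linkings Z := by
  refine ⟨fun C hC x hx y hy => ?_, fun lam hlam l hl => ?_⟩
  · rcases (mem_half hr).1 hC with rfl | ⟨hC, -⟩
    · exact hZ.roots r hr x (h.mem_leaves.2 (.inl hx)) y (h.mem_leaves.2 (.inl hy))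
    · exact hZ.roots C hC x hx y hy
  · obtain ⟨mu, hmu, rfl⟩ := Finset.mem_image.1 hlam
    exact hZ.links mu hmu l (onSet_subset _ _ hl)

/-- A closed set is trivial on each half, and the two halves agree because a leaf of `A` and a leaf
of `B` are joined by the tree of `r`. -/
theorem SplitBy.conn {Λ : LinkingSet} {r A B : Formula} {T : Set ℕ} (hr : r ∈ Λ.seq)
    (h : SplitBy Λ r A B T) (h₀ : Coherent (half r A T Λ)) (h₁ : Coherent (half r B Tᶜ Λ)) :
    Coherent Λ := by
  refine ⟨Finset.image_nonempty.1 h₀.1, fun Z hZ => ?_⟩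
  obtain ⟨a, ha⟩ := A.exists_mem_leaves
  obtain ⟨b, hb⟩ := B.exists_mem_leaves
  have har := h.mem_leaves.2 (.inl ha)
  have hbr := h.mem_leaves.2 (.inr hb)
  have hab : a ∈ Z ↔ b ∈ Z := ⟨hZ.roots r hr a har b hbr, hZ.roots r hr b hbr a har⟩
  have ha' := (h.mem_leaves_half (leaves_subset hr har)).2 (h.left a ha)
  have hb' := (h.symm.mem_leaves_half (leaves_subset hr hbr)).2 (h.symm.left b hb)
  have key : ∀ x ∈ Λ.seq.leaves, (x ∈ Z ↔ a ∈ Z) := by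
    intro x hx
    by_cases hxT : x ∈ T
    · have hx' := (h.mem_leaves_half hx).2 hxT
      exact ⟨h₀.2 Z (hZ.closed_half hr h) x hx' a ha', h₀.2 Z (hZ.closed_half hr h) a ha' x hx'⟩
    · have hx' := (h.symm.mem_leaves_half hx).2 hxT
      rw [hab]
      exact ⟨h₁.2 Z (hZ.closed_half hr h.symm) x hx' b hb', h₁.2 Z (hZ.closed_half hr h.symm) b hb' x hx'⟩
  exact fun x hx y hy hxZ => (key y hy).2 ((key x hx).1 hxZ)

/-! ### Erasure of a root in terms of `branch` and `half` -/

/-- The union of the components of `Δ` with the links of `K` that meet `A`. -/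
def hull (Δ : Sequent) (K : Finset (Finset Link)) (A : Formula) : Set ℕ :=
  {x | ∀ Z, Closed Δ K Z → Within Z A → x ∈ Z}

theorem within_hull (Δ : Sequent) (K : Finset (Finset Link)) (A : Formula) :
    Within (hull Δ K A) A := fun x hx _ _ h => h x hx

theorem closed_hull (Δ : Sequent) (K : Finset (Finset Link)) (A : Formula) :
    Closed Δ K (hull Δ K A) :=
  ⟨fun C hC x hx y hy h Z hZ hA => hZ.roots C hC x hx y hy (h Z hZ hA),
    fun lam hlam l hl x hx y hy h Z hZ hA => hZ.links lam hlam l hl x hx y hy (h Z hZ hA)⟩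

/-- Deleting the vertex `r` leaves the graph of the forest in which its arguments are separate
trees, so `reachable_iff` applies to readiness of a tensor. -/
theorem verts_diff_root {Λ : LinkingSet} (hΛ : Good Λ) {c : Conn} {A B : Formula}
    (hr : .bin c A B ∈ Λ.seq) :
    Λ.verts \ {.bin c A B} = {C | C ∈ (Λ.seq.subst (.bin c A B) [A, B]).vertices} := by
  ext C
  simp only [LinkingSet.verts, Set.mem_sdiff, Set.mem_ofPred_eq, Set.mem_singleton_iff,
    Sequent.mem_vertices, mem_subst hr]
  constructor
  · rintro ⟨⟨D, hD, hCD⟩, hne⟩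
    by_cases he : D = .bin c A B
    · subst he
      simp only [Formula.vertices, List.mem_cons, hne, List.mem_append, false_or] at hCD
      rcases hCD with h | h
      exacts [⟨A, .inl (by simp), h⟩, ⟨B, .inl (by simp), h⟩]
    · exact ⟨D, .inr ⟨hD, he⟩, hCD⟩
  · rintro ⟨D, hD | ⟨hD, hne⟩, hCD⟩
    · have hl : D.leaves.length < (Formula.bin c A B).leaves.length ∧
          D ∈ (Formula.bin c A B).vertices := by
        have h1 := List.length_pos_of_ne_nil A.leaves_ne_nil
        have h2 := List.length_pos_of_ne_nil B.leaves_ne_nil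
        simp only [List.mem_cons, List.not_mem_nil, or_false] at hD
        rcases hD with rfl | rfl <;> simp [Formula.leaves, Formula.vertices,
          Formula.mem_vertices_self] <;> omega
      refine ⟨⟨_, hr, Formula.vertices_trans hl.2 hCD⟩, ?_⟩
      rintro rfl
      exact absurd (Formula.leaves_sublist hCD).length_le (by omega)
    · refine ⟨⟨D, hD, hCD⟩, ?_⟩
      rintro rfl
      obtain ⟨x, hx⟩ := Formula.exists_mem_leaves (.bin c A B)
      exact hne (hΛ.named.root_unique hD hr ((Formula.leaves_sublist hCD).subset hx) hx)

section Deleted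

variable {Λ : LinkingSet} {c : Conn} {A B : Formula}

theorem leaves_subst_bin (hr : .bin c A B ∈ Λ.seq) (x : ℕ) :
    x ∈ (Λ.seq.subst (.bin c A B) [A, B]).leaves ↔ x ∈ Λ.seq.leaves := by
  simp only [Sequent.mem_leaves, mem_subst hr]
  constructor
  · rintro ⟨C, hC | hC, hx⟩
    · refine ⟨_, hr, ?_⟩
      simp only [List.mem_cons, List.not_mem_nil, or_false] at hC
      rcases hC with rfl | rfl <;> simp [Formula.leaves, hx]
    · exact ⟨C, hC.1, hx⟩
  · rintro ⟨C, hC, hx⟩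
    by_cases he : C = .bin c A B
    · subst he
      rcases List.mem_append.1 hx with hx | hx
      exacts [⟨A, .inl (by simp), hx⟩, ⟨B, .inl (by simp), hx⟩]
    · exact ⟨C, .inr ⟨hC, he⟩, hx⟩

theorem wellNamed_subst_bin (hΛ : Good Λ) :
    (Λ.seq.subst (.bin c A B) [A, B]).WellNamed := by
  have : (Sequent.leaves (Λ.seq.subst (.bin c A B) [A, B])).Sublist Λ.seq.leaves := by
    rw [Sequent.subst, Sequent.leaves_flatMap]
    refine sublist_flatMap fun C hC => ?_
    split_ifs with he
    · subst he; simp [Formula.leaves]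
    · simp
  exact this.nodup hΛ.named

theorem reachable_iff_within (hΛ : Good Λ) (hr : .bin c A B ∈ Λ.seq) {D : Formula}
    (hD : D ∈ [A, B]) {C : Formula} (hC : C ∈ Λ.seq.subst (.bin c A B) [A, B]) :
    (Λ.graphOn (Λ.verts \ {.bin c A B})).Reachable D C ↔
      Within (hull (Λ.seq.subst (.bin c A B) [A, B]) Λ.linkings D) C := by
  have hD' : D ∈ Λ.seq.subst (.bin c A B) [A, B] := (mem_subst hr).2 (.inl hD)
  rw [verts_diff_root hΛ hr, reachable_iff (wellNamed_subst_bin hΛ)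
    (fun lam hlam l hl x hx => (leaves_subst_bin hr x).2 (hΛ.mem_leaves hlam hl hx))
    (Sequent.root_mem_vertices hD') (Sequent.root_mem_vertices hC)]
  obtain ⟨d, hd⟩ := D.exists_mem_leaves
  constructor
  · exact fun h y hy Z hZ hDZ => h Z hZ d hd y hy (hDZ d hd)
  · exact fun h Z hZ x hx y hy hxZ => h y hy Z hZ fun z hz => hZ.roots D hD' x hx z hz hxZ

end Deleted

/-- In a connected linking-set, a split at a tensor is the split into components. -/
theorem PreSplit.mem_hull {Λ : LinkingSet} (hc : Coherent Λ) {A B : Formula} {T : Set ℕ}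
    {r D E : Formula} (hr : r ∈ Λ.seq) (hAB : r = .bin .tensor A B)
    (hDE : (D = A ∧ E = B) ∨ (D = B ∧ E = A)) (h : PreSplit Λ r D E T) {x : ℕ}
    (hx : x ∈ Λ.seq.leaves) :
    x ∈ hull (Λ.seq.subst r [A, B]) Λ.linkings D ↔ x ∈ T := by
  set Δ := Λ.seq.subst r [A, B] with hΔ
  have sub : ∀ {D E : Formula} {T : Set ℕ}, ((D = A ∧ E = B) ∨ (D = B ∧ E = A)) →
      PreSplit Λ r D E T → ∀ x ∈ hull Δ Λ.linkings D, x ∈ T := by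
    intro D E T hDE h x hx
    refine hx T ⟨fun C hC x hx y hy hxT => ?_, fun lam hlam l hl x hx y hy hxT => ?_⟩ h.left
    · rcases (mem_subst hr).1 hC with hC | ⟨hC, hne⟩
      · have : C = D ∨ C = E := by
          rcases hDE with ⟨rfl, rfl⟩ | ⟨rfl, rfl⟩ <;> simpa [or_comm] using hC
        rcases this with rfl | rfl
        exacts [h.left y hy, absurd hxT (h.right x hx)]
      · exact (h.roots C hC hne).resolve_right (fun h' => h' x hx hxT) y hy
    · exact (h.links lam hlam l hl).resolve_right (fun h' => h' x hx hxT) y hy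
  refine ⟨sub hDE h x, fun hxT => ?_⟩
  -- The root `r` joins the two hulls, so their union is closed for `Λ` itself and by connectedness
  -- contains every leaf. As the hull of `E` avoids `T`, a leaf of `T` must be in the hull of `D`.
  have hcl : Closed Λ.seq Λ.linkings (hull Δ Λ.linkings D ∪ hull Δ Λ.linkings E) := by
    have hD := closed_hull Δ Λ.linkings D
    have hE := closed_hull Δ Λ.linkings E
    refine ⟨fun C hC x hx y hy hxZ => ?_, fun lam hlam l hl x hx y hy hxZ => ?_⟩
    · by_cases he : C = r
      · subst he
        exact (h.mem_leaves.1 hy).imp (within_hull _ _ _ y) (within_hull _ _ _ y)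
      · have hC' : C ∈ Δ := (mem_subst hr).2 (.inr ⟨hC, he⟩)
        exact hxZ.imp (hD.roots C hC' x hx y hy) (hE.roots C hC' x hx y hy)
    · exact hxZ.imp (hD.links lam hlam l hl x hx y hy) (hE.links lam hlam l hl x hx y hy)
  obtain ⟨d, hd⟩ := D.exists_mem_leaves
  have := hc.2 _ hcl d (leaves_subset hr (h.mem_leaves.2 (.inl hd))) x hx
    (.inl (within_hull _ _ _ d hd))
  exact this.resolve_right fun hE => sub (hDE.symm.imp And.symm And.symm) h.symm x hE hxT

theorem PreSplit.split_eq_half {Λ : LinkingSet} (hΛ : Good Λ) (hc : Coherent Λ) {A B : Formula}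
    {T : Set ℕ} {r D E : Formula} (hr : r ∈ Λ.seq) (hAB : r = .bin .tensor A B)
    (hDE : (D = A ∧ E = B) ∨ (D = B ∧ E = A)) (h : PreSplit Λ r D E T) :
    Λ.split r D = half r D T Λ := by
  classical
  have hDAB : D ∈ [A, B] := by rcases hDE with ⟨rfl, rfl⟩ | ⟨rfl, rfl⟩ <;> simp
  have hreach : ∀ {C}, C ∈ Λ.seq.subst r [A, B] →
      ((Λ.graphOn (Λ.verts \ {r})).Reachable D C ↔
        Within (hull (Λ.seq.subst r [A, B]) Λ.linkings D) C) := by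
    subst hAB; exact reachable_iff_within hΛ hr hDAB
  have hseq : Λ.splitSeq r D = (half r D T Λ).seq := by
    rw [LinkingSet.splitSeq, Sequent.subst, List.filter_flatMap, half]
    refine flatMap_congr_mem fun C hC => ?_
    by_cases he : C = r
    · simp only [he, if_true]
      exact List.filter_eq_self.2 fun C hC => by simp [List.mem_singleton.1 hC]
    · have hiff : (Λ.graphOn (Λ.verts \ {r})).Reachable D C ↔ Within T C := by
        rw [hreach ((mem_subst hr).2 (.inr ⟨hC, he⟩))]
        exact forall₂_congr fun x hx => h.mem_hull hc hr hAB hDE (leaves_subset hC hx)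
      simp only [he, if_false]
      by_cases hT : Within T C <;> simp [hT, hiff]
  rw [LinkingSet.split, LinkingSet.restrict, hseq]
  simp only [half, LinkingSet.mk.injEq, true_and]
  refine Finset.image_congr fun lam hlam => Finset.filter_congr fun l hl => ?_
  exact forall₂_congr fun x hx => h.mem_leaves_half (hΛ.mem_leaves hlam hl hx)

theorem SplitBy.erase_eq {Λ : LinkingSet} (hΛ : Good Λ) (hc : Coherent Λ) {r A B : Formula}
    {T : Set ℕ} (hr : r ∈ Λ.seq) (h : SplitBy Λ r A B T) :
    Λ.erase r = {half r A T Λ, half r B Tᶜ Λ} := by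
  rcases h.eq with rfl | rfl
  · rw [LinkingSet.erase, h.split_eq_half hΛ hc hr rfl (.inl ⟨rfl, rfl⟩),
      h.symm.split_eq_half hΛ hc hr rfl (.inr ⟨rfl, rfl⟩)]
  · rw [LinkingSet.erase, h.split_eq_half hΛ hc hr rfl (.inr ⟨rfl, rfl⟩),
      h.symm.split_eq_half hΛ hc hr rfl (.inl ⟨rfl, rfl⟩), Finset.pair_comm]

/-- Sending a linking to its two restrictions is always injective into the product of the halves.
Equality of cardinalities makes it surjective, and surjectivity is the exchange property. -/
theorem PreSplit.prod_of_card {Λ : LinkingSet} {r A B : Formula} {T : Set ℕ}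
    (h : PreSplit Λ r A B T) (hcard : Λ.linkings.card =
      (half r A T Λ).linkings.card * (half r B Tᶜ Λ).linkings.card) : SplitBy Λ r A B T := by
  refine ⟨h, fun lam hlam mu hmu => ?_⟩
  set P := (half r A T Λ).linkings ×ˢ (half r B Tᶜ Λ).linkings with hP
  have hinj : Set.InjOn (fun lam => (onSet T lam, onSet Tᶜ lam)) (Λ.linkings : Set _) := by
    intro lam hlam mu hmu he
    simp only [Prod.mk.injEq] at he
    rw [← h.union_eq hlam, ← h.union_eq hmu, he.1, he.2]
  have heq : Λ.linkings.image (fun lam => (onSet T lam, onSet Tᶜ lam)) = P := by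
    refine Finset.eq_of_subset_of_card_le (fun p hp => ?_) ?_
    · obtain ⟨nu, hnu, rfl⟩ := Finset.mem_image.1 hp
      exact Finset.mem_product.2 ⟨Finset.mem_image_of_mem _ hnu, Finset.mem_image_of_mem _ hnu⟩
    · rw [Finset.card_image_of_injOn hinj, hP, Finset.card_product, hcard]
  have hmem : (onSet T lam, onSet Tᶜ mu) ∈ P :=
    Finset.mem_product.2 ⟨Finset.mem_image_of_mem _ hlam, Finset.mem_image_of_mem _ hmu⟩
  rw [← heq, Finset.mem_image] at hmem
  obtain ⟨nu, hnu, he⟩ := hmem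
  simp only [Prod.mk.injEq] at he
  rw [← he.1, ← he.2, h.union_eq hnu]
  exact hnu

theorem SplitBy.ready {Λ : LinkingSet} (hΛ : Good Λ) (hc : Coherent Λ) {r A B : Formula}
    {T : Set ℕ} (hr : r ∈ Λ.seq) (h : SplitBy Λ r A B T) : Λ.Ready r := by
  have key : ∀ {r A B : Formula} {T : Set ℕ}, r ∈ Λ.seq → SplitBy Λ r A B T →
      r = .bin .tensor A B → Λ.Ready r := by
    intro r A B T hr h he
    have hs₀ := h.split_eq_half hΛ hc hr he (.inl ⟨rfl, rfl⟩)
    have hs₁ := h.symm.split_eq_half hΛ hc hr he (.inr ⟨rfl, rfl⟩)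
    have hcard := h.card_eq
    subst he
    refine ⟨fun hreach => ?_, by rw [hs₀, hs₁, hcard]⟩
    rw [reachable_iff_within hΛ hr (by simp) ((mem_subst hr).2 (.inl (by simp)))] at hreach
    obtain ⟨b, hb⟩ := B.exists_mem_leaves
    refine h.right b hb ?_
    exact (h.mem_hull hc hr rfl (.inl ⟨rfl, rfl⟩)
      (leaves_subset hr (h.mem_leaves.2 (.inr hb)))).1 (hreach b hb)
  rcases h.eq with he | he
  exacts [key hr h he, key hr h.symm he]

/-- The hull is closed in the forest without the root, so no other root and no link crosses it;
failing to contain all of `B`, it contains no leaf of `B`. -/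
theorem preSplit_hull {Λ : LinkingSet} {A B : Formula} (hr : .bin .tensor A B ∈ Λ.seq)
    (h : ¬ Within (hull (Λ.seq.subst (.bin .tensor A B) [A, B]) Λ.linkings A) B) :
    PreSplit Λ (.bin .tensor A B) A B
      (hull (Λ.seq.subst (.bin .tensor A B) [A, B]) Λ.linkings A) := by
  have hA := within_hull (Λ.seq.subst (.bin .tensor A B) [A, B]) Λ.linkings A
  have hcl := closed_hull (Λ.seq.subst (.bin .tensor A B) [A, B]) Λ.linkings A
  set T := hull (Λ.seq.subst (.bin .tensor A B) [A, B]) Λ.linkings A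
  have dich : ∀ C ∈ Λ.seq.subst (.bin .tensor A B) [A, B],
      (∀ x ∈ C.leaves, x ∈ T) ∨ ∀ x ∈ C.leaves, x ∉ T := by
    intro C hC
    by_contra hcon
    push Not at hcon
    obtain ⟨⟨x, hx, hxT⟩, y, hy, hyT⟩ := hcon
    exact hxT (hcl.roots C hC y hy x hx hyT)
  refine ⟨.inl rfl, hA, (dich B ((mem_subst hr).2 (.inl (by simp)))).resolve_left h,
    fun C hC hne => dich C ((mem_subst hr).2 (.inr ⟨hC, hne⟩)), fun lam hlam l hl => ?_⟩
  by_contra hcon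
  push Not at hcon
  obtain ⟨⟨x, hx, hxT⟩, y, hy, hyT⟩ := hcon
  exact hxT (hcl.links lam hlam l hl y hy x hx hyT)

theorem LinkingSet.Ready.splitBy {Λ : LinkingSet} (hΛ : Good Λ) (hc : Coherent Λ) {A B : Formula}
    (hr : .bin .tensor A B ∈ Λ.seq) (h : Λ.Ready (.bin .tensor A B)) :
    SplitBy Λ (.bin .tensor A B) A B
      (hull (Λ.seq.subst (.bin .tensor A B) [A, B]) Λ.linkings A) := by
  obtain ⟨hreach, hcard⟩ := h
  rw [reachable_iff_within hΛ hr (by simp) ((mem_subst hr).2 (.inl (by simp)))] at hreach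
  have hpre := preSplit_hull hr hreach
  refine hpre.prod_of_card ?_
  rw [hcard, hpre.split_eq_half hΛ hc hr rfl (.inl ⟨rfl, rfl⟩),
    hpre.symm.split_eq_half hΛ hc hr rfl (.inr ⟨rfl, rfl⟩)]

open Classical in
theorem choose_eq_branch (r A : Formula) (Λ : LinkingSet) : Λ.choose r A = branch r [A] Λ := by
  simp only [LinkingSet.choose, branch, LinkingSet.mk.injEq, true_and]
  ext lam
  simp only [Finset.mem_filter, meets_single]
  refine and_congr_right fun _ => ?_
  exact ⟨fun ⟨l, hl, x, hx, hxl⟩ => ⟨x, hx, l, hl, hxl⟩,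
    fun ⟨x, hx, l, hl, hxl⟩ => ⟨l, hl, x, hx, hxl⟩⟩

-- When there is a single branch every linking meets it, so the filter in `branch` removes nothing.
-- This lets par and plus share the treatment of with.
open Classical in
theorem Branches.linkings_eq {Λ : LinkingSet} (hΛ : Good Λ) {r : Formula} (hr : r ∈ Λ.seq)
    {As : Sequent} (h : Branches Λ r [As]) : branch r As Λ = ⟨Λ.seq.subst r As, Λ.linkings⟩ := by
  simp only [branch, LinkingSet.mk.injEq, true_and]
  refine Finset.filter_true_of_mem fun lam hlam => ?_
  simpa using h.exists_meets hΛ hr hlam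

theorem Branches.erase_eq {Λ : LinkingSet} (hΛ : Good Λ) (hne : Λ.linkings.Nonempty) {r : Formula}
    (hr : r ∈ Λ.seq) {Bs : List Sequent} (h : Branches Λ r Bs) :
    Λ.erase r = (Bs.map fun As => branch r As Λ).toFinset := by
  have hle := fun {As} => Branches.linkings_eq (As := As) hΛ hr
  cases h with
  | par A B => simp [LinkingSet.erase, hle (.par A B)]
  | amp A B => simp [LinkingSet.erase, choose_eq_branch]
  | plus₀ A B hB =>
    -- `erase` decides a plus by testing `A`. Some linking exists and resolves the root, so if `B`
    -- is untouched then `A` is touched and the test selects `A`.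
    have hA : Λ.Touches A := by
      obtain ⟨lam, hlam⟩ := hne
      rcases meets_bin.1 (hΛ.resolves lam hlam _ hr).meets with h | h
      exacts [touches_iff.2 ⟨lam, hlam, h⟩, absurd (touches_iff.2 ⟨lam, hlam, h⟩) hB]
    simp [LinkingSet.erase, hle (.plus₀ A B hB), hA]
  | plus₁ A B hA => simp [LinkingSet.erase, hle (.plus₁ A B hA), hA]

theorem Branches.ready {Λ : LinkingSet} {r : Formula} {Bs : List Sequent} (h : Branches Λ r Bs) :
    Λ.Ready r := by
  cases h with
  | par A B => trivial
  | amp A B => trivial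
  | plus₀ A B hB => exact .inr hB
  | plus₁ A B hA => exact .inl hA

/-- `E` lists the results of erasing the root `r` of `Λ`. -/
inductive Erases (Λ : LinkingSet) (r : Formula) : List LinkingSet → Prop
  | branches {Bs : List Sequent} (h : Branches Λ r Bs) :
      Erases Λ r (Bs.map fun As => branch r As Λ)
  | split {A B : Formula} {T : Set ℕ} (h : SplitBy Λ r A B T) :
      Erases Λ r [half r A T Λ, half r B Tᶜ Λ]

theorem Erases.good {Λ : LinkingSet} (hΛ : Good Λ) {r : Formula} (hr : r ∈ Λ.seq)
    {E : List LinkingSet} (h : Erases Λ r E) {M : LinkingSet} (hM : M ∈ E) : Good M := by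
  cases h with
  | branches h =>
    obtain ⟨As, hAs, rfl⟩ := List.mem_map.1 hM
    exact h.good hΛ hr hAs
  | split h =>
    simp only [List.mem_cons, List.not_mem_nil, or_false] at hM
    rcases hM with rfl | rfl
    exacts [h.good hΛ hr, h.symm.good hΛ hr]

theorem Erases.weight_lt {Λ : LinkingSet} (hΛ : Good Λ) (hne : Λ.linkings.Nonempty) {r : Formula}
    (hr : r ∈ Λ.seq) {E : List LinkingSet} (h : Erases Λ r E) : (E.map weight).sum < weight Λ := by
  cases h with
  | branches h => simpa [List.map_map, Function.comp_def] using h.weight_lt hΛ hne hr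
  | split h => simpa using h.weight_lt hΛ hne hr

theorem Erases.coherent {Λ : LinkingSet} {r : Formula} (hr : r ∈ Λ.seq) {E : List LinkingSet}
    (h : Erases Λ r E) (hE : ∀ M ∈ E, Coherent M) : Coherent Λ := by
  cases h with
  | branches h =>
    obtain ⟨As, hAs⟩ := h.ne_nil
    exact branch_conn hr h hAs (hE _ (List.mem_map.2 ⟨As, hAs, rfl⟩))
  | split h => exact h.conn hr (hE _ (by simp)) (hE _ (by simp))

theorem Erases.erase_eq {Λ : LinkingSet} (hΛ : Good Λ) (hc : Coherent Λ) {r : Formula}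
    (hr : r ∈ Λ.seq) {E : List LinkingSet} (h : Erases Λ r E) : Λ.erase r = E.toFinset := by
  cases h with
  | branches h => exact h.erase_eq hΛ hc.1 hr
  | split h => simpa using h.erase_eq hΛ hc hr

theorem Erases.ready {Λ : LinkingSet} (hΛ : Good Λ) (hc : Coherent Λ) {r : Formula}
    (hr : r ∈ Λ.seq) {E : List LinkingSet} (h : Erases Λ r E) : Λ.Ready r := by
  cases h with
  | branches h => exact h.ready
  | split h => exact h.ready hΛ hc hr

theorem exists_erases {Λ : LinkingSet} (hΛ : Good Λ) (hc : Coherent Λ) {r : Formula}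
    (hr : r ∈ Λ.seq) (h : Λ.Ready r) : ∃ E, Erases Λ r E := by
  match r, h with
  | .bin .par A B, _ => exact ⟨_, .branches (.par A B)⟩
  | .bin .amp A B, _ => exact ⟨_, .branches (.amp A B)⟩
  | .bin .plus A B, .inl h => exact ⟨_, .branches (.plus₁ A B h)⟩
  | .bin .plus A B, .inr h => exact ⟨_, .branches (.plus₀ A B h)⟩
  | .bin .tensor A B, h =>
    exact ⟨_, .split (h.splitBy hΛ hc hr)⟩

/-! ### The outcome of erasing a linking-set -/

open Classical in
/-- The irreducible linking-sets left by the erasure of `Λ`, or `⊤` if it ends in an error. -/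
noncomputable def outcome (Λ : LinkingSet) : WithTop (Finset LinkingSet) :=
  if Λ.Connected then
    if Λ.IsAxiom then ⊥
    else if h : ∃ r ∈ Λ.seq, Λ.Ready r then
      -- The comparison of weights only serves the recursion. For good connected sets it always
      -- succeeds, by `Erases.weight_lt_of_mem`, so the default `⊤` is never used there.
      (Λ.erase h.choose).sup fun M => if _h : weight M < weight Λ then outcome M else ⊤
    else (({Λ} : Finset LinkingSet) : WithTop (Finset LinkingSet))
  else ⊤
termination_by weight Λ

theorem outcome_of_not_coherent {Λ : LinkingSet} (hΛ : Good Λ) (h : ¬ Coherent Λ) :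
    outcome Λ = ⊤ := by
  rw [outcome, if_neg (mt hΛ.connected_iff.1 h)]

theorem LinkingSet.IsAxiom.not_ready {Λ : LinkingSet} (h : Λ.IsAxiom) {r : Formula}
    (hr : r ∈ Λ.seq) : ¬ Λ.Ready r := by
  obtain ⟨x, y, P, he, -⟩ := h
  rw [he] at hr
  simp only [List.mem_cons, List.not_mem_nil, or_false] at hr
  rcases hr with rfl | rfl <;> exact id

theorem Erases.weight_lt_of_mem {Λ : LinkingSet} (hΛ : Good Λ) (hne : Λ.linkings.Nonempty)
    {r : Formula} (hr : r ∈ Λ.seq) {E : List LinkingSet} (h : Erases Λ r E) {M : LinkingSet}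
    (hM : M ∈ E) : weight M < weight Λ :=
  (List.le_sum_of_mem (List.mem_map_of_mem hM)).trans_lt (h.weight_lt hΛ hne hr)

/-- Below `Λ`, erasing any root leads to the same outcome. -/
def OutcomeSpec (Λ : LinkingSet) : Prop :=
  Good Λ → ∀ r ∈ Λ.seq, ∀ E, Erases Λ r E → ∀ u, outcome Λ ≤ u ↔ ∀ N ∈ E, outcome N ≤ u

theorem SplitBy.exists_within {Λ : LinkingSet} {r s A B : Formula} {T : Set ℕ}
    (h : SplitBy Λ r A B T) (hs : s ∈ Λ.seq) (hne : s ≠ r) : ∃ A' B' T', SplitBy Λ r A' B' T' ∧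
      Within T' s ∧ ∀ N, N ∈ [half r A T Λ, half r B Tᶜ Λ] ↔
        N ∈ [half r A' T' Λ, half r B' T'ᶜ Λ] := by
  rcases h.roots s hs hne with hT | hT
  · exact ⟨A, B, T, h, hT, fun N => Iff.rfl⟩
  · exact ⟨B, A, Tᶜ, h.symm, hT, fun N => by simp [or_comm]⟩

theorem outcome_of_empty {Λ : LinkingSet} (h : ¬ Λ.linkings.Nonempty) : outcome Λ = ⊤ := by
  rw [outcome, if_neg fun hc => h hc.1]

/-- Erasing different roots of `Λ` leads to the same outcome. -/
theorem outcome_le_of_erases {Λ : LinkingSet} (hΛ : Good Λ) (hc : Coherent Λ)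
    (ih : ∀ M, weight M < weight Λ → OutcomeSpec M) {r s : Formula} (hr : r ∈ Λ.seq)
    (hs : s ∈ Λ.seq) (hne : r ≠ s) {E E' : List LinkingSet} (hE : Erases Λ r E)
    (hE' : Erases Λ s E') {u : WithTop (Finset LinkingSet)} (hu : ∀ N ∈ E, outcome N ≤ u) :
    ∀ N ∈ E', outcome N ≤ u := by
  -- By induction the bound `u` descends from members of `E` to their own results, and (`ihE'`)
  -- ascends to members of `E'` from theirs. It remains to erase in each the other root and to match
  -- the two families.
  have ihE : ∀ N ∈ E, ∀ t ∈ N.seq, ∀ F, Erases N t F → ∀ N' ∈ F, outcome N' ≤ u :=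
    fun N hN t ht F hF => (ih N (hE.weight_lt_of_mem hΛ hc.1 hr hN) (hE.good hΛ hr hN) t ht F hF
      u).1 (hu N hN)
  have ihE' : ∀ N ∈ E', ∀ t ∈ N.seq, ∀ F, Erases N t F → (∀ N' ∈ F, outcome N' ≤ u) →
      outcome N ≤ u :=
    fun N hN t ht F hF => (ih N (hE'.weight_lt_of_mem hΛ hc.1 hs hN) (hE'.good hΛ hs hN) t ht F hF
      u).2
  cases hE with
  | @branches Bs hB =>
    cases hE' with
    | @branches Cs hC =>
      intro N hN
      obtain ⟨Ds, hDs, rfl⟩ := List.mem_map.1 hN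
      refine ihE' _ hN r (mem_seq_branch hr hne) _ (.branches (hB.mono (finer_branch _ _ _))) ?_
      intro N' hN'
      obtain ⟨As, hAs, rfl⟩ := List.mem_map.1 hN'
      rw [← branch_comm hΛ hr hs hne (fun x => (hB.sublist hAs).subset (a := x))
        (fun x => (hC.sublist hDs).subset (a := x))]
      exact ihE _ (List.mem_map.2 ⟨As, hAs, rfl⟩) s (mem_seq_branch hs hne.symm) _
        (.branches (hC.mono (finer_branch _ _ _))) _ (List.mem_map.2 ⟨Ds, hDs, rfl⟩)
    | @split C D U hU =>
      obtain ⟨C, D, U, hU, hrU, hmem⟩ := hU.exists_within hr hne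
      simp only [hmem] at ihE' ⊢
      have key : ∀ As ∈ Bs, ∀ N ∈ [half s C U (branch r As Λ), half s D Uᶜ (branch r As Λ)],
          outcome N ≤ u := fun As hAs =>
        ihE _ (List.mem_map.2 ⟨As, hAs, rfl⟩) s (mem_seq_branch hs hne.symm) _
          (.split (hU.split_branch hr hne fun x => (hB.sublist hAs).subset (a := x)))
      intro N hN
      simp only [List.mem_cons, List.not_mem_nil, or_false] at hN
      rcases hN with rfl | rfl
      · refine ihE' _ (by simp) r (mem_seq_half hr hne hrU) _ (.branches (hB.mono SplitBy.finer)) ?_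
        intro N' hN'
        obtain ⟨As, hAs, rfl⟩ := List.mem_map.1 hN'
        rw [← hU.half_branch hΛ hs hr hne hrU fun x => (hB.sublist hAs).subset (a := x)]
        exact key As hAs _ (by simp)
      · obtain ⟨As, hAs⟩ := hB.ne_nil
        by_cases hemp : (branch r As Λ).linkings.Nonempty
        · rw [← hU.half_branch_of_disjoint hne hr hrU
            (fun x => (hB.sublist hAs).subset (a := x)) hemp]
          exact key As hAs _ (by simp)
        -- An empty branch is disconnected and has outcome `⊤`, so `u` is `⊤` and there is nothing
        -- to prove.
        · have := hu _ (List.mem_map.2 ⟨As, hAs, rfl⟩)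
          rw [outcome_of_empty hemp] at this
          exact le_top.trans this
  | @split A B T hT =>
    obtain ⟨A, B, T, hT, hsT, hmem⟩ := hT.exists_within hs hne.symm
    simp only [hmem] at ihE hu
    cases hE' with
    | @branches Cs hC =>
      intro N hN
      obtain ⟨Ds, hDs, rfl⟩ := List.mem_map.1 hN
      have hDs' := fun x => (hC.sublist hDs).subset (a := x)
      have key := ihE (half r A T Λ) (by simp) s (mem_seq_half hs hne.symm hsT) _
        (.branches (hC.mono SplitBy.finer)) _ (List.mem_map.2 ⟨Ds, hDs, rfl⟩)
      rw [← hT.half_branch hΛ hr hs hne.symm hsT hDs'] at key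
      refine ihE' _ hN r (mem_seq_branch hr hne) _ (.split (hT.split_branch hs hne.symm hDs')) ?_
      intro N' hN'
      simp only [List.mem_cons, List.not_mem_nil, or_false] at hN'
      rcases hN' with rfl | rfl
      · exact key
      · by_cases hemp : (branch s Ds Λ).linkings.Nonempty
        · rw [hT.half_branch_of_disjoint hne.symm hs hsT hDs' hemp]
          exact hu _ (by simp)
        · rw [outcome_of_empty fun h => hemp (Finset.image_nonempty.1 h)] at key
          exact le_top.trans key
    | @split C D U hU =>
      obtain ⟨C, D, U, hU, hrU, hmem'⟩ := hU.exists_within hr hne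
      simp only [hmem'] at ihE' ⊢
      -- The orientation is chosen so that `T` contains `s` and `U` contains `r`. Leaves outside
      -- both then form a closed set that avoids both roots, hence an empty one by connectedness.
      have hTU : ∀ x ∈ Λ.seq.leaves, x ∈ T ∨ x ∈ U := by
        intro x hx
        by_contra hcon
        push Not at hcon
        have hcl : Closed Λ.seq Λ.linkings (Tᶜ ∩ Uᶜ) := by
          refine ⟨fun C hC x hx y hy hxZ => ?_, fun lam hlam l hl x hx y hy hxZ => ?_⟩
          · by_cases h1 : C = r
            · subst h1; exact absurd (hrU x hx) hxZ.2
            by_cases h2 : C = s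
            · subst h2; exact absurd (hsT x hx) hxZ.1
            exact ⟨(hT.roots C hC h1).resolve_left (fun h => hxZ.1 (h x hx)) y hy,
              (hU.roots C hC h2).resolve_left (fun h => hxZ.2 (h x hx)) y hy⟩
          · exact ⟨(hT.links lam hlam l hl).resolve_left (fun h => hxZ.1 (h x hx)) y hy,
              (hU.links lam hlam l hl).resolve_left (fun h => hxZ.2 (h x hx)) y hy⟩
        obtain ⟨a, ha⟩ := A.exists_mem_leaves
        exact (hc.2 _ hcl x hx a (leaves_subset hr (hT.mem_leaves.2 (.inl ha))) hcon).1
          (hT.left a ha)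
      have key := ihE (half r A T Λ) (by simp) s (mem_seq_half hs hne.symm hsT) _
        (.split (hT.split_half hU hr hne))
      intro N hN
      simp only [List.mem_cons, List.not_mem_nil, or_false] at hN
      -- Two cuts leave three parts: outside `T`, outside `U`, and the middle. In either order the
      -- outer parts come off unchanged (`half_of_subset`), and the middle is the same
      -- (`half_comm`).
      rcases hN with rfl | rfl
      · refine ihE' _ (by simp) r (mem_seq_half hr hne hrU) _
          (.split (hU.split_half hT hs hne.symm)) ?_
        intro N' hN'
        simp only [List.mem_cons, List.not_mem_nil, or_false] at hN'
        rcases hN' with rfl | rfl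
        · rw [← hT.half_comm hU hΛ hr hs hne hrU hsT]
          exact key _ (by simp)
        · rw [hU.half_of_subset hT hΛ hs hr hne.symm hsT
            fun x hx hxT => (hTU x hx).resolve_left hxT]
          exact hu _ (by simp)
      · rw [← hT.half_of_subset hU hΛ hr hs hne hrU fun x hx hxU => (hTU x hx).resolve_right hxU]
        exact key _ (by simp)

/-- Induction on weight. If `Λ` is connected, the given root is compared with the one chosen by
`outcome`, through `outcome_le_of_erases`. If not, `Erases.coherent` provides a disconnected result,
and both sides say that `u` is `⊤`. -/
theorem outcome_le_iff {Λ : LinkingSet} : OutcomeSpec Λ := by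
  induction hn : weight Λ using Nat.strong_induction_on generalizing Λ with
  | _ n ih =>
    subst hn
    intro hΛ r hr E hE u
    by_cases hc : Coherent Λ
    · have ih' : ∀ M, weight M < weight Λ → OutcomeSpec M := fun M hM => ih _ hM rfl
      have hex : ∃ r ∈ Λ.seq, Λ.Ready r := ⟨r, hr, hE.ready hΛ hc hr⟩
      have hax : ¬ Λ.IsAxiom := fun h => h.not_ready hr (hE.ready hΛ hc hr)
      rw [outcome, if_pos (hΛ.connected_iff.2 hc), if_neg hax, dif_pos hex]
      obtain ⟨hs, hready⟩ := hex.choose_spec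
      set s := hex.choose
      obtain ⟨E', hE'⟩ := exists_erases hΛ hc hs hready
      rw [hE'.erase_eq hΛ hc hs, Finset.sup_le_iff]
      simp only [List.mem_toFinset]
      have hif : (∀ N ∈ E', (if _h : weight N < weight Λ then outcome N else ⊤) ≤ u) ↔
          ∀ N ∈ E', outcome N ≤ u := forall₂_congr fun N hN => by
        rw [dif_pos (hE'.weight_lt_of_mem hΛ hc.1 hs hN)]
      rw [hif]
      -- For the same root the two lists may come from different data, such as different sets `T`,
      -- but both enumerate `Λ.erase r`.
      by_cases hne : r = s
      · have h1 := hE.erase_eq hΛ hc hr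
        rw [hne, hE'.erase_eq hΛ hc hs] at h1
        have : ∀ N, N ∈ E' ↔ N ∈ E := fun N => by
          rw [← List.mem_toFinset, h1, List.mem_toFinset]
        simp only [this]
      · exact ⟨fun h => outcome_le_of_erases hΛ hc ih' hs hr (Ne.symm hne) hE' hE h,
          fun h => outcome_le_of_erases hΛ hc ih' hr hs hne hE hE' h⟩
    · rw [outcome_of_not_coherent hΛ hc]
      have : ∃ N ∈ E, ¬ Coherent N := by
        by_contra hcon
        push Not at hcon
        exact hc (hE.coherent hr hcon)
      obtain ⟨N, hN, hNc⟩ := this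
      refine ⟨fun h N _ => le_top.trans h, fun h => ?_⟩
      have := h N hN
      rwa [outcome_of_not_coherent (hE.good hΛ hr hN) hNc] at this

theorem LinkingSet.IsAxiom.coherent {Λ : LinkingSet} (h : Λ.IsAxiom) : Coherent Λ := by
  obtain ⟨x, y, P, he, hl⟩ := h
  refine ⟨by simp [hl], fun Z hZ => ?_⟩
  have h1 := hZ.links {s(x, y)} (by simp [hl]) s(x, y) (by simp)
  intro a ha b hb
  simp only [he, Sequent.leaves_cons, Formula.leaves, Sequent.leaves_nil, List.append_nil,
    List.mem_append, List.mem_singleton] at ha hb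
  exact h1 a (by simpa using ha) b (by simpa using hb)

theorem outcome_axiom {Λ : LinkingSet} (hΛ : Good Λ) (h : Λ.IsAxiom) : outcome Λ = ⊥ := by
  rw [outcome, if_pos (hΛ.connected_iff.2 h.coherent), if_pos h]

theorem outcome_stuck {Λ : LinkingSet} (hc : Λ.Connected) (h : ¬ Λ.IsAxiom)
    (hr : ∀ r ∈ Λ.seq, ¬ Λ.Ready r) : outcome Λ = (({Λ} : Finset LinkingSet) : WithTop _) := by
  rw [outcome, if_pos hc, if_neg h, dif_neg (by simpa using hr)]

/-! ### Confluence and termination of erasure on clusters -/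

/-- The outcome of erasing all members of a cluster. -/
noncomputable def Cluster.outcome : Cluster → WithTop (Finset LinkingSet)
  | .error => ⊤
  | .sets X => X.sup MALL.outcome

/-- All members are good. -/
def Cluster.Good : Cluster → Prop
  | .error => True
  | .sets X => ∀ Λ ∈ X, MALL.Good Λ

theorem Cluster.Valid.good {X : Cluster} (h : X.Valid) : X.Good := by
  cases X with
  | error => trivial
  | sets X => exact fun Λ hΛ => (h Λ hΛ).good

/-- The weight of a cluster, which bounds the number of erasure steps. -/
def Cluster.weight : Cluster → ℕ
  | .error => 0
  | .sets X => 1 + ∑ Λ ∈ X, MALL.weight Λ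

theorem Finset.sum_toFinset_le {α : Type*} [DecidableEq α] (f : α → ℕ) (l : List α) :
    ∑ a ∈ l.toFinset, f a ≤ (l.map f).sum := by
  induction l with
  | nil => simp
  | cons a l ih =>
    rw [List.toFinset_cons, List.map_cons, List.sum_cons]
    by_cases h : a ∈ l.toFinset
    · rw [Finset.insert_eq_self.2 h]; omega
    · rw [Finset.sum_insert h]; omega

theorem LinkingSet.IsAxiom.good_weight {Λ : LinkingSet} (h : Λ.IsAxiom) : 0 < weight Λ := by
  obtain ⟨x, y, P, he, hl⟩ := h
  simp [weight, LinkingSet.numVertices, he, hl, Formula.vertices]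

theorem Step.good {X Y : Cluster} (h : Step X Y) (hX : X.Good) : Y.Good := by
  cases h with
  | toError => trivial
  | @root X Λ r fresh conn conn' mem ready =>
    intro M hM
    have hΛ := hX Λ (Finset.mem_insert_self _ _)
    have hc := hΛ.connected_iff.1 conn'
    obtain ⟨E, hE⟩ := exists_erases hΛ hc mem ready
    rw [hE.erase_eq hΛ hc mem, Finset.mem_union, List.mem_toFinset] at hM
    exact hM.elim (fun h => hX M (Finset.mem_insert_of_mem h)) (hE.good hΛ mem)
  | ax => exact fun M hM => hX M (Finset.mem_insert_of_mem hM)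

/-- The summand 1 in the weight pays for the step to the error. Results that coincide with each
other or with members of `X` are counted once, which only lowers the sum further. -/
theorem Step.weight_lt {X Y : Cluster} (h : Step X Y) (hX : X.Good) : Y.weight < X.weight := by
  cases h with
  | toError => simp [Cluster.weight]
  | @root X Λ r fresh conn conn' mem ready =>
    have hΛ := hX Λ (Finset.mem_insert_self _ _)
    have hc := hΛ.connected_iff.1 conn'
    obtain ⟨E, hE⟩ := exists_erases hΛ hc mem ready
    simp only [Cluster.weight, hE.erase_eq hΛ hc mem, Finset.sum_insert fresh]
    have h1 := Finset.sum_union_inter (s₁ := X) (s₂ := E.toFinset) (f := weight)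
    have h2 := Finset.sum_toFinset_le weight E
    have h3 := hE.weight_lt hΛ hc.1 mem
    omega
  | ax fresh conn isAx =>
    simp only [Cluster.weight, Finset.sum_insert fresh]
    have := isAx.good_weight
    omega

/-- Suprema are idempotent, so merging equal members of a cluster is harmless; the rest is
`outcome_le_iff`. An error step needs a disconnected member, whose outcome is already `⊤`. -/
theorem Step.outcome_eq {X Y : Cluster} (h : Step X Y) (hX : X.Good) : X.outcome = Y.outcome := by
  cases h with
  | @toError X Λ mem disc =>
    have : MALL.outcome Λ = ⊤ := by rw [MALL.outcome, if_neg disc]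
    exact top_le_iff.1 (this ▸ Finset.le_sup (f := MALL.outcome) mem)
  | @root X Λ r fresh conn conn' mem ready =>
    have hΛ := hX Λ (Finset.mem_insert_self _ _)
    have hc := hΛ.connected_iff.1 conn'
    obtain ⟨E, hE⟩ := exists_erases hΛ hc mem ready
    refine eq_of_forall_ge_iff fun u => ?_
    simp only [Cluster.outcome, hE.erase_eq hΛ hc mem, Finset.sup_insert, Finset.sup_union,
      sup_le_iff, outcome_le_iff hΛ r mem E hE u, Finset.sup_le_iff, List.mem_toFinset]
    exact and_comm
  | @ax X Λ fresh conn isAx =>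
    have hΛ := hX Λ (Finset.mem_insert_self _ _)
    rw [Cluster.outcome, Finset.sup_insert]
    rw [outcome_axiom hΛ isAx, bot_sup_eq]
    rfl

/-- The irreducible cluster with a given outcome. -/
def Cluster.ofOutcome : WithTop (Finset LinkingSet) → Cluster
  | ⊤ => .error
  | (S : Finset LinkingSet) => .sets S

theorem Finset.sup_coe_singleton (X : Finset LinkingSet) :
    X.sup (fun Λ => (({Λ} : Finset LinkingSet) : WithTop (Finset LinkingSet))) = X := by
  refine eq_of_forall_ge_iff fun u => ?_
  induction u using WithTop.recTopCoe with
  | top => simp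
  | coe S => simp [Finset.sup_le_iff, Finset.subset_iff]

/-- Any step preserves the outcome and lowers the weight, so steps may be taken blindly until none
is possible. An irreducible cluster is the error or consists of stuck linking-sets, and is then its
own outcome. -/
theorem Cluster.steps_ofOutcome {X : Cluster} (hX : X.Good) :
    Steps X (Cluster.ofOutcome X.outcome) := by
  induction hn : X.weight using Nat.strong_induction_on generalizing X with
  | _ n ih =>
    subst hn
    by_cases hstep : ∃ Y, Step X Y
    · obtain ⟨Y, hY⟩ := hstep
      rw [hY.outcome_eq hX]
      exact .head hY (ih _ (hY.weight_lt hX) (hY.good hX) rfl)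
    · cases X with
      | error => exact .refl
      | sets X =>
        have hconn : ∀ Λ ∈ X, Λ.Connected := by
          intro Λ hΛ
          by_contra hc
          exact hstep ⟨_, .toError hΛ hc⟩
        have hst : ∀ Λ ∈ X, MALL.outcome Λ = (({Λ} : Finset LinkingSet) : WithTop _) := by
          intro Λ hΛ
          have hi := Finset.insert_erase hΛ
          have hcon' : ∀ M ∈ X.erase Λ, M.Connected := fun M hM =>
            hconn M (Finset.mem_of_mem_erase hM)
          refine outcome_stuck (hconn Λ hΛ) (fun h => hstep ?_) fun r hr hready => hstep ?_
          · rw [← hi]; exact ⟨_, .ax (Finset.notMem_erase _ _) hcon' h⟩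
          · rw [← hi]; exact ⟨_, .root (Finset.notMem_erase _ _) hcon' (hconn Λ hΛ) hr hready⟩
        have : (Cluster.sets X).outcome = (X : WithTop (Finset LinkingSet)) := by
          rw [Cluster.outcome, Finset.sup_congr rfl hst, Finset.sup_coe_singleton]
        rw [this]
        exact .refl

theorem Steps.good {X Y : Cluster} (h : Steps X Y) (hX : X.Good) : Y.Good := by
  induction h with
  | refl => exact hX
  | tail _ h ih => exact h.good ih

theorem Steps.outcome_eq {X Y : Cluster} (h : Steps X Y) (hX : X.Good) : X.outcome = Y.outcome := by
  induction h with
  | refl => rfl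
  | tail h' h ih => exact ih.trans (h.outcome_eq (Steps.good h' hX))

theorem erasure_confluent {X Y₀ Y₁ : Cluster} (hX : X.Good) (h₀ : Steps X Y₀) (h₁ : Steps X Y₁) :
    ∃ Z, Steps Y₀ Z ∧ Steps Y₁ Z := by
  refine ⟨_, Cluster.steps_ofOutcome (Steps.good h₀ hX), ?_⟩
  rw [← Steps.outcome_eq h₀ hX, Steps.outcome_eq h₁ hX]
  exact Cluster.steps_ofOutcome (Steps.good h₁ hX)

theorem erasure_terminating {X : Cluster} (hX : X.Good) : Acc (fun Y Y' => Step Y' Y) X := by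
  induction hn : X.weight using Nat.strong_induction_on generalizing X with
  | _ n ih =>
    subst hn
    exact ⟨_, fun Y hY => ih _ (hY.weight_lt hX) (hY.good hX) rfl⟩

theorem erasure_length_le {f : ℕ → Cluster} (h₀ : (f 0).Good) {n : ℕ}
    (h : ∀ i < n, Step (f i) (f (i + 1))) : n ≤ (f 0).weight := by
  have key : ∀ i ≤ n, (f i).Good ∧ (f i).weight + i ≤ (f 0).weight := by
    intro i
    induction i with
    | zero => exact fun _ => ⟨h₀, by omega⟩
    | succ i ih =>
      intro hi
      obtain ⟨hg, hw⟩ := ih (by omega)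
      have hs := h i (by omega)
      have := hs.weight_lt hg
      exact ⟨hs.good hg, by omega⟩
  have := (key n le_rfl).2
  omega

theorem LinkingSet.Valid.card_le_numLinks {Λ : LinkingSet} (h : Λ.Valid) :
    Λ.linkings.card ≤ Λ.numLinks := by
  rw [LinkingSet.numLinks, Finset.card_eq_sum_ones]
  exact Finset.sum_le_sum fun lam hlam => (h.2 lam hlam).1.card_pos

/-- The initial weight is 1 plus linkings times vertices; linkings are non-empty, so there are at
most as many as links. -/
theorem erasure_length_bound {Λ : LinkingSet} (hΛ : Λ.Valid) {n : ℕ} {f : ℕ → Cluster}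
    (h₀ : f 0 = .sets {Λ}) (h : ∀ i < n, Step (f i) (f (i + 1))) :
    n ≤ 1 + (Λ.numLinks + Λ.numVertices) * (Λ.numLinks + Λ.numVertices) := by
  have hg : (f 0).Good := by
    rw [h₀]; intro M hM; rw [Finset.mem_singleton.1 hM]; exact hΛ.good
  refine (erasure_length_le hg h).trans ?_
  rw [h₀]
  simp only [Cluster.weight, Finset.sum_singleton, MALL.weight]
  have := hΛ.card_le_numLinks
  gcongr <;> omega

theorem erasable_iff {Λ : LinkingSet} (hΛ : Good Λ) : Λ.Erasable ↔ outcome Λ = ⊥ := by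
  have hg : (Cluster.sets {Λ}).Good := by
    intro M hM; rw [Finset.mem_singleton.1 hM]; exact hΛ
  have ho : (Cluster.sets {Λ}).outcome = outcome Λ := Finset.sup_singleton ..
  constructor
  · intro h
    rw [← ho, Steps.outcome_eq h hg]
    rfl
  · intro h
    have := Cluster.steps_ofOutcome hg
    rw [ho, h] at this
    exact this

/-! ### Sequentializability and erasure -/

/-- `K` is the translation of a proof of `Γ`. -/
def Translates (Γ : Sequent) (K : Finset (Finset Link)) : Prop :=
  ∃ p : Proof Γ, p.translate = K

theorem Translates.perm {Γ Δ : Sequent} {K : Finset (Finset Link)} (h : Translates Γ K)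
    (hp : Γ.Perm Δ) : Translates Δ K :=
  let ⟨p, hK⟩ := h; ⟨.perm hp p, hK⟩

theorem perm_middle_swap (Γ₁ Γ₂ As : Sequent) :
    (Γ₁ ++ As ++ Γ₂).Perm (Γ₁ ++ Γ₂ ++ As) := by
  rw [List.append_assoc, List.append_assoc]
  exact List.Perm.append_left _ List.perm_append_comm

open Classical in
theorem within_partition_perm {Γ : Sequent} {T : Set ℕ}
    (h : ∀ C ∈ Γ, (∀ x ∈ C.leaves, x ∈ T) ∨ ∀ x ∈ C.leaves, x ∉ T) :
    ((Γ.flatMap fun C => if Within T C then [C] else []) ++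
      Γ.flatMap fun C => if Within Tᶜ C then [C] else []).Perm Γ := by
  induction Γ with
  | nil => simp
  | cons C Γ ih =>
    have ih := ih fun D hD => h D (by simp [hD])
    obtain ⟨x, hx⟩ := C.exists_mem_leaves
    simp only [List.flatMap_cons]
    rcases h C (by simp) with hT | hT
    · have h1 : Within T C := hT
      have h2 : ¬ Within Tᶜ C := fun h' => h' x hx (hT x hx)
      simpa [h1, h2] using ih
    · have h1 : ¬ Within T C := fun h' => hT x hx (h' x hx)
      have h2 : Within Tᶜ C := hT
      simp only [h1, h2, if_false, if_true, List.nil_append, List.singleton_append]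
      exact List.perm_middle.trans (ih.cons C)

theorem SplitBy.image₂_eq {Λ : LinkingSet} {r A B : Formula} {T : Set ℕ} (h : SplitBy Λ r A B T) :
    Finset.image₂ (· ∪ ·) (half r A T Λ).linkings (half r B Tᶜ Λ).linkings = Λ.linkings := by
  ext lam
  simp only [half, Finset.mem_image₂, Finset.mem_image, exists_exists_and_eq_and]
  constructor
  · rintro ⟨mu, hmu, nu, hnu, rfl⟩; exact h.prod mu hmu nu hnu
  · exact fun hlam => ⟨lam, hlam, lam, hlam, h.union_eq hlam⟩

theorem SplitBy.translates {Λ : LinkingSet} (hΛ : Good Λ) {A B : Formula} {T : Set ℕ}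
    (hr : .bin .tensor A B ∈ Λ.seq) (h : SplitBy Λ (.bin .tensor A B) A B T)
    (h₀ : (half (.bin .tensor A B) A T Λ).Sequentializable)
    (h₁ : (half (.bin .tensor A B) B Tᶜ Λ).Sequentializable) : Λ.Sequentializable := by
  obtain ⟨Γ₁, Γ₂, he, n₁, n₂⟩ := hΛ.named.exists_append hr
  obtain ⟨p, hp⟩ := h₀
  obtain ⟨q, hq⟩ := h₁
  let φ : Set ℕ → Formula → Sequent := fun U C => open Classical in if Within U C then [C] else []
  have hseq : ∀ D U, (half (.bin .tensor A B) D U Λ).seq =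
      Γ₁.flatMap (φ U) ++ D :: Γ₂.flatMap (φ U) := fun D U => by
    simp only [half, he, List.flatMap_append, List.flatMap_cons, Sequent.flatMap_ite n₁,
      Sequent.flatMap_ite n₂, if_true, List.singleton_append, φ]
  obtain ⟨p', hp'⟩ : Translates (Γ₁.flatMap (φ T) ++ Γ₂.flatMap (φ T) ++ [A])
      (half (.bin .tensor A B) A T Λ).linkings := Translates.perm ⟨p, hp⟩ (by
    rw [hseq]; simpa using perm_middle_swap (Γ₁.flatMap (φ T)) (Γ₂.flatMap (φ T)) [A])
  obtain ⟨q', hq'⟩ : Translates (B :: (Γ₁.flatMap (φ Tᶜ) ++ Γ₂.flatMap (φ Tᶜ)))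
      (half (.bin .tensor A B) B Tᶜ Λ).linkings := Translates.perm ⟨q, hq⟩ (by
    rw [hseq]; exact List.perm_middle)
  have roots : ∀ C ∈ Γ₁ ++ Γ₂, (∀ x ∈ C.leaves, x ∈ T) ∨ ∀ x ∈ C.leaves, x ∉ T := by
    intro C hC
    rcases List.mem_append.1 hC with hC | hC
    · exact h.roots C (by simp [he, hC]) (n₁ C hC)
    · exact h.roots C (by simp [he, hC]) (n₂ C hC)
  have hpart := within_partition_perm roots
  simp only [List.flatMap_append] at hpart
  refine Translates.perm ⟨Proof.tensor p' q', ?_⟩ (?_ : List.Perm _ Λ.seq)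
  · rw [Proof.translate, hp', hq']; exact h.image₂_eq
  · rw [he]
    exact List.perm_middle.trans ((hpart.cons _).trans List.perm_middle.symm)

/-- An erasure read upwards is an inference rule; permutations carry the active formula between its
place in the sequent and the place that the rule prescribes. -/
theorem Erases.sequentializable {Λ : LinkingSet} (hΛ : Good Λ) {r : Formula} (hr : r ∈ Λ.seq)
    {E : List LinkingSet} (h : Erases Λ r E) (hE : ∀ M ∈ E, M.Sequentializable) :
    Λ.Sequentializable := by
  classical
  cases h with
  | @split A B T h =>
    rcases h.eq with rfl | rfl
    · exact h.translates hΛ hr (hE _ (by simp)) (hE _ (by simp))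
    · exact h.symm.translates hΛ hr (hE _ (by simp)) (by rw [compl_compl]; exact hE _ (by simp))
  | branches h =>
    obtain ⟨Γ₁, Γ₂, he, n₁, n₂⟩ := hΛ.named.exists_append hr
    have hseq : ∀ As, (branch r As Λ).seq = Γ₁ ++ As ++ Γ₂ := fun As => by
      rw [branch, he]; exact Sequent.subst_eq n₁ n₂ As
    have prem : ∀ As, (branch r As Λ).Sequentializable →
        Translates (Γ₁ ++ Γ₂ ++ As) (branch r As Λ).linkings := fun As h =>
      Translates.perm h (by rw [hseq]; exact perm_middle_swap _ _ _)
    have concl : Translates (Γ₁ ++ Γ₂ ++ [r]) Λ.linkings → Λ.Sequentializable := fun h =>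
      Translates.perm h (by rw [he]; simpa using (perm_middle_swap Γ₁ Γ₂ [r]).symm)
    have single : ∀ {As}, Branches Λ r [As] → (branch r As Λ).linkings = Λ.linkings := fun h => by
      rw [h.linkings_eq hΛ hr]
    cases h with
    | par A B =>
      obtain ⟨p, hp⟩ := prem _ (hE _ (List.mem_map_of_mem (List.mem_singleton_self _)))
      exact concl ⟨.par p, by rw [Proof.translate, hp, single (.par A B)]⟩
    | amp A B =>
      obtain ⟨p, hp⟩ := prem [A] (hE _ (by simp))
      obtain ⟨q, hq⟩ := prem [B] (hE _ (by simp))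
      refine concl ⟨.amp p q, ?_⟩
      rw [Proof.translate, hp, hq]
      ext lam
      simp only [Finset.mem_union, mem_branch, ← and_or_left, and_iff_left_iff_imp]
      intro hlam
      simpa using (Branches.amp A B).exists_meets hΛ hr hlam
    | plus₀ A B hB =>
      obtain ⟨p, hp⟩ := prem [A] (hE _ (by simp))
      exact concl ⟨.plus₀ B p, by rw [Proof.translate, hp, single (.plus₀ A B hB)]⟩
    | plus₁ A B hA =>
      obtain ⟨p, hp⟩ := prem [B] (hE _ (by simp))
      exact concl ⟨.plus₁ A p, by rw [Proof.translate, hp, single (.plus₁ A B hA)]⟩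

/-- Induction on weight: outcome `⊥` excludes disconnected sets (`⊤`) and stuck ones (a singleton),
so `Λ` is an axiom or has a ready root whose results again have outcome `⊥`. -/
theorem sequentializable_of_outcome {Λ : LinkingSet} (hΛ : Good Λ) (h : outcome Λ = ⊥) :
    Λ.Sequentializable := by
  induction hn : weight Λ using Nat.strong_induction_on generalizing Λ with
  | _ n ih =>
    subst hn
    have hc : Λ.Connected := by
      by_contra hc
      rw [outcome, if_neg hc] at h
      exact top_ne_bot h
    have hco := hΛ.connected_iff.1 hc
    by_cases hax : Λ.IsAxiom
    · obtain ⟨Γ, K⟩ := Λ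
      obtain ⟨x, y, P, he, hl⟩ := hax
      simp only at he hl
      subst he hl
      exact ⟨.ax x y P, rfl⟩
    · by_cases hr : ∃ r ∈ Λ.seq, Λ.Ready r
      · obtain ⟨r, hr, hready⟩ := hr
        obtain ⟨E, hE⟩ := exists_erases hΛ hco hr hready
        have := (outcome_le_iff hΛ r hr E hE ⊥).1 h.le
        exact hE.sequentializable hΛ hr fun M hM =>
          ih _ (hE.weight_lt_of_mem hΛ hco.1 hr hM) (hE.good hΛ hr hM) (le_bot_iff.1 (this M hM)) rfl
      · push Not at hr
        rw [outcome_stuck hc hax hr] at h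
        have : ({Λ} : Finset LinkingSet) = ∅ := WithTop.coe_injective h
        simp at this

theorem Proof.mem_leaves {Γ : Sequent} (p : Proof Γ) {lam : Finset Link} (hlam : lam ∈ p.translate)
    {l : Link} (hl : l ∈ lam) {x : ℕ} (hx : x ∈ l) : x ∈ Γ.leaves := by
  induction p generalizing lam with
  | ax a b P =>
    simp only [Proof.translate, Finset.mem_singleton] at hlam
    subst hlam
    obtain rfl := Finset.mem_singleton.1 hl
    simpa [Formula.leaves] using hx
  | perm h p ih => exact (h.flatMap_right _).mem_iff.1 (ih hlam hl)
  | par p ih => simpa [Sequent.leaves_append, Formula.leaves] using ih hlam hl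
  | plus₀ B p ih =>
    have := ih hlam hl
    simp only [Sequent.leaves_append, Sequent.leaves_cons, Sequent.leaves_nil, Formula.leaves,
      List.mem_append] at this ⊢
    tauto
  | plus₁ A p ih =>
    have := ih hlam hl
    simp only [Sequent.leaves_append, Sequent.leaves_cons, Sequent.leaves_nil, Formula.leaves,
      List.mem_append] at this ⊢
    tauto
  | tensor p q ihp ihq =>
    obtain ⟨mu, hmu, nu, hnu, rfl⟩ := Finset.mem_image₂.1 hlam
    simp only [Sequent.leaves_append, Sequent.leaves_cons, Sequent.leaves_nil, Formula.leaves,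
      List.mem_append, List.append_nil] at ihp ihq ⊢
    rcases Finset.mem_union.1 hl with hl | hl
    · have := ihp hmu hl; tauto
    · have := ihq hnu hl; tauto
  | amp p q ihp ihq =>
    simp only [Sequent.leaves_append, Sequent.leaves_cons, Sequent.leaves_nil, Formula.leaves,
      List.mem_append, List.append_nil] at ihp ihq ⊢
    rcases Finset.mem_union.1 hlam with hlam | hlam
    · have := ihp hlam hl; tauto
    · have := ihq hlam hl; tauto

theorem Proof.not_meets {Γ : Sequent} (p : Proof Γ) {lam : Finset Link} (hlam : lam ∈ p.translate)
    {B : Formula} (hB : ∀ x ∈ B.leaves, x ∉ Γ.leaves) : ¬ Meets lam [B] := by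
  rintro ⟨x, hx, l, hl, hxl⟩
  exact hB x (by simpa using hx) (p.mem_leaves hlam hl hxl)

theorem Proof.translate_nonempty {Γ : Sequent} (p : Proof Γ) : p.translate.Nonempty := by
  induction p with
  | ax => exact Finset.singleton_nonempty _
  | perm _ _ ih => exact ih
  | par _ ih => exact ih
  | plus₀ _ _ ih => exact ih
  | plus₁ _ _ ih => exact ih
  | tensor _ _ ihp ihq => exact ihp.image₂ ihq
  | amp _ _ ihp _ => exact ihp.mono Finset.subset_union_left

theorem subst_perm {Γ Δ : Sequent} {r : Formula} (hΔ : Δ.WellNamed) (h : (Γ ++ [r]).Perm Δ)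
    (As : Sequent) : (Γ ++ As).Perm (Δ.subst r As) := by
  have hnd := h.nodup_iff.2 hΔ.nodup
  have := h.flatMap_right (fun C => if C = r then As else [C])
  rw [List.flatMap_append, Sequent.flatMap_ite] at this
  · simpa [Sequent.subst] using this
  · rintro C hC rfl
    exact (List.nodup_append.1 hnd).2.2 C hC C (by simp) rfl

/-- Induction on the proof: its last rule is an erasure of the root it introduces, with the premises
as results, and `outcome_le_iff` permits any root. Sequents are compared up to permutation because
erasure replaces roots in place. -/
theorem outcome_of_proof {Γ : Sequent} (p : Proof Γ) : ∀ {Λ : LinkingSet}, Good Λ →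
    Γ.Perm Λ.seq → p.translate = Λ.linkings → outcome Λ = ⊥ := by
  have reduce : ∀ {Λ : LinkingSet}, Good Λ → ∀ {r}, r ∈ Λ.seq → ∀ {E}, Erases Λ r E →
      (∀ M ∈ E, outcome M = ⊥) → outcome Λ = ⊥ := fun hΛ r hr E hE h =>
    le_bot_iff.1 ((outcome_le_iff hΛ r hr E hE ⊥).2 fun M hM => (h M hM).le)
  have nodup : ∀ {Γ : Sequent} {Λ : LinkingSet}, Good Λ → Γ.Perm Λ.seq → Γ.leaves.Nodup :=
    fun hΛ hp => (hp.flatMap_right _).nodup_iff.2 hΛ.named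
  induction p with
  | ax x y P =>
    intro Λ hΛ hp hK
    refine outcome_axiom hΛ ?_
    have hp' := hp.symm
    rcases List.perm_pair.1 hp' with h | h
    · exact ⟨x, y, P, h, hK.symm⟩
    -- With the leaves in the other order, the axiom is one on `P.dual`, whose dual is `P`.
    · exact ⟨y, x, P.dual, by simpa using h, by rw [← hK, Proof.translate, Sym2.eq_swap]⟩
  | perm h p ih => exact fun hΛ hp hK => ih hΛ (h.trans hp) hK
  | @par Γ A B p ih =>
    intro Λ hΛ hp hK
    have hr : .bin .par A B ∈ Λ.seq := hp.mem_iff.1 (by simp)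
    refine reduce hΛ hr (.branches (.par A B)) fun M hM => ?_
    obtain rfl := List.mem_singleton.1 hM
    refine ih ((Branches.par A B).good hΛ hr (by simp)) (subst_perm hΛ.named hp _) ?_
    exact hK.trans (congrArg LinkingSet.linkings ((Branches.par A B).linkings_eq hΛ hr)).symm
  | @plus₀ Γ A B p ih =>
    intro Λ hΛ hp hK
    have hr : .bin .plus A B ∈ Λ.seq := hp.mem_iff.1 (by simp)
    have hB : Branches Λ (.bin .plus A B) [[A]] := by
      refine .plus₀ A B fun h => ?_
      obtain ⟨lam, hlam, hm⟩ := touches_iff.1 h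
      rw [← hK] at hlam
      refine p.not_meets hlam (fun x hx hxΓ => ?_) hm
      have := nodup hΛ hp
      simp [Sequent.leaves_append, Formula.leaves, List.nodup_append] at this hxΓ
      grind
    refine reduce hΛ hr (.branches hB) fun M hM => ?_
    obtain rfl := List.mem_singleton.1 hM
    refine ih (hB.good hΛ hr (by simp)) (subst_perm hΛ.named hp _) ?_
    exact hK.trans (congrArg LinkingSet.linkings (hB.linkings_eq hΛ hr)).symm
  | @plus₁ Γ A B p ih =>
    intro Λ hΛ hp hK
    have hr : .bin .plus A B ∈ Λ.seq := hp.mem_iff.1 (by simp)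
    have hB : Branches Λ (.bin .plus A B) [[B]] := by
      refine .plus₁ A B fun h => ?_
      obtain ⟨lam, hlam, hm⟩ := touches_iff.1 h
      rw [← hK] at hlam
      refine p.not_meets hlam (fun x hx hxΓ => ?_) hm
      have := nodup hΛ hp
      simp [Sequent.leaves_append, Formula.leaves, List.nodup_append] at this hxΓ
      grind
    refine reduce hΛ hr (.branches hB) fun M hM => ?_
    obtain rfl := List.mem_singleton.1 hM
    refine ih (hB.good hΛ hr (by simp)) (subst_perm hΛ.named hp _) ?_
    exact hK.trans (congrArg LinkingSet.linkings (hB.linkings_eq hΛ hr)).symm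
  | @amp Γ A B p q ihp ihq =>
    intro Λ hΛ hp hK
    have hr : .bin .amp A B ∈ Λ.seq := hp.mem_iff.1 (by simp)
    have hnd := nodup hΛ hp
    simp only [Sequent.leaves_append, Sequent.leaves_cons, Sequent.leaves_nil, Formula.leaves,
      List.append_nil, List.nodup_append, List.mem_append] at hnd
    have hpB : ∀ lam ∈ p.translate, ¬ Meets lam [B] := fun lam hlam =>
      p.not_meets hlam fun x hx hxΓ => by
        simp [Sequent.leaves_append] at hxΓ
        grind
    have hqA : ∀ lam ∈ q.translate, ¬ Meets lam [A] := fun lam hlam =>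
      q.not_meets hlam fun x hx hxΓ => by
        simp [Sequent.leaves_append] at hxΓ
        grind
    have hres : ∀ lam ∈ Λ.linkings, Meets lam [A] ∨ Meets lam [B] := fun lam hlam =>
      meets_bin.1 (hΛ.resolves lam hlam _ hr).meets
    rw [Proof.translate] at hK
    refine reduce hΛ hr (.branches (.amp A B)) fun M hM => ?_
    simp only [List.map_cons, List.map_nil, List.mem_cons, List.not_mem_nil, or_false] at hM
    rcases hM with rfl | rfl
    · refine ihp ((Branches.amp A B).good hΛ hr (by simp)) (subst_perm hΛ.named hp _) ?_
      ext lam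
      rw [mem_branch, ← hK, Finset.mem_union]
      refine ⟨fun h => ⟨.inl h, ?_⟩, fun ⟨h, hm⟩ => h.resolve_right fun h => hqA lam h hm⟩
      exact (hres lam (hK ▸ Finset.mem_union_left _ h)).resolve_right (hpB lam h)
    · refine ihq ((Branches.amp A B).good hΛ hr (by simp)) (subst_perm hΛ.named hp _) ?_
      ext lam
      rw [mem_branch, ← hK, Finset.mem_union]
      refine ⟨fun h => ⟨.inr h, ?_⟩, fun ⟨h, hm⟩ => h.resolve_left fun h => hpB lam h hm⟩
      exact (hres lam (hK ▸ Finset.mem_union_right _ h)).resolve_left (hqA lam h)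
  | @tensor Γ Δ A B p q ihp ihq =>
    intro Λ hΛ hp hK
    have hr : .bin .tensor A B ∈ Λ.seq := hp.mem_iff.1 (by simp)
    have hnd := nodup hΛ hp
    simp only [Sequent.leaves_append, Sequent.leaves_cons, Formula.leaves, List.nodup_append,
      List.mem_append] at hnd
    have hnd' := hp.nodup_iff.2 hΛ.named.nodup
    rw [List.nodup_append, List.nodup_cons] at hnd'
    set r := Formula.bin .tensor A B with hrdef
    -- The splitting set consists of the leaves of the left premise. Names are distinct, so the
    -- links of the right premise avoid it.
    let T : Set ℕ := {x | x ∈ Sequent.leaves (Γ ++ [A])}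
    have memT : ∀ x, x ∈ T ↔ x ∈ Γ.leaves ∨ x ∈ A.leaves := fun x => by
      simp [T, Sequent.leaves_append]
    have inT : ∀ x ∈ Sequent.leaves (Γ ++ [A]), x ∈ T := fun x hx => hx
    have outT : ∀ x ∈ Sequent.leaves (B :: Δ), x ∉ T := fun x hx => by
      rw [memT]; simp at hx; grind
    have hΓ : ∀ C ∈ Γ, C ≠ r ∧ Within T C := fun C hC =>
      ⟨fun he => hnd'.2.2 C hC r (by simp) he,
        fun x hx => (memT x).2 (.inl (leaves_subset hC hx))⟩
    have hΔ : ∀ C ∈ Δ, C ≠ r ∧ Within Tᶜ C := fun C hC =>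
      ⟨fun he => hnd'.2.1.1 (he ▸ hC),
        fun x hx => outT x (by simp [leaves_subset hC hx])⟩
    have linkp : ∀ lam ∈ p.translate, ∀ l ∈ lam, ∀ x ∈ l, x ∈ T := fun lam hlam l hl x hx =>
      inT x (p.mem_leaves hlam hl hx)
    have linkq : ∀ lam ∈ q.translate, ∀ l ∈ lam, ∀ x ∈ l, x ∉ T := fun lam hlam l hl x hx =>
      outT x (q.mem_leaves hlam hl hx)
    have onp : ∀ lam ∈ p.translate, ∀ mu ∈ q.translate, onSet T (lam ∪ mu) = lam := by
      intro lam hlam mu hmu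
      ext l
      obtain ⟨x, hx⟩ := Link.exists_mem l
      simp only [mem_onSet, Finset.mem_union]
      exact ⟨fun ⟨h, hT⟩ => h.resolve_right fun h => linkq mu hmu l h x hx (hT x hx),
        fun h => ⟨.inl h, linkp lam hlam l h⟩⟩
    have onq : ∀ lam ∈ p.translate, ∀ mu ∈ q.translate, onSet Tᶜ (lam ∪ mu) = mu := by
      intro lam hlam mu hmu
      ext l
      obtain ⟨x, hx⟩ := Link.exists_mem l
      simp only [mem_onSet, Finset.mem_union]
      exact ⟨fun ⟨h, hT⟩ => h.resolve_left fun h => hT x hx (linkp lam hlam l h x hx),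
        fun h => ⟨.inr h, linkq mu hmu l h⟩⟩
    rw [Proof.translate] at hK
    have hmem : ∀ {nu}, nu ∈ Λ.linkings ↔ ∃ lam ∈ p.translate, ∃ mu ∈ q.translate, lam ∪ mu = nu :=
      fun {nu} => by rw [← hK, Finset.mem_image₂]
    have hsplit : SplitBy Λ r A B T := by
      refine ⟨⟨.inl rfl, fun x hx => (memT x).2 (.inr hx), fun x hx => outT x (by simp [hx]),
        fun C hC hne => ?_, fun nu hnu l hl => ?_⟩, fun nu hnu nu' hnu' => ?_⟩
      · have := hp.mem_iff.2 hC
        simp only [List.mem_append, List.mem_cons, hne, false_or] at this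
        exact this.imp (fun h => (hΓ C h).2) fun h => (hΔ C h).2
      · obtain ⟨lam, hlam, mu, hmu, rfl⟩ := hmem.1 hnu
        exact (Finset.mem_union.1 hl).imp (linkp lam hlam l) (linkq mu hmu l)
      · obtain ⟨lam, hlam, mu, hmu, rfl⟩ := hmem.1 hnu
        obtain ⟨lam', hlam', mu', hmu', rfl⟩ := hmem.1 hnu'
        rw [onp lam hlam mu hmu, onq lam' hlam' mu' hmu']
        exact hmem.2 ⟨lam, hlam, mu', hmu', rfl⟩
    -- A linking of one premise is recovered as a restriction only when the other premise offers
    -- some linking to join it with.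
    obtain ⟨lam₀, hlam₀⟩ := p.translate_nonempty
    obtain ⟨mu₀, hmu₀⟩ := q.translate_nonempty
    refine reduce hΛ hr (.split hsplit) fun M hM => ?_
    simp only [List.mem_cons, List.not_mem_nil, or_false] at hM
    have hnotW : ∀ {U : Set ℕ} {C : Formula}, (∀ x ∈ C.leaves, x ∉ U) → ¬ Within U C :=
      fun h h' => let ⟨x, hx⟩ := Formula.exists_mem_leaves _; h x hx (h' x hx)
    have nilMap : ∀ {Θ : Sequent} {f : Formula → Sequent}, (∀ C ∈ Θ, f C = []) →
        Θ.flatMap f = [] := fun h => List.flatMap_eq_nil_iff.2 h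
    have idMap : ∀ {Θ : Sequent} {f : Formula → Sequent}, (∀ C ∈ Θ, f C = [C]) →
        Θ.flatMap f = Θ := fun h => (flatMap_congr_mem h).trans (List.flatMap_singleton' _)
    rcases hM with rfl | rfl
    · refine ihp (hsplit.good hΛ hr) ?_ ?_
      · have := hp.flatMap_right
          (fun C => open Classical in if C = r then [A] else if Within T C then [C] else [])
        rw [List.flatMap_append, List.flatMap_cons, if_pos rfl, idMap, nilMap, List.append_nil]
          at this
        · exact this
        · exact fun C hC => by rw [if_neg (hΔ C hC).1, if_neg (hnotW (hΔ C hC).2)]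
        · exact fun C hC => by rw [if_neg (hΓ C hC).1, if_pos (hΓ C hC).2]
      · ext lam
        simp only [half, Finset.mem_image, hmem]
        constructor
        · exact fun h => ⟨_, ⟨lam, h, mu₀, hmu₀, rfl⟩, onp lam h mu₀ hmu₀⟩
        · rintro ⟨_, ⟨lam', h, mu, hmu, rfl⟩, rfl⟩
          rwa [onp lam' h mu hmu]
    · refine ihq (hsplit.symm.good hΛ hr) ?_ ?_
      · have := hp.flatMap_right
          (fun C => open Classical in if C = r then [B] else if Within Tᶜ C then [C] else [])
        rw [List.flatMap_append, List.flatMap_cons, if_pos rfl, nilMap, idMap, List.nil_append]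
          at this
        · exact this
        · exact fun C hC => by rw [if_neg (hΔ C hC).1, if_pos (hΔ C hC).2]
        · exact fun C hC => by
            have : ¬ Within Tᶜ C := hnotW fun x hx hxT => hxT ((hΓ C hC).2 x hx)
            rw [if_neg (hΓ C hC).1, if_neg this]
      · ext mu
        simp only [half, Finset.mem_image, hmem]
        constructor
        · exact fun h => ⟨_, ⟨lam₀, hlam₀, mu, h, rfl⟩, onq lam₀ hlam₀ mu h⟩
        · rintro ⟨_, ⟨lam, h, mu', hmu, rfl⟩, rfl⟩
          rwa [onq lam h mu' hmu]

theorem sequentializable_iff {Λ : LinkingSet} (hΛ : Good Λ) :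
    Λ.Sequentializable ↔ outcome Λ = ⊥ :=
  ⟨fun ⟨p, hp⟩ => outcome_of_proof p hΛ (List.Perm.refl _) hp, sequentializable_of_outcome hΛ⟩

end MALL

namespace WhileLang

/-! ### Polynomial-time functions on encoded types -/

/-- A type whose elements are represented by binary trees and have a size. -/
class Enc (α : Type) where
  enc : α → Data
  size : α → ℕ

open Enc

instance : Enc Unit := ⟨fun _ => .nil, fun _ => 0⟩

instance : Enc Bool := ⟨fun b => bif b then .cons .nil .nil else .nil, fun _ => 1⟩

instance : Enc ℕ := ⟨encNat, fun n => n + 1⟩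

instance {α β : Type} [Enc α] [Enc β] : Enc (α × β) :=
  ⟨fun x => .cons (enc x.1) (enc x.2), fun x => size x.1 + size x.2 + 1⟩

instance {α : Type} [Enc α] : Enc (List α) :=
  ⟨encList enc, fun l => (l.map fun a => size a + 1).sum + 1⟩

variable {α β γ δ : Type} [Enc α] [Enc β] [Enc γ] [Enc δ]

theorem size_pair (a : α) (b : β) : size (a, b) = size a + size b + 1 := rfl

@[simp] theorem size_nil : size ([] : List α) = 1 := rfl

@[simp] theorem size_cons (a : α) (l : List α) : size (a :: l) = size a + size l + 1 := by
  simp only [size, List.map_cons, List.sum_cons]; omega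

theorem size_append (l m : List α) : size (l ++ m) + 1 = size l + size m := by
  simp only [size, List.map_append, List.sum_append]; omega

theorem size_reverse (l : List α) : size l.reverse = size l := by
  simp only [size, List.map_reverse, List.sum_reverse]

theorem length_lt_size (l : List α) : l.length < size l := by
  induction l with
  | nil => simp
  | cons a l ih => simp only [size_cons, List.length_cons]; omega

theorem size_le_of_mem {l : List α} {a : α} (h : a ∈ l) : size a ≤ size l := by
  induction l with
  | nil => simp at h
  | cons b l ih =>
    simp only [size_cons]
    rcases List.mem_cons.1 h with rfl | h
    · omega
    · have := ih h; omega

theorem size_le_of_sublist {l m : List α} (h : l.Sublist m) : size l ≤ size m := by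
  induction h with
  | slnil => exact le_rfl
  | cons a _ ih => simp only [size_cons]; omega
  | cons_cons a _ ih => simp only [size_cons]; omega

theorem size_le_length_mul {l : List α} {B : ℕ} (h : ∀ a ∈ l, size a ≤ B) :
    size l ≤ l.length * (B + 1) + 1 := by
  induction l with
  | nil => simp
  | cons a l ih =>
    have h1 := ih fun b hb => h b (by simp [hb])
    have h2 := h a (by simp)
    simp only [size_cons, List.length_cons, add_mul]
    omega

theorem size_flatMap_le {β : Type} {l : List β} {f : β → List γ} {B : ℕ} (h : ∀ b ∈ l, size (f b) ≤ B) :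
    size (l.flatMap f) ≤ l.length * B + 1 := by
  induction l with
  | nil => simp
  | cons a l ih =>
    have h1 := ih fun b hb => h b (by simp [hb])
    have h2 := h a (by simp)
    have h3 := size_append (f a) (l.flatMap f)
    simp only [List.flatMap_cons, List.length_cons, add_mul]
    omega

theorem eval_mono (p : Polynomial ℕ) {m n : ℕ} (h : m ≤ n) : p.eval m ≤ p.eval n := by
  rw [Polynomial.eval_eq_sum, Polynomial.eval_eq_sum]
  exact Finset.sum_le_sum fun i _ => Nat.mul_le_mul_left _ (Nat.pow_le_pow_left h i)

/-- The expression `e` about the head of variable `0`. -/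
def Expr.onHd : Expr → Expr
  | .var i => if i = 0 then .hd (.var 0) else .var i
  | .nil => .nil
  | .cons e f => .cons e.onHd f.onHd
  | .hd e => .hd e.onHd
  | .tl e => .tl e.onHd

/-- The program `c` acting on the head of variable `0`. -/
def Prog.onHd : Prog → Prog
  | .assign i e => if i = 0 then .assign 0 (.cons e.onHd (.tl (.var 0))) else .assign i e.onHd
  | .seq c d => .seq c.onHd d.onHd
  | .ite e c d => .ite e.onHd c.onHd d.onHd
  | .loop e c => .loop e.onHd c.onHd

/-- The store `s` with `d` paired to variable `0`. -/
def Store.push (s : Store) (d : Data) : Store := Function.update s 0 (.cons (s 0) d)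

theorem Expr.eval_onHd (e : Expr) (s : Store) (d : Data) : e.onHd.eval (s.push d) = e.eval s := by
  induction e with
  | var i =>
    by_cases h : i = 0
    · subst h; simp [onHd, eval, Store.push, Data.hd]
    · simp [onHd, eval, Store.push, h]
  | nil => rfl
  | cons e f he hf => simp [onHd, eval, he, hf]
  | hd e he => simp [onHd, eval, he]
  | tl e he => simp [onHd, eval, he]

theorem Expr.time_onHd (e : Expr) : e.onHd.time ≤ 2 * e.time := by
  induction e with
  | var i => by_cases h : i = 0 <;> simp [onHd, time, h]
  | nil => simp [onHd, time]
  | cons e f he hf => simp only [onHd, time]; omega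
  | hd e he => simp only [onHd, time]; omega
  | tl e he => simp only [onHd, time]; omega

theorem Expr.time_pos (e : Expr) : 0 < e.time := by cases e <;> simp [time]

/-- A value can be kept in the tail of variable `0` while a program runs on the head, so no fresh
variables are needed. The factor 5 is generous: expressions at most double, and an assignment to
variable `0` has also to rebuild the pair. -/
theorem Exec.onHd {c : Prog} {s s' : Store} {t : ℕ} (h : Exec c s s' t) (d : Data) :
    ∃ t' ≤ 5 * t, Exec c.onHd (s.push d) (s'.push d) t' := by
  induction h with
  | assign i e s =>
    have h1 := e.time_onHd
    have h2 := e.time_pos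
    by_cases h : i = 0
    · subst h
      refine ⟨(Expr.cons e.onHd (.tl (.var 0))).time + 1, ?_, ?_⟩
      rotate_left
      · rw [Prog.onHd, if_pos rfl]
        convert Exec.assign 0 _ _ using 1
        simp [Store.push, Expr.eval, Data.tl, ← e.eval_onHd s d]
      · simp only [Expr.time]; omega
    · refine ⟨e.onHd.time + 1, ?_, ?_⟩
      rotate_left
      · rw [Prog.onHd, if_neg h]
        convert Exec.assign i _ _ using 1
        rw [Expr.eval_onHd, Store.push, Store.push, Function.update_comm h,
          Function.update_of_ne (Ne.symm h)]
      · omega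
  | seq _ _ ih ih' =>
    obtain ⟨t, ht, h⟩ := ih
    obtain ⟨t', ht', h'⟩ := ih'
    exact ⟨t + t', by omega, .seq h h'⟩
  | @iteTrue e _ _ _ _ _ he _ ih =>
    obtain ⟨t, ht, h⟩ := ih
    have := e.time_onHd
    exact ⟨_, by omega, .iteTrue (by rwa [Expr.eval_onHd]) h⟩
  | @iteFalse e _ _ _ _ _ he _ ih =>
    obtain ⟨t, ht, h⟩ := ih
    have := e.time_onHd
    exact ⟨_, by omega, .iteFalse (by rwa [Expr.eval_onHd]) h⟩
  | @loopTrue e _ _ _ _ _ _ he _ _ ih ih' =>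
    obtain ⟨t, ht, h⟩ := ih
    obtain ⟨t', ht', h'⟩ := ih'
    have := e.time_onHd
    exact ⟨_, by omega, .loopTrue (by rwa [Expr.eval_onHd]) h h'⟩
  | @loopFalse e _ _ he =>
    have := e.time_onHd
    exact ⟨_, by omega, .loopFalse (by rwa [Expr.eval_onHd])⟩

/-- The program `c` computes `f` on variable `0`, in time bounded by `p`. -/
def Computes (c : Prog) (p : Polynomial ℕ) (f : α → β) : Prop :=
  ∀ a, (∀ s : Store, s 0 = enc a →
    ∃ t ≤ p.eval (size a), Exec c s (Function.update s 0 (enc (f a))) t) ∧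
    size (f a) ≤ p.eval (size a)

/-- The function `f` is computable in polynomial time, with polynomial output size. -/
def PolyTime (f : α → β) : Prop := ∃ c p, Computes c p f

theorem Computes.onHd {c : Prog} {p : Polynomial ℕ} {f : α → β} (h : Computes c p f) (a : α)
    (d : Data) {s : Store} (hs : s 0 = .cons (enc a) d) :
    ∃ t ≤ 5 * p.eval (size a),
      Exec c.onHd s (Function.update s 0 (.cons (enc (f a)) d)) t := by
  obtain ⟨t, ht, he⟩ := (h a).1 (Function.update s 0 (enc a)) (by simp)
  obtain ⟨t', ht', he'⟩ := he.onHd d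
  refine ⟨t', by omega, ?_⟩
  convert he' using 1
  · simp [Store.push, ← hs]
  · simp [Store.push]

theorem exec_assign {s : Store} {e : Expr} {d : Data} (h : e.eval s = d) :
    Exec (.assign 0 e) s (Function.update s 0 d) (e.time + 1) := h ▸ Exec.assign 0 e s

/-! ### Closure properties of polynomial-time functions -/

namespace PolyTime

open Polynomial

theorem ofExpr {f : α → β} (e : Expr) (p : Polynomial ℕ)
    (h : ∀ a (s : Store), s 0 = enc a → e.eval s = enc (f a))
    (hp : ∀ a, size (f a) ≤ p.eval (size a)) : PolyTime f := by
  refine ⟨.assign 0 e, C (e.time + 1) + p, fun a => ⟨fun s hs => ⟨_, ?_, exec_assign (h a s hs)⟩, ?_⟩⟩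
  · simp
  · have := hp a; simp; omega

theorem ofIte {f : α → β} (e e₁ e₂ : Expr) (p : Polynomial ℕ)
    (h : ∀ a (s : Store), s 0 = enc a → (e.eval s ≠ .nil ∧ e₁.eval s = enc (f a)) ∨
      (e.eval s = .nil ∧ e₂.eval s = enc (f a)))
    (hp : ∀ a, size (f a) ≤ p.eval (size a)) : PolyTime f := by
  refine ⟨.ite e (.assign 0 e₁) (.assign 0 e₂), C (e.time + 1 + (e₁.time + 1) + (e₂.time + 1)) + p,
    fun a => ⟨fun s hs => ?_, ?_⟩⟩
  · rcases h a s hs with ⟨h1, h2⟩ | ⟨h1, h2⟩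
    · exact ⟨_, by simp; omega, .iteTrue h1 (exec_assign h2)⟩
    · exact ⟨_, by simp; omega, .iteFalse h1 (exec_assign h2)⟩
  · have := hp a; simp; omega

theorem id : PolyTime (fun a : α => a) :=
  ofExpr (.var 0) X (fun a s hs => hs) fun a => by simp

theorem comp {g : β → γ} {f : α → β} (hg : PolyTime g) (hf : PolyTime f) :
    PolyTime fun a => g (f a) := by
  obtain ⟨c, p, hf⟩ := hf
  obtain ⟨d, q, hg⟩ := hg
  refine ⟨.seq c d, p + q.comp p, fun a => ⟨fun s hs => ?_, ?_⟩⟩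
  · obtain ⟨t, ht, h⟩ := (hf a).1 s hs
    obtain ⟨t', ht', h'⟩ := (hg (f a)).1 (Function.update s 0 (enc (f a))) (by simp)
    have := eval_mono q (hf a).2
    refine ⟨t + t', by simp; omega, ?_⟩
    rw [Function.update_idem] at h'
    exact .seq h h'
  · have h1 := (hg (f a)).2
    have := eval_mono q (hf a).2
    simp; omega

theorem fst : PolyTime (fun x : α × β => x.1) :=
  ofExpr (.hd (.var 0)) X (fun a s hs => by simp [Expr.eval, hs]; rfl) fun a => by
    simp [size]; omega

theorem snd : PolyTime (fun x : α × β => x.2) :=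
  ofExpr (.tl (.var 0)) X (fun a s hs => by simp [Expr.eval, hs]; rfl) fun a => by
    simp [size]; omega

/-- The input is duplicated, one copy is processed in the head, the copies are swapped, the other is
processed, and a second swap restores the order. -/
theorem pair {f : α → β} {g : α → γ} (hf : PolyTime f) (hg : PolyTime g) :
    PolyTime fun a => (f a, g a) := by
  obtain ⟨c, p, hf⟩ := hf
  obtain ⟨d, q, hg⟩ := hg
  let swap : Prog := .assign 0 (.cons (.tl (.var 0)) (.hd (.var 0)))
  refine ⟨.seq (.assign 0 (.cons (.var 0) (.var 0))) (.seq c.onHd (.seq swap (.seq d.onHd swap))),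
    20 + 5 * p + 5 * q, fun a => ⟨fun s hs => ?_, ?_⟩⟩
  · have h1 : Exec (.assign 0 (.cons (.var 0) (.var 0))) s
      (Function.update s 0 (.cons (enc a) (enc a))) 4 := exec_assign (by simp [Expr.eval, hs])
    obtain ⟨t₂, ht₂, h2⟩ := hf.onHd a (enc a) (s := Function.update s 0 (.cons (enc a) (enc a)))
      (by simp)
    have h3 : Exec swap (Function.update s 0 (.cons (enc (f a)) (enc a)))
      (Function.update s 0 (.cons (enc a) (enc (f a)))) 6 := by
        have := exec_assign (s := Function.update s 0 (.cons (enc (f a)) (enc a)))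
          (e := .cons (.tl (.var 0)) (.hd (.var 0))) (d := .cons (enc a) (enc (f a)))
          (by simp [Expr.eval, Data.hd, Data.tl])
        rwa [Function.update_idem] at this
    obtain ⟨t₄, ht₄, h4⟩ := hg.onHd a (enc (f a))
      (s := Function.update s 0 (.cons (enc a) (enc (f a)))) (by simp)
    have h5 : Exec swap (Function.update s 0 (.cons (enc (g a)) (enc (f a))))
      (Function.update s 0 (.cons (enc (f a)) (enc (g a)))) 6 := by
        have := exec_assign (s := Function.update s 0 (.cons (enc (g a)) (enc (f a))))
          (e := .cons (.tl (.var 0)) (.hd (.var 0))) (d := .cons (enc (f a)) (enc (g a)))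
          (by simp [Expr.eval, Data.hd, Data.tl])
        rwa [Function.update_idem] at this
    rw [Function.update_idem] at h2 h4
    refine ⟨_, ?_, .seq h1 (.seq h2 (.seq h3 (.seq h4 h5)))⟩
    simp; omega
  · have h1 := (hf a).2
    have h2 := (hg a).2
    rw [size_pair]; simp; omega

/-- Branching on a computed value, where `nil` counts as false. -/
theorem branch {τ : α → β} (hτ : PolyTime τ) {f g h : α → γ} (hf : PolyTime f) (hg : PolyTime g)
    (hh : ∀ a, h a = open Classical in if enc (τ a) = .nil then g a else f a) : PolyTime h := by
  obtain ⟨b, r, hb⟩ := hτ.pair (id (α := α))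
  obtain ⟨c, p, hf⟩ := hf
  obtain ⟨d, q, hg⟩ := hg
  refine ⟨.seq b (.ite (.hd (.var 0)) (.seq (.assign 0 (.tl (.var 0))) c)
    (.seq (.assign 0 (.tl (.var 0))) d)), r + 6 + p + q, fun a => ⟨fun s hs => ?_, ?_⟩⟩
  · obtain ⟨t, ht, h1⟩ := (hb a).1 s hs
    have h2 : Exec (.assign 0 (.tl (.var 0))) (Function.update s 0 (enc (τ a, a)))
        (Function.update s 0 (enc a)) 3 := by
      have := exec_assign (s := Function.update s 0 (enc (τ a, a)))
        (e := .tl (.var 0)) (d := enc a) (by simp [Expr.eval]; rfl)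
      rwa [Function.update_idem] at this
    have h3 : (Expr.hd (.var 0)).eval (Function.update s 0 (enc (τ a, a))) = enc (τ a) := by
      simp [Expr.eval]; rfl
    rw [hh]
    by_cases hnil : enc (τ a) = .nil
    · obtain ⟨t', ht', h4⟩ := (hg a).1 (Function.update s 0 (enc a)) (by simp)
      rw [Function.update_idem] at h4
      rw [if_pos hnil]
      refine ⟨_, ?_, .seq h1 (.iteFalse (h3.trans hnil) (.seq h2 h4))⟩
      simp [Expr.time]; omega
    · obtain ⟨t', ht', h4⟩ := (hf a).1 (Function.update s 0 (enc a)) (by simp)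
      rw [Function.update_idem] at h4
      rw [if_neg hnil]
      refine ⟨_, ?_, .seq h1 (.iteTrue (by rwa [h3]) (.seq h2 h4))⟩
      simp [Expr.time]; omega
  · have h1 := (hf a).2
    have h2 := (hg a).2
    rw [hh]
    split_ifs <;> simp <;> omega

theorem ite {τ : α → Bool} (hτ : PolyTime τ) {f g : α → γ} (hf : PolyTime f) (hg : PolyTime g) :
    PolyTime fun a => if τ a = true then f a else g a :=
  hτ.branch hf hg fun a => by cases h : τ a <;> simp [enc]

/-- The polynomial has to bound both the number of rounds and the size of every intermediate state;
a polynomial-time body alone could let the state grow exponentially. -/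
theorem iterate {σ : Type} [Enc σ] {body : σ → σ} {cond : σ → Bool} {i g : α → σ}
    (hi : PolyTime i) (hbody : PolyTime body) (hcond : PolyTime cond) (p : Polynomial ℕ)
    (h : ∀ a, ∃ n ≤ p.eval (size a), (∀ k < n, cond (body^[k] (i a)) = true) ∧
      cond (body^[n] (i a)) = false ∧ (∀ k ≤ n, size (body^[k] (i a)) ≤ p.eval (size a)) ∧
      g a = body^[n] (i a)) : PolyTime g := by
  -- The state travels with the current value of the condition in front, so that the loop test
  -- merely takes a head.
  obtain ⟨c, q, hc⟩ := (hcond.pair (id (α := σ))).comp hi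
  obtain ⟨d, r, hd⟩ := (hcond.pair (id (α := σ))).comp (hbody.comp (snd (α := Bool)))
  let w : Prog := .loop (.hd (.var 0)) d
  have hw : ∀ (B n : ℕ) (a : σ) (s : Store), s 0 = enc (cond a, a) →
      (∀ k < n, cond (body^[k] a) = true) → cond (body^[n] a) = false →
      (∀ k ≤ n, size (body^[k] a) ≤ B) →
      ∃ t ≤ n * (3 + r.eval (B + 2)) + 3,
        Exec w s (Function.update s 0 (enc (false, body^[n] a))) t := by
    intro B n
    induction n with
    | zero =>
      intro a s hs _ hf _
      simp only [Function.iterate_zero, id_eq] at hf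
      rw [hf] at hs
      refine ⟨3, by omega, ?_⟩
      rw [Function.iterate_zero, id_eq, ← hs, Function.update_eq_self]
      exact Exec.loopFalse (by simp [Expr.eval, hs]; rfl)
    | succ n ih =>
      intro a s hs ht hf hB
      have hta := ht 0 (by omega)
      simp only [Function.iterate_zero, id_eq] at hta
      obtain ⟨t, htle, h1⟩ := (hd (cond a, a)).1 s hs
      obtain ⟨t', htle', h2⟩ := ih (body a)
        (Function.update s 0 (enc (cond (body a), body a))) (by simp)
        (fun k hk => ht (k + 1) (by omega)) hf (fun k hk => hB (k + 1) (by omega))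
      rw [Function.update_idem] at h2
      refine ⟨_, ?_, .loopTrue (e := .hd (.var 0)) ?_ h1 h2⟩
      · have := eval_mono r (show size (cond a, a) ≤ B + 2 by
          have := hB 0 (by omega)
          simp only [Function.iterate_zero, id_eq] at this
          have h1 : size (cond a) = 1 := rfl
          rw [size_pair]; omega)
        simp only [Expr.time, add_mul]
        omega
      · rw [Expr.eval, Expr.eval, hs, hta]
        simp [enc, Data.hd]
  refine ⟨.seq c (.seq w (.assign 0 (.tl (.var 0)))), q + p * (3 + r.comp (p + 2)) + 6 + p,
    fun a => ⟨fun s hs => ?_, ?_⟩⟩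
  · obtain ⟨n, hn, ht, hf, hB, hg⟩ := h a
    obtain ⟨t₁, ht₁, h1⟩ := (hc a).1 s hs
    obtain ⟨t₂, ht₂, h2⟩ := hw (p.eval (size a)) n (i a)
      (Function.update s 0 (enc (cond (i a), i a)))
      (by simp) ht hf hB
    rw [Function.update_idem] at h2
    have h3 : Exec (.assign 0 (.tl (.var 0))) (Function.update s 0 (enc (false, body^[n] (i a))))
        (Function.update s 0 (enc (g a))) 3 := by
      have := exec_assign (s := Function.update s 0 (enc (false, body^[n] (i a))))
        (e := .tl (.var 0)) (d := enc (g a)) (by simp [Expr.eval, hg]; rfl)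
      rwa [Function.update_idem] at this
    refine ⟨_, ?_, .seq h1 (.seq h2 h3)⟩
    have := Nat.mul_le_mul_right (3 + r.eval (p.eval (size a) + 2)) hn
    simp; omega
  · obtain ⟨n, hn, ht, hf, hB, hg⟩ := h a
    have := hB n le_rfl
    rw [← hg] at this
    simp; omega

/-! #### Booleans and lists -/

theorem const_of_expr (e : Expr) (b : β) (h : ∀ s, e.eval s = enc b) :
    PolyTime (fun _ : α => b) :=
  ofExpr e (C (size b)) (fun _ s _ => h s) fun _ => by simp

theorem true : PolyTime (fun _ : α => Bool.true) := const_of_expr (.cons .nil .nil) _ fun _ => rfl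

theorem false : PolyTime (fun _ : α => Bool.false) := const_of_expr .nil _ fun _ => rfl

theorem nil : PolyTime (fun _ : α => ([] : List β)) := const_of_expr .nil _ fun _ => rfl

theorem nat (n : ℕ) : PolyTime (fun _ : α => n) := by
  suffices h : ∃ e : Expr, ∀ s, e.eval s = encNat n by
    obtain ⟨e, he⟩ := h
    exact const_of_expr e n he
  induction n with
  | zero => exact ⟨.nil, fun _ => rfl⟩
  | succ n ih =>
    obtain ⟨e, he⟩ := ih
    exact ⟨.cons .nil e, fun s => by simp [Expr.eval, he, encNat]⟩

theorem not {τ : α → Bool} (h : PolyTime τ) : PolyTime fun a => !τ a := by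
  have := h.ite (false (α := α)) true
  refine (funext fun a => ?_ : (fun a => !τ a) = _) ▸ this
  cases τ a <;> rfl

theorem and {τ υ : α → Bool} (h : PolyTime τ) (h' : PolyTime υ) : PolyTime fun a => τ a && υ a := by
  have := h.ite h' (false (α := α))
  refine (funext fun a => ?_ : (fun a => τ a && υ a) = _) ▸ this
  cases τ a <;> rfl

theorem or {τ υ : α → Bool} (h : PolyTime τ) (h' : PolyTime υ) : PolyTime fun a => τ a || υ a := by
  have := h.ite (true (α := α)) h'
  refine (funext fun a => ?_ : (fun a => τ a || υ a) = _) ▸ this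
  cases τ a <;> rfl

theorem cons {f : α → β} {l : α → List β} (hf : PolyTime f) (hl : PolyTime l) :
    PolyTime fun a => f a :: l a :=
  (ofExpr (f := fun x : β × List β => x.1 :: x.2) (.var 0) (X + 1) (fun _ _ hs => hs) fun x => by
    have : size x = size x.1 + size x.2 + 1 := rfl
    simp [this]).comp (hf.pair hl)

theorem tail : PolyTime (fun l : List α => l.tail) := by
  refine ofExpr (.tl (.var 0)) X (fun l s hs => ?_) fun l => ?_
  · cases l <;> simp [Expr.eval, hs] <;> rfl
  · simpa using size_le_of_sublist l.tail_sublist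

theorem listCases {l : α → List β} (hl : PolyTime l) {f : α → γ} (hf : PolyTime f)
    {g : α × β × List β → γ} (hg : PolyTime g) :
    PolyTime fun a => match l a with
      | [] => f a
      | b :: bs => g (a, b, bs) := by
  suffices h : PolyTime fun x : List β × α => match x.1 with
      | [] => f x.2
      | b :: bs => g (x.2, b, bs) from h.comp (hl.pair id)
  obtain ⟨c, p, hf⟩ := hf
  obtain ⟨d, q, hg⟩ := hg
  refine ⟨.ite (.hd (.var 0)) (.seq (.assign 0 (.cons (.tl (.var 0)) (.hd (.var 0)))) d)
    (.seq (.assign 0 (.tl (.var 0))) c), 9 + p + q, ?_⟩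
  rintro ⟨_ | ⟨y, ys⟩, a⟩
  · have hm := eval_mono p (show size a ≤ size (([] : List β), a) by rw [size_pair]; omega)
    refine ⟨fun s hs => ?_, ?_⟩
    · obtain ⟨t', ht', h4⟩ := (hf a).1 (Function.update s 0 (enc a)) (by simp)
      rw [Function.update_idem] at h4
      have h2 := exec_assign (s := s) (e := .tl (.var 0)) (d := enc a)
        (by simp [Expr.eval, hs]; rfl)
      refine ⟨_, ?_, .iteFalse (by simp [Expr.eval, hs]; rfl) (.seq h2 h4)⟩
      simp [Expr.time]; omega
    · have := (hf a).2
      simp; omega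
  · have hm := eval_mono q (show size (a, y, ys) ≤ size (y :: ys, a) by
      simp only [size_pair, size_cons]; omega)
    refine ⟨fun s hs => ?_, ?_⟩
    · obtain ⟨t', ht', h4⟩ := (hg (a, y, ys)).1 (Function.update s 0 (enc (a, y, ys))) (by simp)
      rw [Function.update_idem] at h4
      have h2 := exec_assign (s := s) (e := .cons (.tl (.var 0)) (.hd (.var 0)))
        (d := enc (a, y, ys)) (by simp [Expr.eval, hs, enc, Data.hd, Data.tl, encList])
      refine ⟨_, ?_, .iteTrue (by simp [Expr.eval, hs, enc, Data.hd, encList]) (.seq h2 h4)⟩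
      simp [Expr.time]; omega
    · have := (hg (a, y, ys)).2
      simp; omega

theorem isEmpty {l : α → List β} (hl : PolyTime l) : PolyTime fun a => (l a).isEmpty := by
  have := hl.listCases (true (α := α)) (false (α := α × β × List β))
  refine (funext fun a => ?_ : (fun a => (l a).isEmpty) = _) ▸ this
  cases l a <;> rfl

/-- A loop whose state holds the parameter, the accumulator and the rest of the list. As in
`iterate`, the partial folds need a size bound of their own. -/
theorem foldl {l : α → List β} (hl : PolyTime l) {init : α → γ} (hi : PolyTime init)
    {step : α × γ × β → γ} (hs : PolyTime step) (p : Polynomial ℕ)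
    (hp : ∀ a, ∀ k ≤ (l a).length,
      size (((l a).take k).foldl (fun c b => step (a, c, b)) (init a)) ≤ p.eval (size a)) :
    PolyTime fun a => (l a).foldl (fun c b => step (a, c, b)) (init a) := by
  let body : (α × γ) × List β → (α × γ) × List β := fun x => match x.2 with
    | [] => x
    | b :: bs => ((x.1.1, step (x.1.1, x.1.2, b)), bs)
  have hbody : PolyTime body := by
    refine listCases (α := (α × γ) × List β) (l := fun x => x.2) snd id
      (g := fun y => ((y.1.1.1, step (y.1.1.1, y.1.1.2, y.2.1)), y.2.2)) ?_
    have h1 : PolyTime fun y : ((α × γ) × List β) × β × List β => y.1.1.1 :=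
      fst.comp (fst.comp fst)
    have h2 : PolyTime fun y : ((α × γ) × List β) × β × List β => y.1.1.2 :=
      snd.comp (fst.comp fst)
    exact (h1.pair (hs.comp (h1.pair (h2.pair (fst.comp snd))))).pair (snd.comp snd)
  have hiter : ∀ (a : α) (k : ℕ) (c : γ) (m : List β), k ≤ m.length → body^[k] ((a, c), m) =
      ((a, (m.take k).foldl (fun c b => step (a, c, b)) c), m.drop k) := by
    intro a k
    induction k with
    | zero => intro c m _; simp
    | succ k ih =>
      intro c m hm
      cases m with
      | nil => simp at hm
      | cons b m =>
        rw [Function.iterate_succ_apply]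
        exact ih (step (a, c, b)) m (by simpa using hm)
  obtain ⟨_, q, hq⟩ := hl
  have hloop : PolyTime fun a => body^[(l a).length] ((a, init a), l a) := by
    refine iterate (i := fun a => ((a, init a), l a)) (cond := fun x => !x.2.isEmpty)
      ((id.pair hi).pair ⟨_, q, hq⟩) hbody snd.isEmpty.not (p + q + X + 2) fun a =>
        ⟨(l a).length, ?_, fun k hk => ?_, ?_, fun k hk => ?_, rfl⟩
    · have := (hq a).2
      have := length_lt_size (l a)
      simp; omega
    · simpa [hiter a k (init a) (l a) hk.le] using hk
    · simp [hiter a (l a).length (init a) (l a) le_rfl]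
    · rw [hiter a k (init a) (l a) hk, size_pair, size_pair]
      have := (hq a).2
      have := size_le_of_sublist ((l a).drop_sublist k)
      have := hp a k hk
      simp; omega
  have := (snd.comp fst).comp hloop
  refine (funext fun a => ?_ : (fun a => (l a).foldl (fun c b => step (a, c, b)) (init a)) = _)
    ▸ this
  simp [hiter a (l a).length (init a) (l a) le_rfl]

theorem reverseAppend {l m : α → List β} (hl : PolyTime l) (hm : PolyTime m) :
    PolyTime fun a => (l a).reverse ++ m a := by
  obtain ⟨_, q, hq⟩ := id (α := α) |> hl.pair
  obtain ⟨_, r, hr⟩ := id (α := α) |> hm.pair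
  have hfold : ∀ (k m : List β), k.foldl (fun c b => b :: c) m = k.reverse ++ m := by
    intro k
    induction k with
    | nil => simp
    | cons a k ih => simp [ih]
  have := foldl hl hm (step := fun x : α × List β × β => x.2.2 :: x.2.1)
    ((snd.comp snd).cons (fst.comp snd)) (q + r) fun a k _ => by
      rw [hfold]
      have h1 := size_append ((l a).take k).reverse (m a)
      have h2 := size_le_of_sublist ((l a).take_sublist k)
      have h3 := (hq a).2
      have h4 := (hr a).2
      rw [size_reverse] at h1
      rw [size_pair] at h3 h4
      simp; omega
  simpa only [hfold] using this

theorem append {l m : α → List β} (hl : PolyTime l) (hm : PolyTime m) :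
    PolyTime fun a => l a ++ m a := by
  -- Moving elements one at a time reverses the list, so it is reversed once beforehand.
  have h := hl.reverseAppend (nil (β := β))
  simpa using h.reverseAppend hm

theorem flatMap {l : α → List β} (hl : PolyTime l) {f : α × β → List γ} (hf : PolyTime f) :
    PolyTime fun a => (l a).flatMap fun b => f (a, b) := by
  have hfold : ∀ (a : α) (k : List β) (m : List γ),
      k.foldl (fun c b => c ++ f (a, b)) m = m ++ k.flatMap fun b => f (a, b) := by
    intro a k
    induction k with
    | nil => simp
    | cons b k ih => simp [ih]
  obtain ⟨_, q, hq⟩ := id (α := α) |> hl.pair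
  obtain ⟨c, r, hr⟩ := id (α := α × β) |> hf.pair
  have := foldl hl (nil (β := γ)) (step := fun x : α × List γ × β => x.2.1 ++ f (x.1, x.2.2))
    ((fst.comp snd).append ((show PolyTime f from fst.comp ⟨c, r, hr⟩).comp
      (fst.pair (snd.comp snd)))) (q * r.comp (X + q) + 1) fun a k hk => by
      rw [hfold, List.nil_append]
      have h3 := (hq a).2
      rw [size_pair] at h3
      have hB : ∀ b ∈ (l a).take k, size (f (a, b)) ≤ r.eval (size a + q.eval (size a)) := by
        intro b hb
        have h1 := (hr (a, b)).2
        have h2 := size_le_of_mem (List.mem_of_mem_take hb)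
        have h4 := eval_mono r (show size (a, b) ≤ size a + q.eval (size a) by
          rw [size_pair]; omega)
        rw [size_pair] at h1
        omega
      refine (size_flatMap_le hB).trans ?_
      have h5 := length_lt_size (l a)
      have h6 : ((l a).take k).length ≤ q.eval (size a) := by
        rw [List.length_take]; omega
      simpa using Nat.mul_le_mul_right _ h6
  simpa only [hfold, List.nil_append] using this

theorem map {l : α → List β} (hl : PolyTime l) {f : α × β → γ} (hf : PolyTime f) :
    PolyTime fun a => (l a).map fun b => f (a, b) := by
  have := hl.flatMap (hf.cons nil)
  simpa only [List.flatMap_singleton, ← List.map_eq_flatMap] using this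

theorem filter {l : α → List β} (hl : PolyTime l) {f : α × β → Bool} (hf : PolyTime f) :
    PolyTime fun a => (l a).filter fun b => f (a, b) := by
  have := hl.flatMap (hf.ite (snd.cons nil) nil)
  refine (funext fun a => ?_ : (fun a => (l a).filter fun b => f (a, b)) = _) ▸ this
  induction l a with
  | nil => rfl
  | cons b m ih => cases h : f (a, b) <;> simp [h, ih]

theorem flatten {l : α → List (List β)} (hl : PolyTime l) : PolyTime fun a => (l a).flatten := by
  simpa only [List.flatMap_id'] using hl.flatMap snd

theorem any {l : α → List β} (hl : PolyTime l) {f : α × β → Bool} (hf : PolyTime f) :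
    PolyTime fun a => (l a).any fun b => f (a, b) := by
  have := (hl.filter hf).isEmpty.not
  refine (funext fun a => ?_ : (fun a => (l a).any fun b => f (a, b)) = _) ▸ this
  induction l a with
  | nil => rfl
  | cons b m ih => cases h : f (a, b) <;> simp [h, ih]

theorem all {l : α → List β} (hl : PolyTime l) {f : α × β → Bool} (hf : PolyTime f) :
    PolyTime fun a => (l a).all fun b => f (a, b) := by
  have := (hl.any hf.not).not
  refine (funext fun a => ?_ : (fun a => (l a).all fun b => f (a, b)) = _) ▸ this
  induction l a with
  | nil => rfl
  | cons b m ih => cases h : f (a, b) <;> simp [h, ih]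

/-- Comparison of numbers in unary. -/
theorem natEq {m n : α → ℕ} (hm : PolyTime m) (hn : PolyTime n) :
    PolyTime fun a => m a == n a := by
  -- A unary numeral and a list of units are the same tree, so numbers are compared by consuming
  -- lists. The fold strikes one unit off `n` for each unit of `m`, with a flag for having run
  -- short; equality means no shortage and no remainder.
  have unary : PolyTime fun n : ℕ => List.replicate n () := by
    refine ofExpr (.var 0) X (fun n s hs => ?_) fun n => ?_
    · rw [Expr.eval, hs]
      induction n generalizing s with
      | zero => rfl
      | succ n ih => exact congrArg (Data.cons .nil) (ih (fun _ => enc n) rfl)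
    · simp [size]
  let step : α × (List Unit × Bool) × Unit → List Unit × Bool := fun x =>
    (x.2.1.1.tail, x.2.1.2 && !x.2.1.1.isEmpty)
  have hst : PolyTime step := by
    have h1 : PolyTime fun x : α × (List Unit × Bool) × Unit => x.2.1.1 :=
      fst.comp (fst.comp snd)
    have h2 : PolyTime fun x : α × (List Unit × Bool) × Unit => x.2.1.2 :=
      snd.comp (fst.comp snd)
    exact (tail.comp h1).pair (h2.and h1.isEmpty.not)
  have hfold : ∀ (a : α) (i j : ℕ) (b : Bool),
      (List.replicate i ()).foldl (fun c u => step (a, c, u)) (List.replicate j (), b) =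
        (List.replicate (j - i) (), b && decide (i ≤ j)) := by
    intro a i
    induction i with
    | zero => simp
    | succ i ih =>
      intro j b
      rw [List.replicate_succ, List.foldl_cons]
      have : step (a, (List.replicate j (), b), ()) =
          (List.replicate (j - 1) (), b && decide (0 < j)) := by
        cases j <;> simp [step, List.replicate_succ]
      rw [this, ih]
      have e1 : j - 1 - i = j - (i + 1) := by omega
      rw [e1, Bool.and_assoc, ← Bool.decide_and]
      congr 3
      apply propext; omega
  obtain ⟨_, q, hq⟩ := hn
  have h := (unary.comp hm).foldl ((unary.comp ⟨_, q, hq⟩).pair true) hst (q + 2) fun a k hk => by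
    rw [List.take_replicate, hfold, size_pair]
    have h1 := (hq a).2
    have h2 : size (List.replicate (n a - min k (m a)) ()) ≤ n a + 1 := by simp [size]
    have h3 : size (n a) = n a + 1 := rfl
    have h4 : ∀ b : Bool, size b = 1 := fun _ => rfl
    rw [h4]
    simp; omega
  simp only [hfold] at h
  have := (snd.comp h).and (fst.comp h).isEmpty
  refine (funext fun a => ?_ : (fun a => m a == n a) = _) ▸ this
  rw [Bool.eq_iff_iff]
  simp
  omega

theorem contains {l : α → List ℕ} (hl : PolyTime l) {n : α → ℕ} (hn : PolyTime n) :
    PolyTime fun a => (l a).contains (n a) := by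
  have := hl.any (natEq (hn.comp fst) snd)
  refine (funext fun a => ?_ : (fun a => (l a).contains (n a)) = _) ▸ this
  rw [List.contains_eq_any_beq]

end PolyTime

end WhileLang

namespace MALL

open WhileLang Enc

/-! ### Erasure as a polynomial-time algorithm on lists -/

/-- The size of a formula, where literals count nothing. -/
def Formula.size : Formula → ℕ
  | .leaf x _ => x + 2
  | .bin _ A B => A.size + B.size + 3

/-- The size is not that of the tree. Atoms are written in unary and are not bounded by the numbers
of links and vertices, but the algorithm never inspects a literal: duality of links is part of the
promise on the input. So literals may count nothing. -/
instance : Enc Formula := ⟨Formula.enc id, Formula.size⟩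

/-- A code for the shape of a formula. -/
def Formula.kind : Formula → ℕ
  | .leaf _ _ => 0
  | .bin .tensor _ _ => 1
  | .bin .par _ _ => 2
  | .bin .amp _ _ => 3
  | .bin .plus _ _ => 4

/-- The name of a leaf. -/
def Formula.name : Formula → ℕ
  | .leaf x _ => x
  | .bin _ _ _ => 0

/-- The left argument of a compound formula. -/
def Formula.left : Formula → Formula
  | .leaf x P => .leaf x P
  | .bin _ A _ => A

/-- The right argument of a compound formula. -/
def Formula.right : Formula → Formula
  | .leaf x P => .leaf x P
  | .bin _ _ B => B

variable {α : Type} [Enc α]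

theorem Conn.enc_ne_nil (c : Conn) : c.enc ≠ .nil := by
  cases c <;> simp [Conn.enc, encNat]

open Polynomial in
-- Kinds are numbered to agree with the codes of connectives, so the kind is the head of the
-- encoding, with `nil` as 0 for leaves.
theorem polyTime_kind {F : α → Formula} (hF : PolyTime F) : PolyTime fun a => (F a).kind := by
  refine PolyTime.comp (g := Formula.kind) (PolyTime.ofExpr (.hd (.var 0)) 5 (fun F s hs => ?_)
    fun F => ?_) hF
  · rw [Expr.eval, Expr.eval, hs]
    rcases F with ⟨x, P⟩ | ⟨_ | _ | _ | _, A, B⟩ <;> rfl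
  · have : ∀ n : ℕ, Enc.size n = n + 1 := fun _ => rfl
    rw [this]
    rcases F with ⟨x, P⟩ | ⟨_ | _ | _ | _, A, B⟩ <;> simp [Formula.kind]

open Polynomial in
theorem polyTime_name {F : α → Formula} (hF : PolyTime F) : PolyTime fun a => (F a).name := by
  refine PolyTime.comp (g := Formula.name) (PolyTime.ofIte (.hd (.var 0)) .nil
    (.hd (.tl (.var 0))) X (fun F s hs => ?_) fun F => ?_) hF
  · simp only [Expr.eval, hs]
    cases F with
    | leaf x P => exact .inr ⟨rfl, rfl⟩
    | bin c A B => exact .inl ⟨c.enc_ne_nil, rfl⟩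
  · cases F <;> simp [Formula.name, Enc.size, Formula.size]

open Polynomial in
theorem polyTime_left {F : α → Formula} (hF : PolyTime F) : PolyTime fun a => (F a).left := by
  refine PolyTime.comp (g := Formula.left) (PolyTime.ofIte (.hd (.var 0)) (.hd (.tl (.var 0)))
    (.var 0) X (fun F s hs => ?_) fun F => ?_) hF
  · simp only [Expr.eval, hs]
    cases F with
    | leaf x P => exact .inr ⟨rfl, rfl⟩
    | bin c A B => exact .inl ⟨c.enc_ne_nil, rfl⟩
  · cases F <;> simp [Formula.left, Enc.size, Formula.size]; omega

open Polynomial in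
theorem polyTime_right {F : α → Formula} (hF : PolyTime F) : PolyTime fun a => (F a).right := by
  refine PolyTime.comp (g := Formula.right) (PolyTime.ofIte (.hd (.var 0)) (.tl (.tl (.var 0)))
    (.var 0) X (fun F s hs => ?_) fun F => ?_) hF
  · simp only [Expr.eval, hs]
    cases F with
    | leaf x P => exact .inr ⟨rfl, rfl⟩
    | bin c A B => exact .inl ⟨c.enc_ne_nil, rfl⟩
  · cases F <;> simp [Formula.right, Enc.size, Formula.size]; omega

theorem Formula.kind_eq_zero {F : Formula} : F.kind = 0 ↔ ∃ x P, F = .leaf x P := by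
  rcases F with ⟨x, P⟩ | ⟨_ | _ | _ | _, A, B⟩ <;> simp [kind]

theorem Formula.vertices_length_le_size (F : Formula) : F.vertices.length ≤ F.size := by
  induction F with
  | leaf x P => simp [vertices, size]
  | bin c A B ihA ihB => simp [vertices, size]; omega

/-- Visit the formula on top of a stack: collect a leaf, or push the arguments. -/
def visit (x : Sequent × List ℕ) : Sequent × List ℕ :=
  match x.1 with
  | [] => x
  | F :: st => if F.kind == 0 then (st, F.name :: x.2) else (F.right :: F.left :: st, x.2)

theorem polyTime_visit : PolyTime visit := by
  have hF : PolyTime fun y : (Sequent × List ℕ) × Formula × Sequent => y.2.1 :=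
    PolyTime.fst.comp PolyTime.snd
  have hst : PolyTime fun y : (Sequent × List ℕ) × Formula × Sequent => y.2.2 :=
    PolyTime.snd.comp PolyTime.snd
  have hacc : PolyTime fun y : (Sequent × List ℕ) × Formula × Sequent => y.1.2 :=
    PolyTime.snd.comp PolyTime.fst
  have := PolyTime.listCases (α := Sequent × List ℕ) PolyTime.fst PolyTime.id
    (((polyTime_kind hF).natEq (PolyTime.nat 0)).ite (hst.pair ((polyTime_name hF).cons hacc))
      (((polyTime_right hF).cons ((polyTime_left hF).cons hst)).pair hacc))
  refine (funext fun x => ?_ : visit = _) ▸ this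
  rcases x with ⟨_ | ⟨F, st⟩, acc⟩ <;> rfl

theorem size_visit_le (x : Sequent × List ℕ) : Enc.size (visit x) ≤ Enc.size x := by
  obtain ⟨_ | ⟨F, st⟩, acc⟩ := x
  · exact le_rfl
  · cases F with
    | leaf x P =>
      rw [show visit (.leaf x P :: st, acc) = (st, x :: acc) from rfl]
      simp only [size_pair, size_cons]
      have h1 : Enc.size x = x + 1 := rfl
      have h2 : Enc.size (Formula.leaf x P) = x + 2 := rfl
      omega
    | bin c A B =>
      have : visit (.bin c A B :: st, acc) = (B :: A :: st, acc) := by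
        cases c <;> rfl
      rw [this]
      simp only [size_pair, size_cons]
      have h2 : Enc.size (Formula.bin c A B) = Enc.size A + Enc.size B + 3 := rfl
      omega

/-- One visit for each vertex. The right argument is visited first, so that consing produces the
leaves from left to right. -/
theorem visit_iterate (F : Formula) (st : Sequent) (acc : List ℕ) :
    visit^[F.vertices.length] (F :: st, acc) = (st, F.leaves ++ acc) := by
  induction F generalizing st acc with
  | leaf x P => rfl
  | bin c A B ihA ihB =>
    have : visit (.bin c A B :: st, acc) = (B :: A :: st, acc) := by
      cases c <;> rfl
    have hl : (Formula.bin c A B).vertices.length = A.vertices.length + B.vertices.length + 1 := by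
      simp [Formula.vertices]
    rw [hl, Function.iterate_succ_apply, this, Function.iterate_add_apply, ihB, ihA]
    simp [Formula.leaves]

theorem visit_iterate_ne_nil (F : Formula) (acc : List ℕ) (k : ℕ) (hk : k < F.vertices.length) :
    (visit^[k] ([F], acc)).1 ≠ [] := by
  suffices h : ∀ (F : Formula) (st : Sequent) (acc : List ℕ) (k : ℕ), k < F.vertices.length →
      (visit^[k] (F :: st, acc)).1 ≠ [] from h F [] acc k hk
  clear hk F acc k
  intro F
  induction F with
  | leaf x P =>
    intro st acc k hk
    obtain rfl : k = 0 := by simpa [Formula.vertices] using hk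
    simp
  | bin c A B ihA ihB =>
    intro st acc k hk
    have : visit (.bin c A B :: st, acc) = (B :: A :: st, acc) := by
      cases c <;> rfl
    cases k with
    | zero => simp
    | succ k =>
      rw [Function.iterate_succ_apply, this]
      by_cases h : k < B.vertices.length
      · exact ihB _ _ _ h
      · obtain ⟨j, rfl⟩ := Nat.exists_eq_add_of_le (not_lt.1 h)
        rw [add_comm, Function.iterate_add_apply, visit_iterate]
        refine ihA _ _ _ ?_
        simp [Formula.vertices] at hk
        omega

open Polynomial in
theorem polyTime_leaves {F : α → Formula} (hF : PolyTime F) : PolyTime fun a => (F a).leaves := by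
  refine PolyTime.comp (g := Formula.leaves) ?_ hF
  have h : PolyTime fun F : Formula => visit^[F.vertices.length] ([F], []) := by
    refine PolyTime.iterate (i := fun F : Formula => ([F], ([] : List ℕ)))
      (cond := fun x => !x.1.isEmpty) ((PolyTime.id.cons PolyTime.nil).pair PolyTime.nil)
      -- The initial state exceeds the formula by 4 in size, and visits never enlarge a state.
      polyTime_visit PolyTime.fst.isEmpty.not (X + 4) fun F => ⟨F.vertices.length, ?_, ?_, ?_, ?_, rfl⟩
    · have := F.vertices_length_le_size
      have h : Enc.size F = F.size := rfl
      simp; omega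
    · intro k hk
      simpa using visit_iterate_ne_nil F [] k hk
    · rw [visit_iterate]; rfl
    · intro k _
      have : ∀ (k : ℕ) (x : Sequent × List ℕ), Enc.size (visit^[k] x) ≤ Enc.size x := by
        intro k
        induction k with
        | zero => exact fun x => le_rfl
        | succ k ih => exact fun x => (ih (visit x)).trans (size_visit_le x)
      refine (this k _).trans ?_
      rw [size_pair, size_cons]
      simp; omega
  have := PolyTime.snd.comp h
  simpa only [visit_iterate, List.append_nil] using this

/-- A sequent with a list of lists of links. -/
abbrev Net := Sequent × List (List (ℕ × ℕ))

/-- The lists `S` and `T` have a common element. -/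
def meetsB (S T : List ℕ) : Bool := S.any fun x => T.contains x

/-- The leaf sets that a union of components does not divide. -/
def blocks (N : Net) : List (List ℕ) :=
  (N.1.map fun F => F.leaves) ++ N.2.flatten.map fun q => [q.1, q.2]

/-- The union of the blocks that meet `S`. -/
def grow (B : List (List ℕ)) (S : List ℕ) : List ℕ := (B.filter fun b => meetsB b S).flatten

/-- The leaves connected to `S`. -/
def reach (B : List (List ℕ)) (S : List ℕ) : List ℕ := B.foldl (fun T _ => grow B T) S

/-- The test whether a net is connected. -/
def connectedB (N : Net) : Bool :=
  !N.2.isEmpty && match N.1 with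
    | [] => true
    | F :: _ => N.1.all fun C => C.leaves.all fun x => (reach (blocks N) F.leaves).contains x

/-- Replace the root `r` by `As`. -/
def substB (Γ : Sequent) (r : Formula) (As : Sequent) : Sequent :=
  Γ.flatMap fun C => if meetsB C.leaves r.leaves then As else [C]

/-- Some link of `lam` has an end in `S`. -/
def touchB (S : List ℕ) (lam : List (ℕ × ℕ)) : Bool :=
  lam.any fun q => S.contains q.1 || S.contains q.2

/-- The test version of `branch`. -/
def branchB (N : Net) (r : Formula) (As : Sequent) : Net :=
  (substB N.1 r As, N.2.filter fun lam => touchB (As.flatMap fun A => A.leaves) lam)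

/-- The links of `lam` in `T`. -/
def inside (T : List ℕ) (lam : List (ℕ × ℕ)) : List (ℕ × ℕ) := lam.filter fun q => T.contains q.1

/-- The links of `lam` outside `T`. -/
def outside (T : List ℕ) (lam : List (ℕ × ℕ)) : List (ℕ × ℕ) := lam.filter fun q => !T.contains q.1

/-- The half of a net in `T`. -/
def halfIn (N : Net) (r A : Formula) (T : List ℕ) : Net :=
  (N.1.flatMap fun C => if meetsB C.leaves r.leaves then [A]
    else if meetsB C.leaves T then [C] else [], N.2.map fun lam => inside T lam)

/-- The half of a net outside `T`. -/
def halfOut (N : Net) (r B : Formula) (T : List ℕ) : Net :=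
  (N.1.flatMap fun C => if meetsB C.leaves r.leaves then [B]
    else if meetsB C.leaves T then [] else [C], N.2.map fun lam => outside T lam)

/-- The unordered pair `q` occurs in `mu`. -/
def hasLink (mu : List (ℕ × ℕ)) (q : ℕ × ℕ) : Bool :=
  mu.any fun q' => (q.1 == q'.1 && q.2 == q'.2) || (q.1 == q'.2 && q.2 == q'.1)

/-- The lists `lam` and `mu` have the same links. -/
def sameLinks (lam mu : List (ℕ × ℕ)) : Bool :=
  (lam.all fun q => hasLink mu q) && mu.all fun q => hasLink lam q

/-- The linkings are all combinations of their parts inside and outside `T`. -/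
def productB (T : List ℕ) (Ls : List (List (ℕ × ℕ))) : Bool :=
  Ls.all fun lam => Ls.all fun mu => Ls.any fun nu => sameLinks nu (inside T lam ++ outside T mu)

/-- The leaves connected to the left argument of `r` after deletion of `r`. -/
def sideB (N : Net) (r : Formula) : List ℕ :=
  reach (blocks (substB N.1 r [r.left, r.right], N.2)) r.left.leaves

/-- Erase a tensor root, if it is ready. -/
def tensorB (N : Net) (r : Formula) : List (List Net) :=
  if !meetsB r.right.leaves (sideB N r) && productB (sideB N r) N.2 then
    [[halfIn N r r.left (sideB N r), halfOut N r r.right (sideB N r)]]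
  else []

/-- Erase a plus root, if it is ready. -/
def plusB (N : Net) (r : Formula) : List (List Net) :=
  if N.2.any fun lam => touchB r.right.leaves lam then
    if N.2.any fun lam => touchB r.left.leaves lam then [] else [[branchB N r [r.right]]]
  else [[branchB N r [r.left]]]

/-- Erase a root, if it is ready. -/
def eraseB (N : Net) (r : Formula) : List (List Net) :=
  if r.kind == 1 then tensorB N r
  else if r.kind == 2 then [[branchB N r [r.left, r.right]]]
  else if r.kind == 3 then [[branchB N r [r.left], branchB N r [r.right]]]
  else if r.kind == 4 then plusB N r
  else []

/-- The sequent consists of two leaves. -/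
def axiomB (N : Net) : Bool :=
  (N.1.all fun F => F.kind == 0) && (!N.1.tail.isEmpty && N.1.tail.tail.isEmpty)

/-- The possible results of an erasure step. -/
def step (N : Net) : List (List Net) :=
  if connectedB N then if axiomB N then [[]] else N.1.flatMap fun r => eraseB N r else []

/-- Process the first net of a list. -/
def process (x : List Net × Bool) : List Net × Bool :=
  match x.1 with
  | [] => x
  | N :: rest => match step N with
    | [] => ([], false)
    | E :: _ => (E ++ rest, x.2)

/-! ### Polynomial time for each test and construction -/

section PolyTime

open WhileLang.PolyTime

variable {S T : α → List ℕ} {N : α → Net} {r A : α → Formula} {As : α → Sequent}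

theorem polyTime_meetsB (hS : PolyTime S) (hT : PolyTime T) :
    PolyTime fun a => meetsB (S a) (T a) :=
  hS.any ((hT.comp fst).contains snd)

theorem polyTime_blocks (hN : PolyTime N) : PolyTime fun a => blocks (N a) :=
  ((fst.comp hN).map (polyTime_leaves snd)).append
    ((snd.comp hN).flatten.map ((fst.comp snd).cons ((snd.comp snd).cons nil)))

theorem size_flatten_filter_le (B : List (List ℕ)) (f : List ℕ → Bool) :
    Enc.size (B.filter f).flatten ≤ Enc.size B := by
  induction B with
  | nil => simp
  | cons b B ih =>
    rw [size_cons]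
    by_cases h : f b
    · rw [List.filter_cons_of_pos h, List.flatten_cons]
      have := size_append b (B.filter f).flatten
      omega
    · rw [List.filter_cons_of_neg h]
      omega

open Polynomial in
-- After the first round the set is a concatenation of distinct entries of `B`, so its size stays
-- below that of `B` however often it is grown.
theorem polyTime_reach {B : α → List (List ℕ)} (hB : PolyTime B) (hS : PolyTime S) :
    PolyTime fun a => reach (B a) (S a) := by
  have hg : PolyTime fun x : α × List ℕ × List ℕ => grow (B x.1) x.2.1 :=
    ((hB.comp fst).filter (polyTime_meetsB snd (fst.comp (snd.comp fst)))).flatten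
  obtain ⟨_, p, hp⟩ := hB
  obtain ⟨_, q, hq⟩ := hS
  refine PolyTime.foldl ⟨_, p, hp⟩ ⟨_, q, hq⟩ hg (p + q) fun a k _ => ?_
  show Enc.size (((B a).take k).foldl (fun T _ => grow (B a) T) (S a)) ≤ _
  rw [List.foldl_const]
  have h1 := (hp a).2
  have h2 := (hq a).2
  generalize ((B a).take k).length = n
  cases n with
  | zero => simp; omega
  | succ n =>
    rw [Function.iterate_succ_apply']
    refine (size_flatten_filter_le _ _).trans ?_
    simp; omega

theorem polyTime_connectedB (hN : PolyTime N) : PolyTime fun a => connectedB (N a) := by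
  refine PolyTime.comp (g := connectedB) ?_ hN
  have hF : PolyTime fun x : Net × Formula × Sequent => x.2.1 := fst.comp snd
  have hr : PolyTime fun x : Net × Formula × Sequent => reach (blocks x.1) x.2.1.leaves :=
    polyTime_reach (polyTime_blocks fst) (polyTime_leaves hF)
  have := snd.isEmpty.not.and (PolyTime.listCases (α := Net) fst PolyTime.true
    ((fst.comp fst).all ((polyTime_leaves snd).all ((hr.comp (fst.comp fst)).contains snd))))
  refine (funext fun N => ?_ : connectedB = _) ▸ this
  rcases N with ⟨_ | ⟨F, Γ⟩, Ls⟩ <;> rfl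

theorem polyTime_substB {Γ : α → Sequent} (hΓ : PolyTime Γ) (hr : PolyTime r) (hA : PolyTime As) :
    PolyTime fun a => substB (Γ a) (r a) (As a) :=
  hΓ.flatMap ((polyTime_meetsB (polyTime_leaves snd) (polyTime_leaves (hr.comp fst))).ite
    (hA.comp fst) (snd.cons nil))

theorem polyTime_touchB {lam : α → List (ℕ × ℕ)} (hS : PolyTime S) (hl : PolyTime lam) :
    PolyTime fun a => touchB (S a) (lam a) :=
  hl.any (((hS.comp fst).contains (fst.comp snd)).or ((hS.comp fst).contains (snd.comp snd)))

theorem polyTime_branchB (hN : PolyTime N) (hr : PolyTime r) (hA : PolyTime As) :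
    PolyTime fun a => branchB (N a) (r a) (As a) :=
  (polyTime_substB (fst.comp hN) hr hA).pair ((snd.comp hN).filter
    (polyTime_touchB ((hA.comp fst).flatMap (polyTime_leaves snd)) snd))

theorem polyTime_inside {lam : α → List (ℕ × ℕ)} (hT : PolyTime T) (hl : PolyTime lam) :
    PolyTime fun a => inside (T a) (lam a) :=
  hl.filter ((hT.comp fst).contains (fst.comp snd))

theorem polyTime_outside {lam : α → List (ℕ × ℕ)} (hT : PolyTime T) (hl : PolyTime lam) :
    PolyTime fun a => outside (T a) (lam a) :=
  hl.filter ((hT.comp fst).contains (fst.comp snd)).not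

theorem polyTime_halfIn (hN : PolyTime N) (hr : PolyTime r) (hA : PolyTime A) (hT : PolyTime T) :
    PolyTime fun a => halfIn (N a) (r a) (A a) (T a) :=
  ((fst.comp hN).flatMap ((polyTime_meetsB (polyTime_leaves snd) (polyTime_leaves (hr.comp fst))).ite
    ((hA.comp fst).cons nil) ((polyTime_meetsB (polyTime_leaves snd) (hT.comp fst)).ite
      (snd.cons nil) nil))).pair ((snd.comp hN).map (polyTime_inside (hT.comp fst) snd))

theorem polyTime_halfOut (hN : PolyTime N) (hr : PolyTime r) (hA : PolyTime A) (hT : PolyTime T) :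
    PolyTime fun a => halfOut (N a) (r a) (A a) (T a) :=
  ((fst.comp hN).flatMap ((polyTime_meetsB (polyTime_leaves snd) (polyTime_leaves (hr.comp fst))).ite
    ((hA.comp fst).cons nil) ((polyTime_meetsB (polyTime_leaves snd) (hT.comp fst)).ite
      nil (snd.cons nil)))).pair ((snd.comp hN).map (polyTime_outside (hT.comp fst) snd))

theorem polyTime_hasLink {mu : α → List (ℕ × ℕ)} {q : α → ℕ × ℕ} (hm : PolyTime mu)
    (hq : PolyTime q) : PolyTime fun a => hasLink (mu a) (q a) :=
  hm.any ((((fst.comp (hq.comp fst)).natEq (fst.comp snd)).and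
    ((snd.comp (hq.comp fst)).natEq (snd.comp snd))).or
    (((fst.comp (hq.comp fst)).natEq (snd.comp snd)).and
    ((snd.comp (hq.comp fst)).natEq (fst.comp snd))))

theorem polyTime_sameLinks {lam mu : α → List (ℕ × ℕ)} (hl : PolyTime lam) (hm : PolyTime mu) :
    PolyTime fun a => sameLinks (lam a) (mu a) :=
  (hl.all (polyTime_hasLink (hm.comp fst) snd)).and (hm.all (polyTime_hasLink (hl.comp fst) snd))

theorem polyTime_productB {Ls : α → List (List (ℕ × ℕ))} (hT : PolyTime T) (hL : PolyTime Ls) :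
    PolyTime fun a => productB (T a) (Ls a) :=
  hL.all ((hL.comp fst).all ((hL.comp (fst.comp fst)).any (polyTime_sameLinks snd
    ((polyTime_inside (hT.comp (fst.comp (fst.comp fst))) (snd.comp (fst.comp fst))).append
      (polyTime_outside (hT.comp (fst.comp (fst.comp fst))) (snd.comp fst))))))

theorem polyTime_sideB (hN : PolyTime N) (hr : PolyTime r) : PolyTime fun a => sideB (N a) (r a) :=
  polyTime_reach (polyTime_blocks ((polyTime_substB (fst.comp hN) hr
    ((polyTime_left hr).cons ((polyTime_right hr).cons nil))).pair (snd.comp hN)))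
    (polyTime_leaves (polyTime_left hr))

theorem polyTime_tensorB (hN : PolyTime N) (hr : PolyTime r) :
    PolyTime fun a => tensorB (N a) (r a) :=
  have hs := polyTime_sideB hN hr
  ((polyTime_meetsB (polyTime_leaves (polyTime_right hr)) hs).not.and
    (polyTime_productB hs (snd.comp hN))).ite
    (((polyTime_halfIn hN hr (polyTime_left hr) hs).cons
      ((polyTime_halfOut hN hr (polyTime_right hr) hs).cons nil)).cons nil) nil

theorem polyTime_plusB (hN : PolyTime N) (hr : PolyTime r) :
    PolyTime fun a => plusB (N a) (r a) :=
  ((snd.comp hN).any (polyTime_touchB (polyTime_leaves (polyTime_right (hr.comp fst))) snd)).ite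
    (((snd.comp hN).any (polyTime_touchB (polyTime_leaves (polyTime_left (hr.comp fst))) snd)).ite
      nil (((polyTime_branchB hN hr ((polyTime_right hr).cons nil)).cons nil).cons nil))
    (((polyTime_branchB hN hr ((polyTime_left hr).cons nil)).cons nil).cons nil)

theorem polyTime_eraseB (hN : PolyTime N) (hr : PolyTime r) :
    PolyTime fun a => eraseB (N a) (r a) := by
  have hk := polyTime_kind hr
  have hl := (polyTime_left hr).cons nil
  have hr' := (polyTime_right hr).cons nil
  exact (hk.natEq (PolyTime.nat 1)).ite (polyTime_tensorB hN hr)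
    ((hk.natEq (PolyTime.nat 2)).ite
      (((polyTime_branchB hN hr ((polyTime_left hr).cons hr')).cons nil).cons nil)
      ((hk.natEq (PolyTime.nat 3)).ite
        (((polyTime_branchB hN hr hl).cons ((polyTime_branchB hN hr hr').cons nil)).cons nil)
        ((hk.natEq (PolyTime.nat 4)).ite (polyTime_plusB hN hr) nil)))

theorem polyTime_step (hN : PolyTime N) : PolyTime fun a => step (N a) :=
  have hax : PolyTime fun a => axiomB (N a) :=
    ((fst.comp hN).all ((polyTime_kind snd).natEq (PolyTime.nat 0))).and
      ((tail.comp (fst.comp hN)).isEmpty.not.and (tail.comp (tail.comp (fst.comp hN))).isEmpty)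
  (polyTime_connectedB hN).ite (hax.ite (nil.cons nil)
    ((fst.comp hN).flatMap (polyTime_eraseB (hN.comp fst) snd))) nil

theorem polyTime_process : PolyTime process := by
  have := PolyTime.listCases (α := List Net × Bool) fst PolyTime.id
    (PolyTime.listCases (α := (List Net × Bool) × Net × List Net)
      (polyTime_step (fst.comp snd)) (nil.pair PolyTime.false)
      (((fst.comp snd).append (snd.comp (snd.comp fst))).pair (snd.comp (fst.comp fst))))
  refine (funext fun x => ?_ : process = _) ▸ this
  rcases x with ⟨_ | ⟨N, rest⟩, b⟩
  · rfl
  · simp only [process]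
    cases step N <;> rfl

end PolyTime

/-! ### Correctness of the algorithm -/

/-- The linking-set that a net represents. -/
def linkingSetOf (N : Net) : LinkingSet := ⟨N.1, (N.2.map linkingOf).toFinset⟩

theorem mem_linkingSetOf {N : Net} {lam : Finset Link} :
    lam ∈ (linkingSetOf N).linkings ↔ ∃ ps ∈ N.2, linkingOf ps = lam := by
  simp [linkingSetOf]

theorem linkingOf_mem {N : Net} {ps : List (ℕ × ℕ)} (h : ps ∈ N.2) :
    linkingOf ps ∈ (linkingSetOf N).linkings := mem_linkingSetOf.2 ⟨ps, h, rfl⟩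

theorem mem_linkingOf {ps : List (ℕ × ℕ)} {l : Link} :
    l ∈ linkingOf ps ↔ ∃ q ∈ ps, s(q.1, q.2) = l := by
  rw [linkingOf, List.mem_toFinset, List.mem_map]

theorem pair_mem_linkingOf {ps : List (ℕ × ℕ)} {q : ℕ × ℕ} (h : q ∈ ps) :
    s(q.1, q.2) ∈ linkingOf ps := mem_linkingOf.2 ⟨q, h, rfl⟩

theorem meetsB_iff {S T : List ℕ} : meetsB S T = true ↔ ∃ x ∈ S, x ∈ T := by
  simp [meetsB]

theorem touchB_iff {S : List ℕ} {ps : List (ℕ × ℕ)} :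
    touchB S ps = true ↔ ∃ x ∈ S, Covered (linkingOf ps) x := by
  simp only [touchB, List.any_eq_true, Bool.or_eq_true, List.contains_iff_mem, Covered]
  constructor
  · rintro ⟨q, hq, h | h⟩
    exacts [⟨_, h, _, pair_mem_linkingOf hq, by simp⟩, ⟨_, h, _, pair_mem_linkingOf hq, by simp⟩]
  · rintro ⟨x, hx, l, hl, hxl⟩
    obtain ⟨q, hq, rfl⟩ := mem_linkingOf.1 hl
    rcases Sym2.mem_iff.1 hxl with rfl | rfl
    exacts [⟨q, hq, .inl hx⟩, ⟨q, hq, .inr hx⟩]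

theorem touchB_leaves {As : Sequent} {ps : List (ℕ × ℕ)} :
    touchB (As.flatMap fun A => A.leaves) ps = true ↔ Meets (linkingOf ps) As := touchB_iff

/-- Roots are recognised by a shared leaf; the algorithm thereby avoids comparing formulas, and with
them literals. -/
theorem Sequent.WellNamed.meetsB_leaves {Γ : Sequent} (h : Γ.WellNamed) {C r : Formula}
    (hC : C ∈ Γ) (hr : r ∈ Γ) : meetsB C.leaves r.leaves = true ↔ C = r := by
  rw [meetsB_iff]
  refine ⟨fun ⟨x, hx, hx'⟩ => h.root_unique hC hr hx hx', ?_⟩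
  rintro rfl
  exact C.exists_mem_leaves.imp fun x hx => ⟨hx, hx⟩

theorem Sequent.WellNamed.substB_eq {Γ : Sequent} (h : Γ.WellNamed) {r : Formula} (hr : r ∈ Γ)
    (As : Sequent) : substB Γ r As = Γ.subst r As := by
  refine flatMap_congr_mem fun C hC => ?_
  simp only [h.meetsB_leaves hC hr]

theorem linkingSetOf_branchB {N : Net} (h : N.1.WellNamed) {r : Formula} (hr : r ∈ N.1)
    (As : Sequent) : linkingSetOf (branchB N r As) = branch r As (linkingSetOf N) := by
  rw [linkingSetOf, branch]
  congr 1
  · exact h.substB_eq hr As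
  · ext lam
    simp only [branchB, List.mem_toFinset, List.mem_map, List.mem_filter, touchB_leaves,
      Finset.mem_filter, mem_linkingSetOf]
    constructor
    · rintro ⟨ps, ⟨hps, hm⟩, rfl⟩; exact ⟨⟨ps, hps, rfl⟩, hm⟩
    · rintro ⟨⟨ps, hps, rfl⟩, hm⟩; exact ⟨ps, ⟨hps, hm⟩, rfl⟩

/-- No block is divided by `Z`. -/
def Undivided (B : List (List ℕ)) (Z : Set ℕ) : Prop :=
  ∀ b ∈ B, ∀ x ∈ b, ∀ y ∈ b, x ∈ Z → y ∈ Z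

theorem undivided_blocks {N : Net} {Z : Set ℕ} :
    Undivided (blocks N) Z ↔ Closed N.1 (linkingSetOf N).linkings Z := by
  constructor
  · intro h
    refine ⟨fun C hC => h _ (by simp only [blocks, List.mem_append, List.mem_map]; exact .inl ⟨C, hC, rfl⟩),
      fun lam hlam l hl => ?_⟩
    obtain ⟨ps, hps, rfl⟩ := mem_linkingSetOf.1 hlam
    obtain ⟨q, hq, rfl⟩ := mem_linkingOf.1 hl
    intro x hx y hy
    refine h [q.1, q.2] ?_ x (by simpa using hx) y (by simpa using hy)
    simp only [blocks, List.mem_append, List.mem_map]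
    exact .inr ⟨q, List.mem_flatten.2 ⟨ps, hps, hq⟩, rfl⟩
  · intro h b hb
    simp only [blocks, List.mem_append, List.mem_map, List.mem_flatten] at hb
    rcases hb with ⟨C, hC, rfl⟩ | ⟨q, ⟨ps, hps, hq⟩, rfl⟩
    · exact h.roots C hC
    · intro x hx y hy
      exact h.links _ (linkingOf_mem hps) _ (pair_mem_linkingOf hq) x (by simpa using hx) y
        (by simpa using hy)

theorem mem_grow {B : List (List ℕ)} {T : List ℕ} {x : ℕ} :
    x ∈ grow B T ↔ ∃ b ∈ B, x ∈ b ∧ ∃ y ∈ b, y ∈ T := by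
  simp only [grow, List.mem_flatten, List.mem_filter, meetsB_iff]
  exact ⟨fun ⟨b, ⟨h, h'⟩, hx⟩ => ⟨b, h, hx, h'⟩, fun ⟨b, h, hx, h'⟩ => ⟨b, ⟨h, h'⟩, hx⟩⟩

theorem undivided_of_grow {B : List (List ℕ)} {T : List ℕ} (h : grow B T ⊆ T) :
    Undivided B {x | x ∈ T} :=
  fun b hb x hx _ hy hxT => h (mem_grow.2 ⟨b, hb, hy, x, hx, hxT⟩)

theorem grow_mono {B : List (List ℕ)} {T T' : List ℕ} (h : T ⊆ T') : grow B T ⊆ grow B T' := by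
  intro x hx
  obtain ⟨b, hb, hxb, y, hy, hyT⟩ := mem_grow.1 hx
  exact mem_grow.2 ⟨b, hb, hxb, y, hy, h hyT⟩

/-- The leaves connected to a block form the least undivided set including it. -/
theorem mem_reach {B : List (List ℕ)} {S : List ℕ} (hS : S ∈ B) (hne : S ≠ []) {x : ℕ} :
    x ∈ reach B S ↔ ∀ Z, Undivided B Z → (∀ y ∈ S, y ∈ Z) → x ∈ Z := by
  have hsucc : ∀ k, (grow B)^[k + 1] S = grow B ((grow B)^[k] S) := fun k =>
    Function.iterate_succ_apply' _ _ _
  rw [reach, List.foldl_const]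
  constructor
  · intro hx Z hZ hSZ
    have : ∀ k, ∀ x ∈ (grow B)^[k] S, x ∈ Z := by
      intro k
      induction k with
      | zero => exact hSZ
      | succ k ih =>
        intro x hx
        rw [hsucc] at hx
        obtain ⟨b, hb, hxb, y, hy, hyT⟩ := mem_grow.1 hx
        exact hZ b hb y hy x hxb (ih y hyT)
    exact this _ x hx
  · have hinc : ∀ k, (grow B)^[k] S ⊆ (grow B)^[k + 1] S := by
      intro k
      induction k with
      | zero => exact fun x hx => mem_grow.2 ⟨S, hS, hx, x, hx, hx⟩
      | succ k ih =>
        rw [hsucc, hsucc (k + 1)]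
        exact grow_mono ih
    have hsub : ∀ k, S ⊆ (grow B)^[k] S := by
      intro k
      induction k with
      | zero => exact fun _ h => h
      | succ k ih => exact fun x hx => hinc k (ih hx)
    let F := fun k => B.filter fun b => meetsB b ((grow B)^[k] S)
    -- `F k` lists the blocks met at stage `k`. While the stage is not yet closed under `grow` a new
    -- block is met each time, so as many rounds as there are blocks suffice.
    have hcount : ∀ k, ¬ grow B ((grow B)^[k] S) ⊆ (grow B)^[k] S → k + 1 ≤ (F k).length := by
      intro k
      induction k with
      | zero =>
        intro _
        obtain ⟨y, hy⟩ := List.exists_mem_of_ne_nil _ hne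
        exact List.length_pos_of_mem (a := S) (List.mem_filter.2 ⟨hS, meetsB_iff.2 ⟨y, hy, hy⟩⟩)
      | succ k ih =>
        intro h
        have hk := ih fun h' => h (by rw [hsucc]; exact grow_mono h')
        have hlt : (F k).length < (F (k + 1)).length := by
          obtain ⟨y, hy, hyn⟩ : ∃ y ∈ grow B ((grow B)^[k + 1] S), y ∉ (grow B)^[k + 1] S := by
            by_contra hcon
            push Not at hcon
            exact h hcon
          obtain ⟨b, hb, hyb, z, hz, hzT⟩ := mem_grow.1 hy
          have hbF : b ∈ F (k + 1) := List.mem_filter.2 ⟨hb, meetsB_iff.2 ⟨z, hz, hzT⟩⟩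
          have hbn : ¬ meetsB b ((grow B)^[k] S) = true := fun hb' => by
            obtain ⟨w, hw, hwT⟩ := meetsB_iff.1 hb'
            exact hyn (hsucc k ▸ mem_grow.2 ⟨b, hb, hyb, w, hw, hwT⟩)
          have hF : F k = (F (k + 1)).filter fun b => meetsB b ((grow B)^[k] S) := by
            simp only [F, List.filter_filter]
            refine List.filter_congr fun b _ => ?_
            rw [Bool.eq_iff_iff, Bool.and_eq_true, meetsB_iff, meetsB_iff]
            exact ⟨fun ⟨x, hx, h⟩ => ⟨⟨x, hx, h⟩, x, hx, hinc k h⟩, fun h => h.1⟩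
          rw [hF]
          exact List.length_filter_lt_length_iff_exists.2 ⟨b, hbF, hbn⟩
        omega
    intro h
    refine h _ (undivided_of_grow ?_) (hsub _)
    by_contra hcon
    have h1 := hcount _ hcon
    have h2 : (F B.length).length ≤ B.length := List.length_filter_le _ _
    omega

theorem connectedB_iff {N : Net} : connectedB N = true ↔ Coherent (linkingSetOf N) := by
  obtain ⟨Γ, Ls⟩ := N
  have hne : (linkingSetOf (Γ, Ls)).linkings.Nonempty ↔ Ls ≠ [] := by
    rw [linkingSetOf, List.toFinset_nonempty_iff, ne_eq, List.map_eq_nil_iff]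
  rw [Coherent, hne, connectedB, Bool.and_eq_true]
  refine and_congr (by simp) ?_
  cases Γ with
  | nil => simp [linkingSetOf]
  | cons F Γ =>
    have hF : F.leaves ∈ blocks (F :: Γ, Ls) := by simp [blocks]
    simp only [List.all_eq_true, List.contains_iff_mem, mem_reach hF F.leaves_ne_nil]
    constructor
    · intro h Z hcl x hx y hy hxZ
      have hZ := (undivided_blocks (N := (F :: Γ, Ls))).2 hcl
      obtain ⟨C, hC, hxC⟩ := Sequent.mem_leaves.1 hx
      obtain ⟨D, hD, hyD⟩ := Sequent.mem_leaves.1 hy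
      refine h D hD y hyD Z hZ ?_
      obtain ⟨z, hz⟩ := F.exists_mem_leaves
      -- The complement of an undivided set is undivided. Were `z` outside `Z`, the complement would
      -- contain the first root and hence everything reached from it, including `x`.
      have hzZ : z ∈ Z := by
        by_contra hzZ
        exact h C hC x hxC Zᶜ (fun b hb v hv w hw hvZ hwZ => hvZ (hZ b hb w hw v hv hwZ))
          (fun w hw hwZ => hzZ (hZ _ hF w hw z hz hwZ)) hxZ
      exact fun w hw => hZ _ hF z hz w hw hzZ
    · intro h C hC x hx Z hZ hFZ
      obtain ⟨z, hz⟩ := F.exists_mem_leaves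
      exact h Z ((undivided_blocks (N := (F :: Γ, Ls))).1 hZ) z (Sequent.mem_leaves.2 ⟨F, List.mem_cons_self, hz⟩) x (Sequent.mem_leaves.2 ⟨C, hC, hx⟩)
        (hFZ z hz)

theorem mem_sideB {N : Net} (h : N.1.WellNamed) {c : Conn} {A B : Formula}
    (hr : .bin c A B ∈ N.1) {x : ℕ} : x ∈ sideB N (.bin c A B) ↔
      x ∈ hull (N.1.subst (.bin c A B) [A, B]) (linkingSetOf N).linkings A := by
  have hA : A.leaves ∈ blocks (N.1.subst (.bin c A B) [A, B], N.2) := by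
    simp only [blocks, List.mem_append, List.mem_map]
    exact .inl ⟨A, (mem_subst hr).2 (.inl (by simp)), rfl⟩
  rw [sideB, h.substB_eq hr]
  refine (mem_reach hA A.leaves_ne_nil).trans ?_
  simp only [undivided_blocks]
  exact Iff.rfl

theorem hasLink_iff {mu : List (ℕ × ℕ)} {q : ℕ × ℕ} :
    hasLink mu q = true ↔ s(q.1, q.2) ∈ linkingOf mu := by
  simp only [hasLink, List.any_eq_true, mem_linkingOf, Bool.or_eq_true, Bool.and_eq_true, beq_iff_eq,
    Sym2.eq_iff]
  refine exists_congr fun p => and_congr_right fun _ => ?_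
  constructor <;> rintro (⟨h, h'⟩ | ⟨h, h'⟩) <;> simp [h, h']

theorem sameLinks_iff {lam mu : List (ℕ × ℕ)} :
    sameLinks lam mu = true ↔ linkingOf lam = linkingOf mu := by
  simp only [sameLinks, Bool.and_eq_true, List.all_eq_true, hasLink_iff]
  constructor
  · rintro ⟨h, h'⟩
    ext l
    constructor <;> intro hl <;> obtain ⟨q, hq, rfl⟩ := mem_linkingOf.1 hl
    exacts [h q hq, h' q hq]
  · exact fun h => ⟨fun q hq => h ▸ pair_mem_linkingOf hq, fun q hq => h ▸ pair_mem_linkingOf hq⟩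

theorem linkingOf_append (lam mu : List (ℕ × ℕ)) :
    linkingOf (lam ++ mu) = linkingOf lam ∪ linkingOf mu := by
  simp [linkingOf]

/-- No link crosses `T`, so it is enough that `inside` tests one end. -/
theorem linkingOf_inside {T : List ℕ} {ps : List (ℕ × ℕ)}
    (h : ∀ l ∈ linkingOf ps, (∀ x ∈ l, x ∈ T) ∨ ∀ x ∈ l, x ∉ T) :
    linkingOf (inside T ps) = onSet {x | x ∈ T} (linkingOf ps) := by
  ext l
  simp only [mem_onSet, mem_linkingOf, inside, List.mem_filter, List.contains_iff_mem]
  constructor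
  · rintro ⟨q, ⟨hq, hT⟩, rfl⟩
    exact ⟨⟨q, hq, rfl⟩, (h _ (pair_mem_linkingOf hq)).resolve_right fun h' => h' q.1 (by simp) hT⟩
  · rintro ⟨⟨q, hq, rfl⟩, hT⟩
    exact ⟨q, ⟨hq, hT q.1 (by simp)⟩, rfl⟩

theorem linkingOf_outside {T : List ℕ} {ps : List (ℕ × ℕ)}
    (h : ∀ l ∈ linkingOf ps, (∀ x ∈ l, x ∈ T) ∨ ∀ x ∈ l, x ∉ T) :
    linkingOf (outside T ps) = onSet {x | x ∈ T}ᶜ (linkingOf ps) := by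
  ext l
  simp only [mem_onSet, mem_linkingOf, outside, List.mem_filter, Bool.not_eq_true',
    ← Bool.not_eq_true, List.contains_iff_mem]
  constructor
  · rintro ⟨q, ⟨hq, hT⟩, rfl⟩
    exact ⟨⟨q, hq, rfl⟩, (h _ (pair_mem_linkingOf hq)).resolve_left fun h' => hT (h' q.1 (by simp))⟩
  · rintro ⟨⟨q, hq, rfl⟩, hT⟩
    exact ⟨q, ⟨hq, hT q.1 (by simp)⟩, rfl⟩

section Split

variable {N : Net} {r A B : Formula} {T : List ℕ}

theorem productB_iff (h : PreSplit (linkingSetOf N) r A B {x | x ∈ T}) :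
    productB T N.2 = true ↔ SplitBy (linkingSetOf N) r A B {x | x ∈ T} := by
  have hin := fun ps (hps : ps ∈ N.2) => linkingOf_inside (h.links _ (linkingOf_mem hps))
  have hout := fun ps (hps : ps ∈ N.2) => linkingOf_outside (h.links _ (linkingOf_mem hps))
  simp only [productB, List.all_eq_true, List.any_eq_true, sameLinks_iff, linkingOf_append]
  constructor
  · refine fun hp => ⟨h, fun lam hlam mu hmu => ?_⟩
    obtain ⟨ps, hps, rfl⟩ := mem_linkingSetOf.1 hlam
    obtain ⟨qs, hqs, rfl⟩ := mem_linkingSetOf.1 hmu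
    rw [← hin ps hps, ← hout qs hqs]
    exact mem_linkingSetOf.2 (hp ps hps qs hqs)
  · intro hs ps hps qs hqs
    rw [hin ps hps, hout qs hqs]
    exact mem_linkingSetOf.1 (hs.prod _ (linkingOf_mem hps) _ (linkingOf_mem hqs))

theorem linkingSetOf_halfIn (hN : N.1.WellNamed) (hr : r ∈ N.1)
    (h : PreSplit (linkingSetOf N) r A B {x | x ∈ T}) :
    linkingSetOf (halfIn N r A T) = half r A {x | x ∈ T} (linkingSetOf N) := by
  rw [linkingSetOf, half]
  congr 1
  · refine flatMap_congr_mem fun C hC => ?_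
    simp only [hN.meetsB_leaves hC hr]
    split_ifs with h1 h2 h3 h3
    · rfl
    · rfl
    · obtain ⟨x, hx, hxT⟩ := meetsB_iff.1 h2
      exact absurd ((h.roots C hC h1).resolve_right fun h' => h' x hx hxT) h3
    · obtain ⟨x, hx⟩ := C.exists_mem_leaves
      exact absurd (meetsB_iff.2 ⟨x, hx, h3 x hx⟩) h2
    · rfl
  · ext lam
    simp only [halfIn, List.mem_toFinset, List.mem_map, Finset.mem_image, mem_linkingSetOf,
      exists_exists_and_eq_and]
    refine exists_congr fun ps => and_congr_right fun hps => ?_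
    rw [linkingOf_inside (h.links _ (linkingOf_mem hps))]

theorem linkingSetOf_halfOut (hN : N.1.WellNamed) (hr : r ∈ N.1)
    (h : PreSplit (linkingSetOf N) r A B {x | x ∈ T}) :
    linkingSetOf (halfOut N r B T) = half r B {x | x ∈ T}ᶜ (linkingSetOf N) := by
  rw [linkingSetOf, half]
  congr 1
  · refine flatMap_congr_mem fun C hC => ?_
    simp only [hN.meetsB_leaves hC hr]
    split_ifs with h1 h2 h3 h3
    · rfl
    · obtain ⟨x, hx, hxT⟩ := meetsB_iff.1 h2
      exact absurd hxT (h3 x hx)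
    · rfl
    · rfl
    · exact absurd (fun x hx hxT => h2 (meetsB_iff.2 ⟨x, hx, hxT⟩)) h3
  · ext lam
    simp only [halfOut, List.mem_toFinset, List.mem_map, Finset.mem_image, mem_linkingSetOf,
      exists_exists_and_eq_and]
    refine exists_congr fun ps => and_congr_right fun hps => ?_
    rw [linkingOf_outside (h.links _ (linkingOf_mem hps))]

end Split

/-! ### Weight and size of nets, and correctness of one round -/

open WhileLang Enc

/-- A bound for the number of erasure steps. -/
def weightB (N : Net) : ℕ := N.2.length * N.1.vertices.length

/-- A version of `Branches.weight_lt` with free multiplicities: nets may list a linking several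
times, so lengths of lists take the place of cardinalities. -/
theorem Branches.sum_mul_lt {Λ : LinkingSet} (hΛ : Good Λ) {r : Formula} (hr : r ∈ Λ.seq)
    {Bs : List Sequent} (h : Branches Λ r Bs) {n : ℕ} (hn : 0 < n) {m : Sequent → ℕ}
    (hm : (Bs.map m).sum ≤ n) :
    (Bs.map fun As => m As * (branch r As Λ).numVertices).sum < n * Λ.numVertices := by
  have hlt : ∀ As ∈ Bs, (branch r As Λ).numVertices + 1 ≤ Λ.numVertices := by
    intro As hAs
    have := numVertices_branch hΛ hr As
    cases h <;> simp at hAs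
    · subst hAs; simp [Formula.vertices] at this; omega
    · rcases hAs with rfl | rfl <;> simp [Formula.vertices] at this <;> omega
    · subst hAs; simp [Formula.vertices] at this; omega
    · subst hAs; simp [Formula.vertices] at this; omega
  have hpos : 0 < Λ.numVertices := List.length_pos_of_mem (Sequent.root_mem_vertices hr)
  calc _ ≤ (Bs.map fun As => m As * (Λ.numVertices - 1)).sum :=
        List.sum_le_sum fun As hAs => Nat.mul_le_mul_left _ (Nat.le_sub_of_add_le (hlt As hAs))
    _ = (Bs.map m).sum * (Λ.numVertices - 1) := by rw [List.sum_map_mul_right]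
    _ ≤ n * (Λ.numVertices - 1) := Nat.mul_le_mul_right _ hm
    _ < _ := Nat.mul_lt_mul_of_pos_left (by omega) hn

theorem length_filter_add_le {β : Type*} {p q : β → Bool} {l : List β}
    (h : ∀ b ∈ l, p b = true → q b = true → False) :
    (l.filter p).length + (l.filter q).length ≤ l.length := by
  induction l with
  | nil => simp
  | cons b l ih =>
    have := ih fun c hc => h c (by simp [hc])
    have := h b (by simp)
    cases hp : p b <;> cases hq : q b <;> simp_all <;> omega

theorem Branches.sum_length_le {N : Net} (hΛ : Good (linkingSetOf N)) {r : Formula} (hr : r ∈ N.1)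
    {Bs : List Sequent} (h : Branches (linkingSetOf N) r Bs) :
    (Bs.map fun As => (branchB N r As).2.length).sum ≤ N.2.length := by
  have hle : ∀ As, (branchB N r As).2.length ≤ N.2.length := fun As => List.length_filter_le _ _
  cases h with
  | amp A B =>
    simp only [List.map_cons, List.map_nil, List.sum_cons, List.sum_nil, add_zero]
    refine length_filter_add_le fun ps hps hA hB => ?_
    rcases hΛ.resolves _ (linkingOf_mem hps) _ hr with h | h
    exacts [h.2 (touchB_leaves.1 hB), h.1 (touchB_leaves.1 hA)]
  | _ => simpa using hle _

/-- The list `E` of nets is the result of erasing the root `r` of `N`. -/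
inductive ErasesB (N : Net) (r : Formula) : List Net → Prop
  | branches {Bs : List Sequent} (h : Branches (linkingSetOf N) r Bs) :
      ErasesB N r (Bs.map fun As => branchB N r As)
  | split {A B : Formula} {T : List ℕ} (h : SplitBy (linkingSetOf N) r A B {x | x ∈ T}) :
      ErasesB N r [halfIn N r A T, halfOut N r B T]

section Erases

variable {N : Net} {r : Formula} {E : List Net}

theorem ErasesB.erases (hN : N.1.WellNamed) (hr : r ∈ N.1) (h : ErasesB N r E) :
    Erases (linkingSetOf N) r (E.map linkingSetOf) := by
  cases h with
  | @branches Bs h =>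
    rw [List.map_map, show linkingSetOf ∘ (fun As => branchB N r As) =
      fun As => branch r As (linkingSetOf N) from funext fun As => linkingSetOf_branchB hN hr As]
    exact .branches h
  | split h =>
    simp only [List.map_cons, List.map_nil, linkingSetOf_halfIn hN hr h.toPreSplit,
      linkingSetOf_halfOut hN hr h.toPreSplit]
    exact .split h

/-- Halving a net keeps all its n listed linkings on both sides, repetitions included. The decrease
in vertices is still enough, as n(v₀ + v₁) < nv. -/
theorem ErasesB.weight_lt (hΛ : Good (linkingSetOf N)) (hne : N.2 ≠ []) (hr : r ∈ N.1)
    (h : ErasesB N r E) : (E.map weightB).sum < weightB N := by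
  have hpos := List.length_pos_iff.2 hne
  cases h with
  | @branches Bs h =>
    have := h.sum_mul_lt hΛ hr hpos (h.sum_length_le hΛ hr)
    simp only [← linkingSetOf_branchB hΛ.named hr] at this
    rwa [List.map_map]
  | split h =>
    have hlt := h.numVertices_lt hΛ hr
    rw [← linkingSetOf_halfIn hΛ.named hr h.toPreSplit,
      ← linkingSetOf_halfOut hΛ.named hr h.toPreSplit] at hlt
    simp only [List.map_cons, List.map_nil, List.sum_cons, List.sum_nil, add_zero, weightB]
    rw [halfIn, halfOut, List.length_map, List.length_map, ← mul_add]
    exact Nat.mul_lt_mul_of_pos_left hlt hpos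

/-- The slack 2 is the size of a singleton list beyond that of its element. -/
theorem size_flatMap_le_size {β : Type} [Enc β] {l : List β} {f : β → List β}
    (h : ∀ b ∈ l, Enc.size (f b) ≤ Enc.size b + 2) : Enc.size (l.flatMap f) ≤ Enc.size l := by
  induction l with
  | nil => exact le_rfl
  | cons b l ih =>
    have h1 := ih fun c hc => h c (by simp [hc])
    have h2 := h b (by simp)
    have h3 := size_append (f b) (l.flatMap f)
    rw [List.flatMap_cons, size_cons]
    omega

theorem size_map_le {β : Type} [Enc β] {l : List β} {f : β → β}
    (h : ∀ b, Enc.size (f b) ≤ Enc.size b) : Enc.size (l.map f) ≤ Enc.size l := by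
  induction l with
  | nil => exact le_rfl
  | cons b l ih =>
    have := h b
    rw [List.map_cons, size_cons, size_cons]
    omega

theorem size_bin (c : Conn) (A B : Formula) :
    Enc.size (Formula.bin c A B) = Enc.size A + Enc.size B + 3 := rfl

theorem ErasesB.size_le (hN : N.1.WellNamed) (hr : r ∈ N.1) (h : ErasesB N r E) {M : Net}
    (hM : M ∈ E) : Enc.size M ≤ Enc.size N := by
  have mono : ∀ {M : Net}, Enc.size M.1 ≤ Enc.size N.1 → Enc.size M.2 ≤ Enc.size N.2 →
      Enc.size M ≤ Enc.size N := fun h h' => by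
    have h1 : ∀ M : Net, Enc.size M = Enc.size M.1 + Enc.size M.2 + 1 := fun _ => rfl
    rw [h1, h1]; omega
  cases h with
  | @branches Bs h =>
    obtain ⟨As, hAs, rfl⟩ := List.mem_map.1 hM
    refine mono (size_flatMap_le_size fun C hC => ?_) (size_le_of_sublist List.filter_sublist)
    simp only [hN.meetsB_leaves hC hr]
    split_ifs with he
    · subst he
      cases h <;> simp at hAs
      · subst hAs; simp only [size_cons, size_bin, size_nil]; omega
      · rcases hAs with rfl | rfl <;> simp only [size_cons, size_bin, size_nil] <;> omega
      · subst hAs; simp only [size_cons, size_bin, size_nil]; omega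
      · subst hAs; simp only [size_cons, size_bin, size_nil]; omega
    · simp only [size_cons, size_nil]; omega
  | @split A B T h =>
    have hsz : Enc.size A ≤ Enc.size r ∧ Enc.size B ≤ Enc.size r := by
      rcases h.eq with rfl | rfl <;> rw [size_bin] <;> omega
    simp only [List.mem_cons, List.not_mem_nil, or_false] at hM
    rcases hM with rfl | rfl
    all_goals
      refine mono (size_flatMap_le_size fun C hC => ?_)
        (size_map_le fun ps => size_le_of_sublist List.filter_sublist)
      simp only [hN.meetsB_leaves hC hr]
      split_ifs with he
      · subst he; simp only [size_cons, size_nil]; omega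
      all_goals simp only [size_cons, size_nil]; omega

theorem any_touchB {A : Formula} :
    (N.2.any fun lam => touchB A.leaves lam) = true ↔ (linkingSetOf N).Touches A := by
  rw [touches_iff, List.any_eq_true]
  simp only [touchB_iff, meets_single]
  constructor
  · rintro ⟨ps, hps, h⟩; exact ⟨_, linkingOf_mem hps, h⟩
  · rintro ⟨lam, hlam, h⟩
    obtain ⟨ps, hps, rfl⟩ := mem_linkingSetOf.1 hlam
    exact ⟨ps, hps, h⟩

theorem sideB_eq (hN : N.1.WellNamed) {c : Conn} {A B : Formula} (hr : .bin c A B ∈ N.1) :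
    {x | x ∈ sideB N (.bin c A B)} =
      hull (N.1.subst (.bin c A B) [A, B]) (linkingSetOf N).linkings A :=
  Set.ext fun _ => mem_sideB hN hr

/-- Soundness, for which connectedness is not needed: the computed side is a hull, and a hull that
misses `B` gives a split as soon as the product test succeeds. -/
theorem erasesB_of_mem (hΛ : Good (linkingSetOf N)) (hr : r ∈ N.1) (h : E ∈ eraseB N r) :
    ErasesB N r E := by
  rcases r with ⟨x, P⟩ | ⟨_ | _ | _ | _, A, B⟩
  · simp [eraseB, Formula.kind] at h
  · simp only [eraseB, Formula.kind, tensorB, Formula.left, Formula.right, beq_self_eq_true,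
      if_true, Bool.and_eq_true, Bool.not_eq_true', List.mem_ite_nil_right, List.mem_singleton] at h
    obtain ⟨⟨hm, hp⟩, rfl⟩ := h
    have hpre : PreSplit (linkingSetOf N) (.bin .tensor A B) A B
        {x | x ∈ sideB N (.bin .tensor A B)} := by
      rw [sideB_eq hΛ.named hr]
      refine preSplit_hull hr fun hB => ?_
      obtain ⟨y, hy⟩ := B.exists_mem_leaves
      rw [← Bool.not_eq_true, meetsB_iff] at hm
      exact hm ⟨y, hy, (mem_sideB hΛ.named hr).2 (hB y hy)⟩
    exact .split ((productB_iff hpre).1 hp)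
  · simp [eraseB, Formula.kind, Formula.left, Formula.right] at h
    subst h
    exact .branches (.par A B)
  · simp [eraseB, Formula.kind, Formula.left, Formula.right] at h
    subst h
    exact .branches (.amp A B)
  · rw [show eraseB N (.bin .plus A B) = plusB N (.bin .plus A B) from rfl, plusB] at h
    split_ifs at h with hB hA
    · simp at h
    · obtain rfl := List.mem_singleton.1 h
      exact .branches (.plus₁ A B (any_touchB.not.1 hA))
    · obtain rfl := List.mem_singleton.1 h
      exact .branches (.plus₀ A B (any_touchB.not.1 hB))

/-- Completeness. Connectedness identifies the components in the definition of readiness with the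
hull that is computed. -/
theorem eraseB_ne_nil (hΛ : Good (linkingSetOf N)) (hc : Coherent (linkingSetOf N)) (hr : r ∈ N.1)
    (h : (linkingSetOf N).Ready r) : eraseB N r ≠ [] := by
  rcases r with ⟨x, P⟩ | ⟨_ | _ | _ | _, A, B⟩
  · exact h.elim
  · have hs := h.splitBy hΛ hc hr
    erw [← sideB_eq hΛ.named hr] at hs
    have hm : meetsB B.leaves (sideB N (.bin .tensor A B)) = false := by
      rw [← Bool.not_eq_true, meetsB_iff]
      rintro ⟨y, hy, hyT⟩
      exact hs.right y hy hyT
    simp [eraseB, Formula.kind, tensorB, Formula.left, Formula.right, hm,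
      (productB_iff hs.toPreSplit).2 hs]
  · simp [eraseB, Formula.kind]
  · simp [eraseB, Formula.kind]
  · rw [show eraseB N (.bin .plus A B) = plusB N (.bin .plus A B) from rfl, plusB]
    split_ifs with hB hA
    · exact absurd h (not_or.2 ⟨not_not.2 (any_touchB.1 hA), not_not.2 (any_touchB.1 hB)⟩)
    all_goals simp

/-- On two leaves, goodness leaves no choice: a link joins dual labels, so it joins the two distinct
leaves, and every linking covers them. It remains to count the roots and to see that they are
leaves. -/
theorem axiomB_iff (hΛ : Good (linkingSetOf N)) (hne : (linkingSetOf N).linkings.Nonempty) :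
    axiomB N = true ↔ (linkingSetOf N).IsAxiom := by
  constructor
  · intro h
    obtain ⟨Γ, Ls⟩ := N
    rcases Γ with _ | ⟨F, _ | ⟨G, _ | ⟨H, Γ⟩⟩⟩
    · simp [axiomB] at h
    · simp [axiomB] at h
    swap
    · simp [axiomB] at h
    simp only [axiomB, List.all_cons, List.all_nil, Bool.and_eq_true, beq_iff_eq,
      Formula.kind_eq_zero] at h
    obtain ⟨⟨⟨x, P, rfl⟩, ⟨y, Q, rfl⟩, -⟩, -⟩ := h
    have key : ∀ lam ∈ (linkingSetOf ([.leaf x P, .leaf y Q], Ls)).linkings,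
        Q = P.dual ∧ lam = {s(x, y)} := by
      intro lam hlam
      have hl : ∀ l ∈ lam, Q = P.dual ∧ l = s(x, y) := by
        intro l hl
        obtain ⟨a, b, R, rfl, ha, hb⟩ := hΛ.dual lam hlam l hl
        simp only [linkingSetOf, Sequent.vertices, List.flatMap_cons, List.flatMap_nil,
          Formula.vertices, List.cons_append, List.nil_append, List.mem_cons, List.not_mem_nil,
          or_false, Formula.leaf.injEq] at ha hb
        rcases ha with ⟨rfl, rfl⟩ | ⟨rfl, rfl⟩ <;> rcases hb with ⟨rfl, hb⟩ | ⟨rfl, hb⟩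
        · exact absurd hb (Literal.dual_ne _)
        · exact ⟨hb.symm, rfl⟩
        · exact ⟨by rw [← hb, Literal.dual_dual], Sym2.eq_swap⟩
        · exact absurd hb (Literal.dual_ne _)
      obtain ⟨l, hl', -⟩ : Covered lam x := hΛ.resolves lam hlam (.leaf x P) (by simp [linkingSetOf])
      refine ⟨(hl l hl').1, Finset.eq_singleton_iff_unique_mem.2 ⟨?_, fun m hm => (hl m hm).2⟩⟩
      exact (hl l hl').2 ▸ hl'
    obtain ⟨lam, hlam⟩ := hne
    refine ⟨x, y, P, ?_, Finset.eq_singleton_iff_unique_mem.2 ⟨?_, fun mu hmu => (key mu hmu).2⟩⟩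
    · rw [(key lam hlam).1]; rfl
    · exact (key lam hlam).2 ▸ hlam
  · rintro ⟨x, y, P, hs, -⟩
    have hs : N.1 = _ := hs
    simp [axiomB, hs, Formula.kind]

theorem step_eq_nil (hΛ : Good (linkingSetOf N)) (h : step N = []) :
    outcome (linkingSetOf N) ≠ ⊥ := by
  rw [step] at h
  split_ifs at h with hc hax
  · have hc := connectedB_iff.1 hc
    rw [axiomB_iff hΛ hc.1] at hax
    rw [List.flatMap_eq_nil_iff] at h
    rw [outcome_stuck (hΛ.connected_iff.2 hc) hax fun r hr hready =>
      eraseB_ne_nil hΛ hc hr hready (h r hr)]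
    intro he
    exact Finset.singleton_ne_empty _ (WithTop.coe_injective he)
  · rw [connectedB_iff] at hc
    rw [outcome_of_not_coherent hΛ hc]
    exact WithTop.coe_ne_top.symm

theorem step_spec (hΛ : Good (linkingSetOf N)) (h : E ∈ step N) :
    (outcome (linkingSetOf N) = ⊥ ↔ ∀ M ∈ E, outcome (linkingSetOf M) = ⊥) ∧
      (∀ M ∈ E, Good (linkingSetOf M) ∧ Enc.size M ≤ Enc.size N) ∧
      (E.map weightB).sum < weightB N ∧ E.length ≤ 2 := by
  rw [step] at h
  split_ifs at h with hc hax
  · have hc := connectedB_iff.1 hc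
    rw [axiomB_iff hΛ hc.1] at hax
    obtain rfl := List.mem_singleton.1 h
    refine ⟨by simp [outcome_axiom hΛ hax], by simp, ?_, by simp⟩
    obtain ⟨lam, hlam⟩ := hc.1
    obtain ⟨ps, hps, -⟩ := mem_linkingSetOf.1 hlam
    obtain ⟨x, y, P, hs, -⟩ := hax
    have hs : N.1 = _ := hs
    rw [List.map_nil, List.sum_nil, weightB, hs]
    exact Nat.mul_pos (List.length_pos_of_mem hps) (by simp [Formula.vertices])
  · have hc := connectedB_iff.1 hc
    obtain ⟨r, hr, hE⟩ := List.mem_flatMap.1 h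
    have hE := erasesB_of_mem hΛ hr hE
    have he := hE.erases hΛ.named hr
    obtain ⟨lam, hlam⟩ := hc.1
    obtain ⟨ps, hps, -⟩ := mem_linkingSetOf.1 hlam
    refine ⟨?_, fun M hM => ⟨he.good hΛ hr (List.mem_map_of_mem hM), hE.size_le hΛ.named hr hM⟩,
      hE.weight_lt hΛ (List.ne_nil_of_mem hps) hr, ?_⟩
    · have := outcome_le_iff hΛ r hr _ he ⊥
      simpa only [le_bot_iff, List.forall_mem_map] using this
    · rcases hE with ⟨_ | _ | _ | _⟩ | _ <;> simp
  · simp at h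

end Erases

/-! ### The main loop -/

open WhileLang Enc

theorem vertices_length_le_size (Γ : Sequent) : Γ.vertices.length ≤ Enc.size Γ := by
  induction Γ with
  | nil => simp [Sequent.vertices]
  | cons F Γ ih =>
    have h1 := F.vertices_length_le_size
    have h2 : Enc.size F = F.size := rfl
    rw [Sequent.vertices_cons, List.length_append, size_cons]
    omega

theorem weightB_le (N : Net) : weightB N ≤ Enc.size N * Enc.size N := by
  have h0 : Enc.size N = Enc.size N.1 + Enc.size N.2 + 1 := rfl
  have h1 := length_lt_size N.2
  have h2 := vertices_length_le_size N.1
  exact Nat.mul_le_mul (by omega) (by omega)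

/-- The invariant of the main loop after `k` rounds on the input `N`. -/
structure LoopInvariant (N : Net) (k : ℕ) (x : List Net × Bool) : Prop where
  good : ∀ M ∈ x.1, Good (linkingSetOf M) ∧ Enc.size M ≤ Enc.size N
  outcome_iff : (x.2 = true ∧ ∀ M ∈ x.1, outcome (linkingSetOf M) = ⊥) ↔
    outcome (linkingSetOf N) = ⊥
  length_le : x.1.length ≤ k + 1
  -- Once the list is empty `process` is idle while `k` goes on counting, hence the restriction.
  weight_le : x.1 ≠ [] → k + (x.1.map weightB).sum ≤ weightB N

theorem LoopInvariant.process {N : Net} {k : ℕ} {x : List Net × Bool} (h : LoopInvariant N k x) :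
    LoopInvariant N (k + 1) (process x) := by
  obtain ⟨_ | ⟨M, rest⟩, b⟩ := x
  · exact ⟨h.good, h.outcome_iff, by simp [MALL.process], fun hne => (hne rfl).elim⟩
  · have hM := (h.good M (by simp)).1
    have hout := h.outcome_iff
    have hlen := h.length_le
    have hw := h.weight_le (by simp)
    simp only [List.forall_mem_cons, List.length_cons, List.map_cons, List.sum_cons] at hout hlen hw
    cases hs : step M with
    | nil =>
      have hp : MALL.process (M :: rest, b) = ([], false) := by simp [MALL.process, hs]
      rw [hp]
      refine ⟨by simp, ?_, by simp, by simp⟩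
      rw [← hout]
      simp [step_eq_nil hM hs]
    | cons E Es =>
      have hp : MALL.process (M :: rest, b) = (E ++ rest, b) := by simp [MALL.process, hs]
      obtain ⟨h1, h2, h3, h4⟩ := step_spec hM (E := E) (by simp [hs])
      rw [hp]
      refine ⟨fun L hL => ?_, ?_, ?_, fun _ => ?_⟩
      · rcases List.mem_append.1 hL with hL | hL
        · exact ⟨(h2 L hL).1, (h2 L hL).2.trans (h.good M (by simp)).2⟩
        · exact h.good L (by simp [hL])
      · rw [← hout, h1]
        simp only [List.forall_mem_append]
      · simp only [List.length_append]; omega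
      · simp only [List.map_append, List.sum_append]; omega

theorem loopInvariant_iterate {N : Net} (hN : Good (linkingSetOf N)) (k : ℕ) :
    LoopInvariant N k (process^[k] ([N], true)) := by
  induction k with
  | zero => exact ⟨by simp [hN], by simp, by simp, by simp⟩
  | succ k ih =>
    rw [Function.iterate_succ_apply']
    exact ih.process

/-- A net that represents a good linking-set. -/
abbrev GoodNet := {N : Net // Good (linkingSetOf N)}

/-- Goodness is a promise and not tested: an element is encoded as the bare net, and running times
are claimed only where the promise holds. -/
instance : Enc GoodNet := ⟨fun N => Enc.enc N.1, fun N => Enc.size N.1⟩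

open Polynomial in
/-- Erasability is decidable in polynomial time. -/
theorem exists_polyTime_outcome :
    ∃ f : GoodNet → Bool, PolyTime f ∧ ∀ N, f N = true ↔ outcome (linkingSetOf N.1) = ⊥ := by
  have hex : ∀ N : GoodNet, ∃ n ≤ weightB N.1 + 1,
      (∀ k < n, (process^[k] ([N.1], true)).1 ≠ []) ∧ (process^[n] ([N.1], true)).1 = [] := by
    intro N
    -- A list still non-empty after this many rounds would contradict the weight bound of the
    -- invariant.
    have hend : (process^[weightB N.1 + 1] ([N.1], true)).1 = [] := by
      by_contra hne
      have := (loopInvariant_iterate N.2 _).weight_le hne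
      omega
    classical
    have hfind : ∃ n, (process^[n] ([N.1], true)).1 = [] := ⟨_, hend⟩
    exact ⟨Nat.find hfind, Nat.find_min' hfind hend, fun k hk => Nat.find_min hfind hk,
      Nat.find_spec hfind⟩
  choose n hn hlt hnil using hex
  refine ⟨fun N => (process^[n N] ([N.1], true)).2, PolyTime.snd.comp ?_, fun N => ?_⟩
  · have hval : PolyTime fun N : GoodNet => N.1 :=
      PolyTime.ofExpr (.var 0) X (fun _ _ hs => hs) fun _ => by rw [eval_X]; exact le_rfl
    refine PolyTime.iterate (i := fun N : GoodNet => ([N.1], true)) (cond := fun x => !x.1.isEmpty)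
      ((hval.cons PolyTime.nil).pair PolyTime.true) polyTime_process PolyTime.fst.isEmpty.not
      -- At most X² + 2 nets of size at most X, each with 1 for its place in the list, then 1 for
      -- the end of the list and 2 for the flag and the pair.
      ((X * X + 2) * (X + 1) + 3) fun N => ⟨n N, ?_, fun k hk => ?_, ?_, fun k hk => ?_, rfl⟩
    all_goals have hW := weightB_le N.1
    all_goals have hS : Enc.size N = Enc.size N.1 := rfl
    · have := hn N
      simp only [eval_add, eval_mul, eval_X, eval_one, eval_ofNat, hS]
      nlinarith
    · simpa using hlt N k hk
    · simp [hnil N]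
    · have h := loopInvariant_iterate N.2 k
      have h1 := size_le_length_mul fun M hM => (h.good M hM).2
      have h2 : (process^[k] ([N.1], true)).1.length ≤ Enc.size N.1 * Enc.size N.1 + 2 := by
        have := h.length_le
        have := hn N
        omega
      have h3 := Nat.mul_le_mul_right (Enc.size N.1 + 1) h2
      rw [← Prod.mk.eta (p := process^[k] ([N.1], true)), size_pair]
      have h4 : ∀ b : Bool, Enc.size b = 1 := fun _ => rfl
      rw [h4]
      simp only [eval_add, eval_mul, eval_X, eval_one, eval_ofNat, hS]
      omega
  · have := (loopInvariant_iterate N.2 (n N)).outcome_iff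
    rw [← this]
    simp [hnil N]

/-! ### Renaming of leaves -/

/-- Rename the leaves of a formula. -/
def Formula.rename (f : ℕ → ℕ) : Formula → Formula
  | .leaf x P => .leaf (f x) P
  | .bin c A B => .bin c (A.rename f) (B.rename f)

/-- Rename the leaves of a linking-set. -/
def LinkingSet.rename (f : ℕ → ℕ) (Λ : LinkingSet) : LinkingSet :=
  ⟨Λ.seq.map (Formula.rename f), Λ.linkings.image (Finset.image (Sym2.map f))⟩

variable {f : ℕ → ℕ}

theorem Formula.leaves_rename (F : Formula) : (F.rename f).leaves = F.leaves.map f := by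
  induction F with
  | leaf x P => rfl
  | bin c A B ihA ihB => simp [rename, leaves, ihA, ihB]

theorem Formula.vertices_rename (F : Formula) :
    (F.rename f).vertices = F.vertices.map (Formula.rename f) := by
  induction F with
  | leaf x P => rfl
  | bin c A B ihA ihB => simp [rename, vertices, ihA, ihB]

theorem Sequent.leaves_rename (Γ : Sequent) :
    Sequent.leaves (Γ.map (Formula.rename f)) = Γ.leaves.map f := by
  simp [leaves, List.flatMap_map, List.map_flatMap, Formula.leaves_rename]

theorem Sequent.vertices_rename (Γ : Sequent) :
    Sequent.vertices (Γ.map (Formula.rename f)) = Γ.vertices.map (Formula.rename f) := by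
  simp [vertices, List.flatMap_map, List.map_flatMap, Formula.vertices_rename]

theorem Formula.enc_rename (F : Formula) : (F.rename f).enc id = F.enc f := by
  induction F with
  | leaf x P => rfl
  | bin c A B ihA ihB => simp [rename, enc, ihA, ihB]

theorem covered_image {lam : Finset Link} {S : Set ℕ} (hf : Set.InjOn f S)
    (hS : ∀ l ∈ lam, ∀ x ∈ l, x ∈ S) {x : ℕ} (hx : x ∈ S) :
    Covered (lam.image (Sym2.map f)) (f x) ↔ Covered lam x := by
  constructor
  · rintro ⟨l', hl', hxl⟩
    obtain ⟨l, hl, rfl⟩ := Finset.mem_image.1 hl'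
    obtain ⟨y, hy, he⟩ := Sym2.mem_map.1 hxl
    exact ⟨l, hl, hf (hS l hl y hy) hx he ▸ hy⟩
  · rintro ⟨l, hl, hxl⟩
    exact ⟨_, Finset.mem_image_of_mem _ hl, Sym2.mem_map.2 ⟨x, hxl, rfl⟩⟩

theorem meets_image {lam : Finset Link} {S : Set ℕ} (hf : Set.InjOn f S)
    (hS : ∀ l ∈ lam, ∀ x ∈ l, x ∈ S) {F : Formula} (hF : ∀ x ∈ F.leaves, x ∈ S) :
    Meets (lam.image (Sym2.map f)) [F.rename f] ↔ Meets lam [F] := by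
  simp only [meets_single, Formula.leaves_rename, List.mem_map]
  constructor
  · rintro ⟨_, ⟨x, hx, rfl⟩, h⟩; exact ⟨x, hx, (covered_image hf hS (hF x hx)).1 h⟩
  · rintro ⟨x, hx, h⟩; exact ⟨_, ⟨x, hx, rfl⟩, (covered_image hf hS (hF x hx)).2 h⟩

theorem resolves_image {lam : Finset Link} {S : Set ℕ} (hf : Set.InjOn f S)
    (hS : ∀ l ∈ lam, ∀ x ∈ l, x ∈ S) {F : Formula} (hF : ∀ x ∈ F.leaves, x ∈ S) :
    Resolves (lam.image (Sym2.map f)) (F.rename f) ↔ Resolves lam F := by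
  induction F with
  | leaf x P => exact covered_image hf hS (hF x (by simp [Formula.leaves]))
  | bin c A B ihA ihB =>
    simp only [Formula.leaves, List.mem_append] at hF
    have hA := fun x hx => hF x (.inl hx)
    have hB := fun x hx => hF x (.inr hx)
    cases c <;> simp only [Formula.rename, Resolves, ihA hA, ihB hB, meets_image hf hS hA,
      meets_image hf hS hB]

theorem Good.rename {Λ : LinkingSet} (h : Good Λ) (hf : Set.InjOn f {x | x ∈ Λ.seq.leaves}) :
    Good (Λ.rename f) where
  named := by
    rw [Sequent.WellNamed, LinkingSet.rename, Sequent.leaves_rename]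
    exact h.named.map_on fun x hx y hy he => hf hx hy he
  dual lam' hlam' l' hl' := by
    obtain ⟨lam, hlam, rfl⟩ := Finset.mem_image.1 hlam'
    obtain ⟨l, hl, rfl⟩ := Finset.mem_image.1 hl'
    obtain ⟨x, y, P, rfl, hx, hy⟩ := h.dual lam hlam l hl
    simp only [LinkingSet.rename, Sequent.vertices_rename]
    exact ⟨f x, f y, P, by simp, List.mem_map.2 ⟨_, hx, rfl⟩, List.mem_map.2 ⟨_, hy, rfl⟩⟩
  resolves lam' hlam' F' hF' := by
    obtain ⟨lam, hlam, rfl⟩ := Finset.mem_image.1 hlam'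
    obtain ⟨F, hF, rfl⟩ := List.mem_map.1 hF'
    exact (resolves_image hf (fun l hl x hx => h.mem_leaves hlam hl hx)
      fun x hx => leaves_subset hF hx).2 (h.resolves lam hlam F hF)

/-- No injectivity is needed, because the rules themselves put no condition on names. -/
theorem Proof.translates_rename {Γ : Sequent} (p : Proof Γ) :
    Translates (Γ.map (Formula.rename f)) (p.translate.image (Finset.image (Sym2.map f))) := by
  induction p with
  | ax x y P => exact ⟨.ax (f x) (f y) P, by simp [translate]⟩
  | perm h p ih => exact ih.perm (h.map _)
  | par p ih =>
    rw [List.map_append] at ih ⊢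
    obtain ⟨q, hq⟩ := ih
    exact ⟨q.par, hq⟩
  | plus₀ B p ih =>
    rw [List.map_append] at ih ⊢
    obtain ⟨q, hq⟩ := ih
    exact ⟨q.plus₀ _, hq⟩
  | plus₁ A p ih =>
    rw [List.map_append] at ih ⊢
    obtain ⟨q, hq⟩ := ih
    exact ⟨q.plus₁ _, hq⟩
  | tensor p q ihp ihq =>
    rw [List.map_append] at ihp ⊢
    rw [List.map_cons] at ihq ⊢
    obtain ⟨p', hp⟩ := ihp
    obtain ⟨q', hq⟩ := ihq
    refine ⟨p'.tensor q', ?_⟩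
    simp only [translate, hp, hq]
    exact (Finset.image_image₂_distrib fun a b => Finset.image_union a b).symm
  | amp p q ihp ihq =>
    rw [List.map_append] at ihp ihq ⊢
    obtain ⟨p', hp⟩ := ihp
    obtain ⟨q', hq⟩ := ihq
    exact ⟨p'.amp q', by simp only [translate, hp, hq, Finset.image_union]⟩

theorem LinkingSet.Sequentializable.rename {Λ : LinkingSet} (h : Λ.Sequentializable) (f : ℕ → ℕ) :
    (Λ.rename f).Sequentializable := by
  obtain ⟨p, hp⟩ := h
  have := p.translates_rename (f := f)
  rwa [hp] at this

theorem Formula.rename_rename {g : ℕ → ℕ} {F : Formula} (h : ∀ x ∈ F.leaves, g (f x) = x) :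
    (F.rename f).rename g = F := by
  induction F with
  | leaf x P => simp [rename, h x (by simp [leaves])]
  | bin c A B ihA ihB =>
    simp only [leaves, List.mem_append] at h
    simp only [rename, ihA fun x hx => h x (.inl hx), ihB fun x hx => h x (.inr hx)]

theorem Good.rename_rename {Λ : LinkingSet} (hΛ : Good Λ) {g : ℕ → ℕ}
    (h : ∀ x ∈ Λ.seq.leaves, g (f x) = x) : (Λ.rename f).rename g = Λ := by
  obtain ⟨Γ, K⟩ := Λ
  simp only [LinkingSet.rename, List.map_map, Finset.image_image, LinkingSet.mk.injEq]
  constructor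
  · refine (List.map_congr_left fun F hF => ?_).trans (List.map_id Γ)
    exact Formula.rename_rename fun x hx => h x (leaves_subset hF hx)
  · refine (Finset.image_congr fun lam hlam => ?_).trans Finset.image_id
    simp only [Function.comp, Finset.image_image, id]
    refine (Finset.image_congr fun l hl => ?_).trans Finset.image_id
    obtain ⟨x, y, P, rfl, hx, hy⟩ := hΛ.dual lam hlam l hl
    simp [h x (Sequent.mem_leaves_iff.2 ⟨_, hx⟩), h y (Sequent.mem_leaves_iff.2 ⟨_, hy⟩)]

/-- Links of a good set end in leaves of its sequent, so an inverse of `f` on those leaves undoes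
the renaming. -/
theorem Good.sequentializable_rename {Λ : LinkingSet} (hΛ : Good Λ)
    (hf : Set.InjOn f {x | x ∈ Λ.seq.leaves}) :
    (Λ.rename f).Sequentializable ↔ Λ.Sequentializable := by
  refine ⟨fun h => ?_, fun h => h.rename f⟩
  have := h.rename (Function.invFunOn f {x | x ∈ Λ.seq.leaves})
  rwa [hΛ.rename_rename fun x hx => hf.leftInvOn_invFunOn hx] at this

/-! ### The machine input -/

/-- The net with the leaves renamed. -/
def renameNet (f : ℕ → ℕ) (N : Net) : Net :=
  (N.1.map (Formula.rename f), N.2.map fun ps => ps.map fun q => (f q.1, f q.2))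

/-- The algorithm takes leaf names at face value; numbering the leaves in the input amounts to
renaming them by position, which also bounds the names by the number of vertices. -/
theorem input_eq (Γ : Sequent) (Ls : List (List (ℕ × ℕ))) :
    input Γ Ls = Enc.enc (renameNet Γ.pos (Γ, Ls)) := by
  have hmap : ∀ {β γ : Type} (g : β → γ) (e : γ → Data) (l : List β),
      encList e (l.map g) = encList (fun b => e (g b)) l := by
    intro β γ g e l
    induction l with
    | nil => rfl
    | cons b l ih => simp [encList, ih]
  simp only [Enc.enc, renameNet, hmap, input, Formula.enc_rename]

theorem linkingSetOf_renameNet (N : Net) :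
    linkingSetOf (renameNet f N) = (linkingSetOf N).rename f := by
  have hl : ∀ ps : List (ℕ × ℕ), linkingOf (ps.map fun q => (f q.1, f q.2)) =
      (linkingOf ps).image (Sym2.map f) := by
    intro ps
    ext l
    simp [mem_linkingOf]
  simp only [linkingSetOf, renameNet, LinkingSet.rename, LinkingSet.mk.injEq, true_and]
  ext lam
  simp [hl]

/-! ### Size of the input in terms of links and vertices -/

theorem Formula.size_le {F : Formula} {n : ℕ} (h : ∀ x ∈ F.leaves, x < n) :
    F.size ≤ F.vertices.length * (n + 3) := by
  induction F with
  | leaf x P =>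
    have := h x (by simp [leaves])
    simp [size, vertices]; omega
  | bin c A B ihA ihB =>
    simp only [leaves, List.mem_append] at h
    have hA := ihA fun x hx => h x (.inl hx)
    have hB := ihB fun x hx => h x (.inr hx)
    simp only [size, vertices, List.length_cons, List.length_append, add_mul, one_mul]
    omega

theorem Sequent.size_le {Γ : Sequent} {n : ℕ} (h : ∀ x ∈ Γ.leaves, x < n) :
    Enc.size Γ ≤ Γ.vertices.length * (n + 4) + 1 := by
  induction Γ with
  | nil => simp
  | cons F Γ ih =>
    simp only [leaves_cons, List.mem_append] at h
    have h1 := ih fun x hx => h x (.inr hx)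
    have h2 := Formula.size_le fun x hx => h x (.inl hx)
    have h3 := F.vertices_length_pos
    have h4 : Enc.size F = F.size := rfl
    have h5 : F.vertices.length * (n + 4) = F.vertices.length * (n + 3) + F.vertices.length := by
      ring
    rw [size_cons, vertices_cons, List.length_append, add_mul]
    omega

theorem size_links_le {ps : List (ℕ × ℕ)} {n : ℕ} (h : ∀ q ∈ ps, q.1 < n ∧ q.2 < n) :
    Enc.size ps ≤ ps.length * (2 * n + 4) + 1 := by
  refine size_le_length_mul fun q hq => ?_
  have h1 : Enc.size q = q.1 + 1 + (q.2 + 1) + 1 := rfl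
  have := h q hq
  omega

/-- Each listed linking costs an overhead of 2, charged to its links at 2 apiece; this is why
linkings have to be non-empty. -/
theorem size_linkings_le {Ls : List (List (ℕ × ℕ))} {n : ℕ} (hne : ∀ ps ∈ Ls, ps ≠ [])
    (h : ∀ ps ∈ Ls, ∀ q ∈ ps, q.1 < n ∧ q.2 < n) :
    Enc.size Ls ≤ (Ls.map List.length).sum * (2 * n + 6) + 1 := by
  induction Ls with
  | nil => simp
  | cons ps Ls ih =>
    have h1 := ih (fun qs hqs => hne qs (by simp [hqs])) fun qs hqs => h qs (by simp [hqs])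
    have h2 := size_links_le (h ps (by simp))
    have h3 := List.length_pos_iff.2 (hne ps (by simp))
    have h4 : ps.length * (2 * n + 6) = ps.length * (2 * n + 4) + 2 * ps.length := by ring
    rw [size_cons, List.map_cons, List.sum_cons, add_mul]
    omega

theorem Formula.leaves_length_le (F : Formula) : F.leaves.length ≤ F.vertices.length := by
  induction F with
  | leaf x P => simp [leaves, vertices]
  | bin c A B ihA ihB => simp [leaves, vertices]; omega

theorem Sequent.leaves_length_le (Γ : Sequent) : Γ.leaves.length ≤ Γ.vertices.length := by
  induction Γ with
  | nil => simp
  | cons F Γ ih =>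
    have := F.leaves_length_le
    simp only [leaves_cons, vertices_cons, List.length_append]
    omega

theorem Sequent.pos_lt {Γ : Sequent} {x : ℕ} (hx : x ∈ Γ.leaves) : Γ.pos x < Γ.vertices.length :=
  (List.idxOf_lt_length_of_mem hx).trans_le Γ.leaves_length_le

theorem Sequent.pos_injOn (Γ : Sequent) : Set.InjOn Γ.pos {x | x ∈ Γ.leaves} :=
  fun _ hx _ _ h => (List.idxOf_inj hx).1 h

theorem Lists.linkingSetOf_eq {Λ : LinkingSet} {Ls : List (List (ℕ × ℕ))} (h : Lists Ls Λ) :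
    linkingSetOf (Λ.seq, Ls) = Λ := by
  rw [linkingSetOf, h.2.2]

theorem Lists.sum_length {Λ : LinkingSet} {Ls : List (List (ℕ × ℕ))} (h : Lists Ls Λ) :
    (Ls.map List.length).sum = Λ.numLinks := by
  rw [LinkingSet.numLinks, ← h.2.2, List.sum_toFinset _ h.2.1, List.map_map]
  refine congrArg List.sum (List.map_congr_left fun ps hps => ?_)
  rw [Function.comp, linkingOf, List.toFinset_card_of_nodup (h.1 ps hps), List.length_map]

theorem Lists.size_le {Λ : LinkingSet} {Ls : List (List (ℕ × ℕ))} (h : Lists Ls Λ)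
    (hΛ : Λ.Valid) : Enc.size (renameNet Λ.seq.pos (Λ.seq, Ls)) ≤
      Λ.numVertices * (Λ.numVertices + 4) + Λ.numLinks * (2 * Λ.numVertices + 6) + 3 := by
  have hmem : ∀ ps ∈ Ls, linkingOf ps ∈ Λ.linkings := fun ps hps => by
    rw [← h.2.2]; exact List.mem_toFinset.2 (List.mem_map_of_mem hps)
  have h1 : Enc.size (Λ.seq.map (Formula.rename Λ.seq.pos)) ≤ _ :=
    Sequent.size_le (n := Λ.numVertices) fun x hx => by
      rw [Sequent.leaves_rename] at hx
      obtain ⟨y, hy, rfl⟩ := List.mem_map.1 hx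
      exact Sequent.pos_lt hy
  have h2 := size_linkings_le (n := Λ.numVertices)
    (Ls := Ls.map fun ps => ps.map fun q => (Λ.seq.pos q.1, Λ.seq.pos q.2))
    (List.forall_mem_map.2 fun ps hps => by
      obtain ⟨l, hl⟩ := (hΛ.2 _ (hmem ps hps)).1
      obtain ⟨q, hq, -⟩ := mem_linkingOf.1 hl
      simpa using List.ne_nil_of_mem hq)
    (List.forall_mem_map.2 fun ps hps => List.forall_mem_map.2 fun q hq =>
      have hl := fun {x} => hΛ.good.mem_leaves (x := x) (hmem ps hps) (pair_mem_linkingOf hq)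
      ⟨Sequent.pos_lt (hl (by simp)), Sequent.pos_lt (hl (by simp))⟩)
  rw [Sequent.vertices_rename, List.length_map] at h1
  rw [List.map_map, show List.length ∘ (fun ps : List (ℕ × ℕ) => ps.map fun q =>
    (Λ.seq.pos q.1, Λ.seq.pos q.2)) = List.length from funext fun ps => List.length_map _,
    h.sum_length] at h2
  rw [renameNet, size_pair]
  dsimp only
  have h3 : Λ.seq.vertices.length = Λ.numVertices := rfl
  rw [h3] at h1
  omega

open Polynomial in
/-- Sequentializability is decidable in polynomial time. -/
theorem exists_prog_sequentializable : ∃ (prog : Prog) (p : Polynomial ℕ),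
    ∀ (Λ : LinkingSet) (Ls : List (List (ℕ × ℕ))), Λ.Valid → Lists Ls Λ →
      ∃ (s : Store) (t : ℕ), Exec prog (initStore (input Λ.seq Ls)) s t ∧
        t ≤ p.eval (Λ.numLinks + Λ.numVertices) ∧ (s 0 ≠ .nil ↔ Λ.Sequentializable) := by
  obtain ⟨f, ⟨c, p, hc⟩, hf⟩ := exists_polyTime_outcome
  refine ⟨c, p.comp (X * (X + 4) + X * (2 * X + 6) + 3), fun Λ Ls hΛ hL => ?_⟩
  have hr : linkingSetOf (renameNet Λ.seq.pos (Λ.seq, Ls)) = Λ.rename Λ.seq.pos := by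
    rw [linkingSetOf_renameNet, hL.linkingSetOf_eq]
  have hinj := Λ.seq.pos_injOn
  have hgood := hΛ.good.rename hinj
  let N : GoodNet := ⟨renameNet Λ.seq.pos (Λ.seq, Ls), hr ▸ hgood⟩
  obtain ⟨t, ht, he⟩ := (hc N).1 (initStore (input Λ.seq Ls)) (by simp [initStore, input_eq]; rfl)
  refine ⟨_, t, he, ht.trans ?_, ?_⟩
  · rw [eval_comp]
    refine eval_mono p ((hL.size_le hΛ).trans ?_)
    simp only [eval_add, eval_mul, eval_X, eval_ofNat]
    have hv : Λ.numVertices ≤ Λ.numLinks + Λ.numVertices := by omega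
    have hl : Λ.numLinks ≤ Λ.numLinks + Λ.numVertices := by omega
    gcongr
  · rw [Function.update_self]
    have h1 : Enc.enc (f N) ≠ .nil ↔ f N = true := by
      cases f N <;> simp [Enc.enc]
    rw [h1, hf, hr, ← sequentializable_iff hgood, hΛ.good.sequentializable_rename hinj]

end MALL

/-- Polynomial-time correctness of slice nets, by erasure. -/
theorem mainTheorem8 :
    -- correctness (being the translation of a proof) is decidable in polynomial time
    (∃ (prog : WhileLang.Prog) (p : Polynomial ℕ),
      ∀ (Λ : MALL.LinkingSet) (Ls : List (List (ℕ × ℕ))), Λ.Valid → MALL.Lists Ls Λ →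
        ∃ (s : WhileLang.Store) (t : ℕ),
          WhileLang.Exec prog (WhileLang.initStore (MALL.input Λ.seq Ls)) s t ∧
          t ≤ p.eval (Λ.numLinks + Λ.numVertices) ∧
          (s 0 ≠ .nil ↔ Λ.Sequentializable)) ∧
    -- erasure is confluent
    (∀ X Y₀ Y₁ : MALL.Cluster, X.Valid → MALL.Steps X Y₀ → MALL.Steps X Y₁ →
      ∃ Z, MALL.Steps Y₀ Z ∧ MALL.Steps Y₁ Z) ∧
    -- erasure is terminating (strongly normalising)
    (∀ X : MALL.Cluster, X.Valid → Acc (fun Y Y' => MALL.Step Y' Y) X) ∧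
    -- all erasure paths have polynomially bounded length
    (∃ p : Polynomial ℕ, ∀ Λ : MALL.LinkingSet, Λ.Valid →
      ∀ (n : ℕ) (f : ℕ → MALL.Cluster), f 0 = .sets {Λ} →
        (∀ i < n, MALL.Step (f i) (f (i + 1))) →
        n ≤ p.eval (Λ.numLinks + Λ.numVertices)) ∧
    -- erasability coincides with sequentializability
    (∀ Λ : MALL.LinkingSet, Λ.Valid → (Λ.Erasable ↔ Λ.Sequentializable)) :=
  ⟨MALL.exists_prog_sequentializable,
    fun _ _ _ hX h₀ h₁ => MALL.erasure_confluent hX.good h₀ h₁,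
    fun _ hX => MALL.erasure_terminating hX.good,
    ⟨1 + .X * .X, fun Λ hΛ n f h₀ h => by simpa using MALL.erasure_length_bound hΛ h₀ h⟩,
    fun _ hΛ => (MALL.erasable_iff hΛ.good).trans (MALL.sequentializable_iff hΛ.good).symm⟩
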